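/- Let $\mathcal N$ be a von Neumann algebra on a complex Hilbert space $\mathcal H$ with a faithful normal semifinite trace $\tau$. For $S\in\mathcal N$ and $t>0$ let $\mu_t(S)=\inf\{\|SE\| : E\in\mathcal N \text{ a projection},\ \tau(1-E)\le t\}$, and let $\mathcal K(\mathcal N)=\{T\in\mathcal N:\lim_{t\to\infty}\mu_t(T)=0\}$. Put $\psi_1(t)=\log(1+t)$ and, for $p>1$, $\psi_p(t)=t$ for $0\le t\le 1$, $\psi_p(t)=t^{1-1/p}$ for $t\ge 1$; let $$\mathcal L^{(p,\infty)}=\Big\{T\in\mathcal N:\ \sup_{t>0}\frac1{\psi_p(t)}\int_0^t\mu_s(T)\,ds<\infty\Big\}.$$ A spectral triple $(\mathcal A,\mathcal H,\mathcal D)$ consists of a $*$-subalgebra $\mathcal A\subset\mathcal N$ and a self-adjoint operator $\mathcal D$ on $\mathcal H$ affiliated to $\mathcal N$ such that, for all $a\in\mathcal A$, $[\mathcal D,a]$ is densely defined and extends to a bounded operator in $\mathcal N$ (again written $[\mathcal D,a]$), and $(\lambda-\mathcal D)^{-1}\in\mathcal K(\mathcal N)$ for all $\lambda\in\mathbb C\setminus\mathbb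 R$. It is even if there is given a grading $\Gamma\in\mathcal N$ with $\Gamma=\Gamma^*$, $\Gamma^2=1$, $\Gamma a=a\Gamma$ for all $a\in\mathcal A$, and $\mathcal D\Gamma+\Gamma\mathcal D=0$; otherwise it is odd and we put $\Gamma=1$. Let $\delta(T)=[|\mathcal D|,T]$, with domain the set of $T\in\mathcal N$ that map $\mathrm{dom}|\mathcal D|$ into itself and for which $[|\mathcal D|,T]$ extends to a bounded operator. The triple is $QC^1$ if $a$ and $[\mathcal D,a]$ lie in $\mathrm{dom}\,\delta$ and $\delta(a),\delta([\mathcal D,a])\in\mathcal N$ for all $a\in\mathcal A$; it is $(p,\infty)$-summable if $(1+\mathcal D^2)^{-1/2}\in\mathcal L^{(p,\infty)}$. A Dixmier functional is a positive linear functional $\omega$ on $L^\infty(0,\infty)$ that agrees with the ordinary limit on functions having a limit at infinity and is invariant under all dilations $f\mapsto f(c\,\cdot)$, $c>0$ (for example, the composition of any positive functional that agrees with the limit at infinity with the Cesàro mean $Mg(t)=\frac1{\log t}\int_1^t g(s)\frac{ds}{s}$). The Dixmier trace $\tau_\omega$ on $\mathcal L^{(1,\infty)}$ is the linear extension of $T\mapsto\omega\Big(t\mapsto\frac1{\log(1+t)}\int_0^t\mu_s(T)\,ds\Big)$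 from the positive operators $T\in\mathcal L^{(1,\infty)}$. **Lemma.** Let $p\ge1$ be an integer, let $(\mathcal A,\mathcal H,\mathcal D)$ be a $QC^1$ $(p,\infty)$-summable spectral triple, and let $\omega$ be a Dixmier functional. Then for all $a_0,\dots,a_p\in\mathcal A$ the operator $\Gamma a_0[\mathcal D,a_1]\cdots[\mathcal D,a_p](1+\mathcal D^2)^{-p/2}$ lies in $\mathcal L^{(1,\infty)}$, and $$\phi_\omega(a_0,\dots,a_p)=\lambda_p\,\tau_\omega\big(\Gamma a_0[\mathcal D,a_1]\cdots[\mathcal D,a_p](1+\mathcal D^2)^{-p/2}\big)$$ is a Hochschild cocycle on $\mathcal A$: it is a $(p+1)$-multilinear functional, continuous for the norm $\|a\|+\|[\mathcal D,a]\|$ on $\mathcal A$, and $b\phi_\omega=0$. Here $\lambda_p=(-1)^{p(p-1)/2}\,\Gamma(\tfrac p2+1)$ for $p$ even and $\lambda_p=\sqrt{2i}\,(-1)^{p(p-1)/2}\,\Gamma(\tfrac p2+1)$ for $p$ odd (in these two formulas $\Gamma$ is the gamma function), and $$(b\phi)(a_0,\dots,a_{p+1})=\sum_{i=0}^{p}(-1)^i\phi(a_0,\dots,a_ia_{i+1},\dots,a_{p+1})+(-1)^{p+1}\phi(a_{p+1}a_0,a_1,\dots,a_p).$$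 -/

import Mathlib

open scoped ENNReal NNReal Topology ComplexStarModule InnerProductSpace
open MeasureTheory Filter

noncomputable section

namespace SemifiniteNCG

section Trace

variable {H : Type*} [NormedAddCommGroup H] [InnerProductSpace ℂ H] [CompleteSpace H]

/-- `τ` is a faithful normal semifinite trace on the positive cone of the von Neumann algebra `N`.
Only the values of `τ` at positive elements of `N` matter. -/
structure IsFaithfulNormalSemifiniteTrace (N : VonNeumannAlgebra H)
    (τ : (H →L[ℂ] H) → ℝ≥0∞) : Prop where
  add : ∀ S ∈ N, ∀ T ∈ N, 0 ≤ S → 0 ≤ T → τ (S + T) = τ S + τ T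
  smul : ∀ (c : ℝ≥0), ∀ T ∈ N, 0 ≤ T → τ (((c : ℝ) : ℂ) • T) = (c : ℝ≥0∞) * τ T
  tracial : ∀ T ∈ N, τ (star T * T) = τ (T * star T)
  faithful : ∀ T ∈ N, 0 ≤ T → τ T = 0 → T = 0
  normal : ∀ (S : Set (H →L[ℂ] H)) (T : H →L[ℂ] H), S.Nonempty → DirectedOn (· ≤ ·) S →
    (∀ s ∈ S, s ∈ N ∧ 0 ≤ s) → T ∈ N → IsLUB S T → τ T = ⨆ s ∈ S, τ s
  semifinite : ∀ T ∈ N, 0 ≤ T → T ≠ 0 → ∃ S ∈ N, 0 ≤ S ∧ S ≤ T ∧ S ≠ 0 ∧ τ S < ∞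

/-- The generalized singular value
`μ_t(S) = inf {‖S E‖ : E a projection in N with τ(1 - E) ≤ t}`. -/
def singularValue (N : VonNeumannAlgebra H) (τ : (H →L[ℂ] H) → ℝ≥0∞)
    (t : ℝ) (S : H →L[ℂ] H) : ℝ :=
  sInf {r : ℝ | ∃ E ∈ N, IsStarProjection E ∧ τ (1 - E) ≤ ENNReal.ofReal t ∧ r = ‖S * E‖}

/-- The `τ`-compact operators in `N`: those `T ∈ N` with `μ_t(T) → 0` as `t → ∞`. -/
def tauCompact (N : VonNeumannAlgebra H) (τ : (H →L[ℂ] H) → ℝ≥0∞) : Set (H →L[ℂ] H) :=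
  {T | T ∈ N ∧ Tendsto (fun t => singularValue N τ t T) atTop (𝓝 0)}

/-- The gauge of the weak ideals: `log (1 + t)` for `p = 1`; otherwise `t` for `t ≤ 1` and
`t ^ (1 - 1/p)` for `t ≥ 1`. -/
def gauge (p : ℝ) (t : ℝ) : ℝ :=
  if p = 1 then Real.log (1 + t) else if t ≤ 1 then t else t ^ (1 - 1 / p)

/-- The ideal `L^(p,∞)(N)`, `p ≥ 1`: those `T ∈ N` for which
`sup_{t > 0} (∫_0^t μ_s(T) ds) / gauge p t` is finite. -/
def weakIdeal (N : VonNeumannAlgebra H) (τ : (H →L[ℂ] H) → ℝ≥0∞) (p : ℝ) :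
    Set (H →L[ℂ] H) :=
  {T | T ∈ N ∧ ∃ C : ℝ, ∀ t > 0, (∫ s in (0 : ℝ)..t, singularValue N τ s T) / gauge p t ≤ C}

end Trace

section DixmierTrace

/-- Real-valued `L^∞` on the positive half-line. -/
abbrev LInfty : Type := Lp ℝ ∞ (volume.restrict (Set.Ioi (0 : ℝ)))

/-- A Dixmier functional: a positive linear functional on `L^∞(0,∞)` which agrees with the
ordinary limit at infinity (hence is a state) and is invariant under dilations. In particular
`ω' ∘ M` is of this form for `M` the Cesaro mean `M g (t) = (1 / log t) ∫_1^t g(s) ds/s` and `ω'`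
any positive functional that agrees with the ordinary limit at infinity, as `M (D_a g) - M g`
tends to `0` at infinity. -/
structure IsDixmierFunctional (ω : LInfty →ₗ[ℝ] ℝ) : Prop where
  nonneg : ∀ f : LInfty, 0 ≤ f → 0 ≤ ω f
  eq_lim : ∀ (f : LInfty) (g : ℝ → ℝ) (c : ℝ),
    f =ᵐ[volume.restrict (Set.Ioi (0 : ℝ))] g → Tendsto g atTop (𝓝 c) → ω f = c
  dilation : ∀ (a : ℝ), 0 < a → ∀ f g : LInfty,
    (∀ᵐ t ∂(volume.restrict (Set.Ioi (0 : ℝ))), g t = f (a * t)) → ω g = ω f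

open Classical in
/-- `ω-lim_{t → ∞} f(t)`, the value of `ω` at the class of an essentially bounded measurable
function `f` (and `0` for other `f`). -/
def omegaLim (ω : LInfty →ₗ[ℝ] ℝ) (f : ℝ → ℝ) : ℝ :=
  if h : MemLp f ∞ (volume.restrict (Set.Ioi (0 : ℝ))) then ω (h.toLp f) else 0

variable {H : Type*} [NormedAddCommGroup H] [InnerProductSpace ℂ H] [CompleteSpace H]

/-- The Dixmier trace of a positive operator,
`ω-lim_{t → ∞} (1 / log (1 + t)) ∫_0^t μ_s(T) ds`. -/
def dixmierTracePos (N : VonNeumannAlgebra H) (τ : (H →L[ℂ] H) → ℝ≥0∞)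
    (ω : LInfty →ₗ[ℝ] ℝ) (T : H →L[ℂ] H) : ℝ :=
  omegaLim ω fun t => (1 / Real.log (1 + t)) * ∫ s in (0 : ℝ)..t, singularValue N τ s T

/-- The Dixmier trace `τ_ω` on `L^(1,∞)(N)`, extended from the positive operators by linearity
through `T = (Re T)⁺ - (Re T)⁻ + i ((Im T)⁺ - (Im T)⁻)`. -/
def dixmierTrace (N : VonNeumannAlgebra H) (τ : (H →L[ℂ] H) → ℝ≥0∞)
    (ω : LInfty →ₗ[ℝ] ℝ) (T : H →L[ℂ] H) : ℂ :=
  ((dixmierTracePos N τ ω ((ℜ T : H →L[ℂ] H)⁺) : ℂ)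
      - dixmierTracePos N τ ω ((ℜ T : H →L[ℂ] H)⁻))
    + Complex.I * ((dixmierTracePos N τ ω ((ℑ T : H →L[ℂ] H)⁺) : ℂ)
      - dixmierTracePos N τ ω ((ℑ T : H →L[ℂ] H)⁻))

end DixmierTrace

section Unbounded

variable {H : Type*} [NormedAddCommGroup H] [InnerProductSpace ℂ H] [CompleteSpace H]

/-- The unbounded operator `D` is affiliated to `N`: every bounded operator in the commutant of
`N` preserves the domain of `D` and commutes with `D` there. -/
def IsAffiliated (N : VonNeumannAlgebra H) (D : H →ₗ.[ℂ] H) : Prop :=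
  ∀ T ∈ N.commutant, ∀ x : D.domain, ∃ h : T x ∈ D.domain, D ⟨T x, h⟩ = T (D x)

/-- `R = (z - D)⁻¹`: a bounded everywhere defined two-sided inverse of `z - D`. -/
def IsResolvent (D : H →ₗ.[ℂ] H) (z : ℂ) (R : H →L[ℂ] H) : Prop :=
  (∀ y : H, ∃ h : R y ∈ D.domain, z • R y - D ⟨R y, h⟩ = y) ∧
    ∀ x : D.domain, R (z • (x : H) - D x) = x

/-- `[D, a]` is densely defined (on those `x ∈ dom D` with `a x ∈ dom D`) and extends to the
bounded operator `B`. -/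
def IsBoundedCommutator (D : H →ₗ.[ℂ] H) (a B : H →L[ℂ] H) : Prop :=
  Dense {x : H | x ∈ D.domain ∧ a x ∈ D.domain} ∧
    ∀ (x : H) (hx : x ∈ D.domain) (hax : a x ∈ D.domain), D ⟨a x, hax⟩ - a (D ⟨x, hx⟩) = B x

open Classical in
/-- The bounded extension of `[D, a]` (unique, as `[D, a]` is densely defined); `0` if there is
none. -/
def commutator (D : H →ₗ.[ℂ] H) (a : H →L[ℂ] H) : H →L[ℂ] H :=
  if h : ∃ B, IsBoundedCommutator D a B then h.choose else 0

/-- `R = (1 + D²)⁻¹`: for every `y`, the vector `R y` lies in the domain of `D²` and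
`R y + D² (R y) = y`. For `D` symmetric there is at most one such `R`. -/
def IsInvOneAddSq (D : H →ₗ.[ℂ] H) (R : H →L[ℂ] H) : Prop :=
  ∀ y : H, ∃ (h : R y ∈ D.domain) (h' : D ⟨R y, h⟩ ∈ D.domain),
    R y + D ⟨D ⟨R y, h⟩, h'⟩ = y

theorem exists_isInvOneAddSq {D : H →ₗ.[ℂ] H} (hD : IsSelfAdjoint D) :
    ∃ R, IsInvOneAddSq D R := by
  let e : WithLp 2 (H × H) →L[ℂ] H × H :=
    (WithLp.prodContinuousLinearEquiv 2 ℂ H H : WithLp 2 (H × H) →L[ℂ] H × H)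
  let G : Submodule ℂ (WithLp 2 (H × H)) := D.graph.comap (e : WithLp 2 (H × H) →ₗ[ℂ] H × H)
  have hG : IsClosed (G : Set (WithLp 2 (H × H))) := by
    have h1 : IsClosed (D.graph : Set (H × H)) := hD.isClosed
    exact h1.preimage e.continuous
  have : CompleteSpace G := hG.completeSpace_coe
  let R : H →L[ℂ] H := (ContinuousLinearMap.fst ℂ H H).comp (e.comp (G.starProjection.comp
    (((WithLp.prodContinuousLinearEquiv 2 ℂ H H).symm : H × H →L[ℂ] WithLp 2 (H × H)).comp
      (ContinuousLinearMap.inl ℂ H H))))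
  refine ⟨R, fun y => ?_⟩
  set v : WithLp 2 (H × H) := WithLp.toLp 2 (y, 0) with hv
  set w := G.starProjection v with hw
  have hwG : w ∈ G := Submodule.starProjection_apply_mem G v
  have hRy : R y = w.fst := rfl
  have hgr : (w.fst, w.snd) ∈ D.graph := hwG
  obtain ⟨x, hx1, hx2⟩ := (LinearPMap.mem_graph_iff D).1 hgr
  simp only at hx1 hx2
  have hdom : R y ∈ D.domain := by rw [hRy, ← hx1]; exact x.2
  have hxx : x = ⟨R y, hdom⟩ := Subtype.ext (hx1.trans hRy.symm)
  have horth : ∀ z : D.domain, ⟪y - R y, (z : H)⟫_ℂ = ⟪D ⟨R y, hdom⟩, D z⟫_ℂ := by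
    intro z
    have hz : (WithLp.toLp 2 ((z : H), D z) : WithLp 2 (H × H)) ∈ G := LinearPMap.mem_graph D z
    have h0 := Submodule.starProjection_inner_eq_zero (K := G) v _ hz
    rw [← hw, WithLp.prod_inner_apply] at h0
    change ⟪y - w.fst, (z : H)⟫_ℂ + ⟪0 - w.snd, D z⟫_ℂ = 0 at h0
    rw [← hx2, ← hRy, hxx] at h0
    simp only [zero_sub, inner_neg_left] at h0
    linear_combination h0
  have hD' : D.adjoint = D := hD
  have hmem : D ⟨R y, hdom⟩ ∈ D.adjoint.domain :=
    LinearPMap.mem_adjoint_domain_of_exists _ ⟨y - R y, horth⟩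
  have hval := LinearPMap.adjoint_apply_eq hD.dense_domain ⟨_, hmem⟩ horth
  have key : ∀ (S : H →ₗ.[ℂ] H), S = D → ∀ (u c : H) (hu : u ∈ S.domain), S ⟨u, hu⟩ = c →
      ∃ h : u ∈ D.domain, D ⟨u, h⟩ = c := by
    rintro S rfl u c hu h
    exact ⟨hu, h⟩
  obtain ⟨h', hh⟩ := key _ hD' _ _ hmem hval
  exact ⟨hdom, h', by rw [hh]; abel⟩

open Classical in
/-- The bounded operator `(1 + D²)⁻¹`, for `D` self-adjoint. -/
def invOneAddSq (D : H →ₗ.[ℂ] H) : H →L[ℂ] H :=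
  if h : ∃ R, IsInvOneAddSq D R then h.choose else 0

/-- The bounded operator `(1 + D²)^(-1/2)`, the positive square root of `(1 + D²)⁻¹`. -/
def invSqrtOneAddSq (D : H →ₗ.[ℂ] H) : H →L[ℂ] H := CFC.sqrt (invOneAddSq D)

/-- The unbounded operator `(1 + D²)^(1/2)`, the inverse of `(1 + D²)^(-1/2)`; its domain is the
range of `(1 + D²)^(-1/2)`. -/
def sqrtOneAddSq (D : H →ₗ.[ℂ] H) : H →ₗ.[ℂ] H :=
  ((invSqrtOneAddSq D : H →ₗ[ℂ] H).toPMap ⊤).inverse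

/-- The absolute value `|D|` of a self-adjoint `D`. By the functional calculus,
`|D| = (1 - (1 + D²)⁻¹)^(1/2) (1 + D²)^(1/2)`, since `|s| = (1 - (1 + s²)⁻¹)^(1/2) (1 + s²)^(1/2)`
for real `s`, the first factor being bounded; the domain is that of `(1 + D²)^(1/2)`, which is
that of `D`. -/
def absOp (D : H →ₗ.[ℂ] H) : H →ₗ.[ℂ] H :=
  ((CFC.sqrt (1 - invOneAddSq D) : H →L[ℂ] H) : H →ₗ[ℂ] H).compPMap (sqrtOneAddSq D)

/-- `B = δ(T) = [|D|, T]`: the operator `T` preserves the domain of `|D|`, and `[|D|, T]`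
extends from there to the bounded operator `B`. -/
def IsDelta (D : H →ₗ.[ℂ] H) (T B : H →L[ℂ] H) : Prop :=
  ∀ x : (absOp D).domain, ∃ h : T x ∈ (absOp D).domain,
    absOp D ⟨T x, h⟩ - T (absOp D x) = B x

/-- `T` is in the domain of `δ^k`, where `δ(T) = [|D|, T]` is viewed as a partially defined
derivation of `N`. -/
def InDomDelta (N : VonNeumannAlgebra H) (D : H →ₗ.[ℂ] H) : ℕ → (H →L[ℂ] H) → Prop
  | 0, T => T ∈ N
  | k + 1, T => T ∈ N ∧ ∃ B, IsDelta D T B ∧ InDomDelta N D k B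

end Unbounded

/-- A semifinite spectral triple `(A, H, D)` relative to a von Neumann algebra `N` on `H` with a
faithful normal semifinite trace `τ`. Either the triple is considered as odd, and `Γ = 1`, or it
is even with grading operator `Γ`. -/
structure SpectralTriple (H : Type*) [NormedAddCommGroup H] [InnerProductSpace ℂ H]
    [CompleteSpace H] where
  N : VonNeumannAlgebra H
  τ : (H →L[ℂ] H) → ℝ≥0∞
  isTrace : IsFaithfulNormalSemifiniteTrace N τ
  A : NonUnitalStarSubalgebra ℂ (H →L[ℂ] H)
  A_subset : ∀ a ∈ A, a ∈ N
  D : H →ₗ.[ℂ] H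
  selfAdjoint : IsSelfAdjoint D
  affiliated : IsAffiliated N D
  commutator_bounded : ∀ a ∈ A, ∃ B ∈ N, IsBoundedCommutator D a B
  resolvent_compact : ∀ z : ℂ, z.im ≠ 0 → ∃ R ∈ tauCompact N τ, IsResolvent D z R
  Γ : H →L[ℂ] H
  grading : Γ = 1 ∨
    (Γ ∈ N ∧ star Γ = Γ ∧ Γ * Γ = 1 ∧ (∀ a ∈ A, Γ * a = a * Γ) ∧
      ∀ x : D.domain, ∃ h : Γ x ∈ D.domain, D ⟨Γ x, h⟩ + Γ (D x) = 0)

namespace SpectralTriple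

variable {H : Type*} [NormedAddCommGroup H] [InnerProductSpace ℂ H] [CompleteSpace H]

/-- The triple is `QC^k`: both `a` and `[D, a]` are in the domain of `δ^k`, for all `a ∈ A`. -/
def IsQC (X : SpectralTriple H) (k : ℕ) : Prop :=
  ∀ a ∈ X.A, InDomDelta X.N X.D k a ∧ InDomDelta X.N X.D k (commutator X.D a)

/-- The triple is `(p,∞)`-summable: `(1 + D²)^(-1/2) ∈ L^(p,∞)`. -/
def IsWeaklySummable (X : SpectralTriple H) (p : ℝ) : Prop :=
  invSqrtOneAddSq X.D ∈ weakIdeal X.N X.τ p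

/-- The operator `Γ a_0 [D, a_1] ⋯ [D, a_p] (1 + D²)^(-p/2)`. -/
def formOp (X : SpectralTriple H) (p : ℕ) (a : Fin (p + 1) → X.A) : H →L[ℂ] H :=
  X.Γ * (a 0 : H →L[ℂ] H) * (List.ofFn fun i : Fin p => commutator X.D (a i.succ)).prod
    * invSqrtOneAddSq X.D ^ p

end SpectralTriple

section Hochschild

/-- The constant `λ_p`: `(-1)^(p(p-1)/2) Γ(p/2 + 1)` for `p` even, and
`√(2i) (-1)^(p(p-1)/2) Γ(p/2 + 1)` for `p` odd. -/
def lambdaConst (p : ℕ) : ℂ :=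
  (if Even p then 1 else (2 * Complex.I) ^ (1 / 2 : ℂ)) * (-1) ^ (p * (p - 1) / 2)
    * Complex.Gamma ((p : ℂ) / 2 + 1)

/-- The Hochschild coboundary
`(bφ)(a_0,…,a_{n+1}) = ∑_{i=0}^n (-1)^i φ(a_0,…,a_i a_{i+1},…,a_{n+1})
  + (-1)^{n+1} φ(a_{n+1} a_0, a_1,…,a_n)`. -/
def hochschildCoboundary {A : Type*} [Mul A] (n : ℕ) (φ : (Fin (n + 1) → A) → ℂ)
    (a : Fin (n + 2) → A) : ℂ :=
  (∑ i : Fin (n + 1), (-1) ^ (i : ℕ) * φ (Fin.contractNth i.castSucc (· * ·) a))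
    + (-1) ^ (n + 1) * φ (Fin.cons (a (Fin.last (n + 1)) * a 0) fun i : Fin n => a i.succ.castSucc)

variable {H : Type*} [NormedAddCommGroup H] [InnerProductSpace ℂ H] [CompleteSpace H]

/-- `φ` is a Hochschild `n`-cocycle on the algebra of the triple: an `(n+1)`-multilinear functional
with `bφ = 0`, continuous for the norm `‖a‖ + ‖[D, a]‖`. -/
def IsHochschildCocycle (X : SpectralTriple H) (n : ℕ) (φ : (Fin (n + 1) → X.A) → ℂ) : Prop :=
  (∃ Φ : MultilinearMap ℂ (fun _ : Fin (n + 1) => X.A) ℂ, ⇑Φ = φ) ∧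
  (∃ C : ℝ, ∀ a : Fin (n + 1) → X.A,
    ‖φ a‖ ≤ C * ∏ i, (‖(a i : H →L[ℂ] H)‖ + ‖commutator X.D (a i)‖)) ∧
  ∀ a : Fin (n + 2) → X.A, hochschildCoboundary n φ a = 0

end Hochschild

end SemifiniteNCG

end

open scoped ENNReal NNReal Topology ComplexStarModule InnerProductSpace
open MeasureTheory Filter

noncomputable section

namespace SemifiniteNCG

/-! ### Abstract traces on hereditary cones and their linear extension -/

section TraceCone

variable {H : Type*} [NormedAddCommGroup H] [InnerProductSpace ℂ H] [CompleteSpace H]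

/-! Write R = (1 + D²)^(-1/2), Z = Γ a_0 [D, a_1] ⋯ [D, a_p] and b = a_{p+1}. Since [D, ·] is a
derivation, the first p + 1 terms of the Hochschild coboundary telescope to (-1)^p τ_ω(Z b R^p).
Cyclicity of τ_ω and Γ b = b Γ turn the last term into (-1)^(p+1) τ_ω(Z R^p b). Hence the coboundary
is, up to sign and the constant λ_p, τ_ω(Z [b, R^p]).

By QC¹, [|D|, b] is bounded. So is (1 + D²)^(1/2) - |D|, hence [R⁻¹, b] extends to a bounded B, and
[b, R] = R B R (`IsDelta.exists_commutator_eq`). Therefore [b, R^p] = ∑ R^(k+1) B R^(p-k), where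
every term has total order p + 1 in R. Summability gives μ_s(R^p) = O(1/s) for p > 1, and for p = 1
the logarithmic bound directly; in both cases R^p lies in L^(1,∞) and τ(R^(p+1)) is finite. A Hölder
inequality then bounds ∫_0^t μ_s of the positive and negative parts of these terms uniformly in t,
so τ_ω vanishes on them (`mul_pow_mul_pow_dixmierTrace`).

The theory of τ_ω that this needs rests on one formula: for positive T, ∫_0^t μ_s(T) ds = inf {τ(A)
+ t b : T ≤ A + b} (`ofReal_kyFan_eq_kFun`). The right side is visibly monotone, subadditive and
compatible with conjugation. A Riesz decomposition also gives K_t(S) + K_t(T) ≤ K_{2t}(S + T); as ω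
is dilation invariant and log(1 + 2t) ~ log(1 + t), τ_ω is additive on positive operators.

Linearity, cyclicity and the bound |f(T P)| ≤ ‖T‖ f(P) are proved once, for any `IsTraceCone`. They
apply both to the finite part of τ, where Hölder is proved, and to τ_ω. -/

theorem smul_mem_vonNeumann {N : VonNeumannAlgebra H} (c : ℂ) {T : H →L[ℂ] H} (hT : T ∈ N) :
    c • T ∈ N :=
  N.toStarSubalgebra.smul_mem hT c

theorem real_smul_mem_vonNeumann {N : VonNeumannAlgebra H} (c : ℝ) {T : H →L[ℂ] H} (hT : T ∈ N) :
    c • T ∈ N := by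
  rw [← Complex.coe_smul]; exact smul_mem_vonNeumann _ hT

/-- A cone `J` of positive elements of `N` with an additive, positively homogeneous functional `f`,
hereditary and stable under `P ↦ V P V*` with `f (V P V*) ≤ ‖V‖² f P`. -/
structure IsTraceCone (N : VonNeumannAlgebra H) (J : Set (H →L[ℂ] H))
    (f : (H →L[ℂ] H) → ℝ) : Prop where
  mem : ∀ P ∈ J, P ∈ N
  nonneg : ∀ P ∈ J, 0 ≤ P
  zero_mem' : 0 ∈ J
  add_mem' : ∀ P ∈ J, ∀ Q ∈ J, P + Q ∈ J
  smul_mem' : ∀ c : ℝ, 0 ≤ c → ∀ P ∈ J, c • P ∈ J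
  posPart_mem : ∀ Y ∈ N, IsSelfAdjoint Y → ∀ P ∈ J, Y ≤ P → Y⁺ ∈ J
  conj_mem : ∀ V ∈ N, ∀ P ∈ J, V * P * star V ∈ J
  map_nonneg : ∀ P ∈ J, 0 ≤ f P
  map_add' : ∀ P ∈ J, ∀ Q ∈ J, f (P + Q) = f P + f Q
  map_smul' : ∀ c : ℝ, 0 ≤ c → ∀ P ∈ J, f (c • P) = c * f P
  map_conj_le : ∀ V ∈ N, ∀ P ∈ J, f (V * P * star V) ≤ ‖V‖ ^ 2 * f P

/-- The extension of `f` to self-adjoint operators through positive and negative parts. -/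
def signedExt (f : (H →L[ℂ] H) → ℝ) (Y : H →L[ℂ] H) : ℝ := f Y⁺ - f Y⁻

/-- The complex linear extension of `f`. -/
def complexExt (f : (H →L[ℂ] H) → ℝ) (T : H →L[ℂ] H) : ℂ :=
  ((f ((ℜ T : H →L[ℂ] H)⁺) : ℂ) - f ((ℜ T : H →L[ℂ] H)⁻))
    + Complex.I * ((f ((ℑ T : H →L[ℂ] H)⁺) : ℂ) - f ((ℑ T : H →L[ℂ] H)⁻))

theorem complexExt_eq (f : (H →L[ℂ] H) → ℝ) (T : H →L[ℂ] H) :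
    complexExt f T = signedExt f (ℜ T : H →L[ℂ] H) + Complex.I * signedExt f (ℑ T : H →L[ℂ] H) := by
  simp [complexExt, signedExt]

/-- The differences of elements of `J`. -/
def diffCone (J : Set (H →L[ℂ] H)) : Set (H →L[ℂ] H) := {Y | ∃ P ∈ J, ∃ Q ∈ J, Y = P - Q}

namespace IsTraceCone

variable {N : VonNeumannAlgebra H} {J : Set (H →L[ℂ] H)} {f : (H →L[ℂ] H) → ℝ}

theorem mem_of_le (h : IsTraceCone N J f) {P Q : H →L[ℂ] H} (hP : P ∈ J) (hQ : Q ∈ N) (hQ0 : 0 ≤ Q)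
    (hQP : Q ≤ P) : Q ∈ J := by
  have := h.posPart_mem Q hQ (.of_nonneg hQ0) P hP hQP
  rwa [CFC.posPart_eq_self Q |>.2 hQ0] at this

theorem map_zero' (h : IsTraceCone N J f) : f 0 = 0 := by
  have := h.map_add' 0 h.zero_mem' 0 h.zero_mem'
  rw [add_zero] at this; linarith

/-- Additivity applied to (P - Q)⁺ + Q = P + (P - Q)⁻ makes the signed extension independent of the
way an operator is written as a difference. -/
theorem posPart_negPart (h : IsTraceCone N J f) {P Q : H →L[ℂ] H} (hP : P ∈ J) (hQ : Q ∈ J) :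
    (P - Q)⁺ ∈ J ∧ (P - Q)⁻ ∈ J ∧ signedExt f (P - Q) = f P - f Q := by
  have hPs : IsSelfAdjoint P := .of_nonneg (h.nonneg _ hP)
  have hQs : IsSelfAdjoint Q := .of_nonneg (h.nonneg _ hQ)
  have h1 : (P - Q)⁺ ∈ J := h.posPart_mem _ (sub_mem (h.mem _ hP) (h.mem _ hQ)) (hPs.sub hQs) P hP
    (sub_le_self _ (h.nonneg _ hQ))
  have h2 : (P - Q)⁻ ∈ J := by
    have := h.posPart_mem _ (sub_mem (h.mem _ hQ) (h.mem _ hP)) (hQs.sub hPs) Q hQ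
      (sub_le_self _ (h.nonneg _ hP))
    rwa [← neg_sub, CFC.posPart_neg] at this
  refine ⟨h1, h2, ?_⟩
  have h3 : (P - Q)⁺ + Q = P + (P - Q)⁻ := by
    have := CFC.posPart_sub_negPart (P - Q) (hPs.sub hQs)
    rw [sub_eq_sub_iff_add_eq_add] at this
    exact this
  have h4 := h.map_add' _ h1 _ hQ
  rw [h3, h.map_add' _ hP _ h2] at h4
  unfold signedExt; linarith

theorem diffCone_add (h : IsTraceCone N J f) {Y Z : H →L[ℂ] H} (hY : Y ∈ diffCone J)
    (hZ : Z ∈ diffCone J) :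
    Y + Z ∈ diffCone J ∧ signedExt f (Y + Z) = signedExt f Y + signedExt f Z := by
  obtain ⟨P, hP, Q, hQ, rfl⟩ := hY
  obtain ⟨P', hP', Q', hQ', rfl⟩ := hZ
  have e : P - Q + (P' - Q') = (P + P') - (Q + Q') := by abel
  have h1 := h.add_mem' _ hP _ hP'
  have h2 := h.add_mem' _ hQ _ hQ'
  refine ⟨⟨_, h1, _, h2, e⟩, ?_⟩
  rw [e, (h.posPart_negPart h1 h2).2.2, (h.posPart_negPart hP hQ).2.2,
    (h.posPart_negPart hP' hQ').2.2, h.map_add' _ hP _ hP', h.map_add' _ hQ _ hQ']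
  ring

theorem diffCone_neg (h : IsTraceCone N J f) {Y : H →L[ℂ] H} (hY : Y ∈ diffCone J) :
    -Y ∈ diffCone J ∧ signedExt f (-Y) = -signedExt f Y := by
  obtain ⟨P, hP, Q, hQ, rfl⟩ := hY
  refine ⟨⟨Q, hQ, P, hP, by abel⟩, ?_⟩
  rw [neg_sub, (h.posPart_negPart hQ hP).2.2, (h.posPart_negPart hP hQ).2.2]
  ring

theorem diffCone_smul (h : IsTraceCone N J f) {Y : H →L[ℂ] H} (hY : Y ∈ diffCone J) (c : ℝ) :
    c • Y ∈ diffCone J ∧ signedExt f (c • Y) = c * signedExt f Y := by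
  have key : ∀ c : ℝ, 0 ≤ c → ∀ Y ∈ diffCone J,
      c • Y ∈ diffCone J ∧ signedExt f (c • Y) = c * signedExt f Y := by
    rintro c hc _ ⟨P, hP, Q, hQ, rfl⟩
    refine ⟨⟨_, h.smul_mem' c hc P hP, _, h.smul_mem' c hc Q hQ, smul_sub _ _ _⟩, ?_⟩
    rw [smul_sub, (h.posPart_negPart (h.smul_mem' c hc P hP) (h.smul_mem' c hc Q hQ)).2.2,
      (h.posPart_negPart hP hQ).2.2, h.map_smul' c hc P hP, h.map_smul' c hc Q hQ]
    ring
  rcases le_total 0 c with hc | hc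
  · exact key c hc Y hY
  · have h1 := key (-c) (neg_nonneg.2 hc) _ (h.diffCone_neg hY).1
    rw [neg_smul_neg, (h.diffCone_neg hY).2] at h1
    exact ⟨h1.1, by rw [h1.2]; ring⟩

theorem mem_diffCone (h : IsTraceCone N J f) {P : H →L[ℂ] H} (hP : P ∈ J) :
    P ∈ diffCone J ∧ signedExt f P = f P := by
  have := (h.posPart_negPart hP h.zero_mem').2.2
  rw [sub_zero, h.map_zero', sub_zero] at this
  exact ⟨⟨P, hP, 0, h.zero_mem', by simp⟩, this⟩

theorem zero_diffCone (h : IsTraceCone N J f) : (0 : H →L[ℂ] H) ∈ diffCone J :=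
  (h.mem_diffCone h.zero_mem').1

/-- With `mem_span_of_parts` this identifies the span of `J` with `diffCone J + i diffCone J`, which
is where `complexExt` is linear. -/
theorem parts_mem_diffCone (h : IsTraceCone N J f) {T : H →L[ℂ] H}
    (hT : T ∈ Submodule.span ℂ J) :
    (ℜ T : H →L[ℂ] H) ∈ diffCone J ∧ (ℑ T : H →L[ℂ] H) ∈ diffCone J := by
  induction hT using Submodule.span_induction with
  | mem P hP =>
    have hs : IsSelfAdjoint P := .of_nonneg (h.nonneg P hP)
    rw [hs.coe_realPart, hs.imaginaryPart]
    exact ⟨(h.mem_diffCone hP).1, h.zero_diffCone⟩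
  | zero => simpa using h.zero_diffCone
  | add S T _ _ hS hT =>
    simp only [map_add, AddSubgroup.coe_add]
    exact ⟨(h.diffCone_add hS.1 hT.1).1, (h.diffCone_add hS.2 hT.2).1⟩
  | smul c T _ hT =>
    rw [realPart_smul, imaginaryPart_smul]
    simp only [AddSubgroup.coe_add, AddSubgroup.coe_neg, selfAdjoint.val_smul, sub_eq_add_neg]
    exact ⟨(h.diffCone_add (h.diffCone_smul hT.1 _).1
      (h.diffCone_neg (h.diffCone_smul hT.2 _).1).1).1,
      (h.diffCone_add (h.diffCone_smul hT.2 _).1 (h.diffCone_smul hT.1 _).1).1⟩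

theorem mem_span_of_parts {T : H →L[ℂ] H}
    (h1 : (ℜ T : H →L[ℂ] H) ∈ diffCone J) (h2 : (ℑ T : H →L[ℂ] H) ∈ diffCone J) :
    T ∈ Submodule.span ℂ J := by
  have key : ∀ Y ∈ diffCone J, Y ∈ Submodule.span ℂ J := by
    rintro _ ⟨P, hP, Q, hQ, rfl⟩
    exact sub_mem (Submodule.subset_span hP) (Submodule.subset_span hQ)
  rw [← realPart_add_I_smul_imaginaryPart T]
  exact add_mem (key _ h1) (Submodule.smul_mem _ _ (key _ h2))

theorem complexExt_add (h : IsTraceCone N J f) {S T : H →L[ℂ] H} (hS : S ∈ Submodule.span ℂ J)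
    (hT : T ∈ Submodule.span ℂ J) : complexExt f (S + T) = complexExt f S + complexExt f T := by
  have h1 := h.parts_mem_diffCone hS
  have h2 := h.parts_mem_diffCone hT
  simp only [complexExt_eq, map_add, AddSubgroup.coe_add, (h.diffCone_add h1.1 h2.1).2,
    (h.diffCone_add h1.2 h2.2).2]
  push_cast; ring

theorem complexExt_smul (h : IsTraceCone N J f) {T : H →L[ℂ] H} (c : ℂ)
    (hT : T ∈ Submodule.span ℂ J) : complexExt f (c • T) = c * complexExt f T := by
  have h1 := h.parts_mem_diffCone hT
  have a1 := h.diffCone_smul h1.1 c.re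
  have a2 := h.diffCone_smul h1.2 c.re
  have a3 := h.diffCone_smul h1.1 c.im
  have a4 := h.diffCone_smul h1.2 c.im
  have a5 := h.diffCone_neg a4.1
  rw [complexExt_eq, complexExt_eq, realPart_smul, imaginaryPart_smul]
  simp only [AddSubgroup.coe_add, AddSubgroup.coe_neg, selfAdjoint.val_smul, sub_eq_add_neg]
  rw [(h.diffCone_add a1.1 a5.1).2, (h.diffCone_add a2.1 a3.1).2, a5.2, a1.2, a2.2, a3.2, a4.2]
  apply Complex.ext <;> simp <;> ring

theorem complexExt_of_mem (h : IsTraceCone N J f) {P : H →L[ℂ] H} (hP : P ∈ J) :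
    complexExt f P = f P := by
  have hs : IsSelfAdjoint P := .of_nonneg (h.nonneg P hP)
  rw [complexExt_eq, hs.coe_realPart, hs.imaginaryPart, (h.mem_diffCone hP).2]
  simp [(h.mem_diffCone h.zero_mem').2, h.map_zero']

theorem complexExt_zero (h : IsTraceCone N J f) : complexExt f 0 = 0 := by
  rw [h.complexExt_of_mem h.zero_mem', h.map_zero', Complex.ofReal_zero]

theorem complexExt_neg (h : IsTraceCone N J f) {T : H →L[ℂ] H}
    (hT : T ∈ Submodule.span ℂ J) : complexExt f (-T) = -complexExt f T := by
  have := h.complexExt_smul (-1) hT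
  simpa using this

theorem complexExt_sub (h : IsTraceCone N J f) {S T : H →L[ℂ] H} (hS : S ∈ Submodule.span ℂ J)
    (hT : T ∈ Submodule.span ℂ J) : complexExt f (S - T) = complexExt f S - complexExt f T := by
  rw [sub_eq_add_neg, h.complexExt_add hS (neg_mem hT), h.complexExt_neg hT, sub_eq_add_neg]

theorem complexExt_sum (h : IsTraceCone N J f) {ι : Type*} (s : Finset ι) (T : ι → H →L[ℂ] H)
    (hT : ∀ i ∈ s, T i ∈ Submodule.span ℂ J) :
    complexExt f (∑ i ∈ s, T i) = ∑ i ∈ s, complexExt f (T i) := by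
  classical
  induction s using Finset.induction_on with
  | empty => simpa using h.complexExt_zero
  | insert i s hi ih =>
    rw [Finset.sum_insert hi, Finset.sum_insert hi, h.complexExt_add
      (hT i (Finset.mem_insert_self _ _)) (sum_mem fun j hj => hT j (Finset.mem_insert_of_mem hj)),
      ih fun j hj => hT j (Finset.mem_insert_of_mem hj)]

theorem complexExt_star (h : IsTraceCone N J f) {T : H →L[ℂ] H} (hT : T ∈ Submodule.span ℂ J) :
    complexExt f (star T) = star (complexExt f T) := by
  have h1 := h.parts_mem_diffCone hT
  have e1 : ℜ (star T) = ℜ T := by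
    ext1; simp [realPart_apply_coe, add_comm]
  have e2 : (ℑ (star T) : H →L[ℂ] H) = -(ℑ T : H →L[ℂ] H) := by
    simp only [imaginaryPart_apply_coe, star_star]
    rw [← smul_neg, ← smul_neg, neg_sub]
  rw [complexExt_eq, complexExt_eq, e1, e2, (h.diffCone_neg h1.2).2]
  apply Complex.ext <;> simp

theorem star_mem_span (h : IsTraceCone N J f) {T : H →L[ℂ] H} (hT : T ∈ Submodule.span ℂ J) :
    star T ∈ Submodule.span ℂ J := by
  induction hT using Submodule.span_induction with
  | mem P hP =>
    rw [(IsSelfAdjoint.of_nonneg (h.nonneg P hP)).star_eq]; exact Submodule.subset_span hP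
  | zero => simp
  | add S T _ _ hS hT => rw [star_add]; exact add_mem hS hT
  | smul c T _ hT => rw [star_smul]; exact Submodule.smul_mem _ _ hT

theorem mem_of_mem_span (h : IsTraceCone N J f) {T : H →L[ℂ] H} (hT : T ∈ Submodule.span ℂ J) :
    T ∈ N := by
  induction hT using Submodule.span_induction with
  | mem P hP => exact h.mem P hP
  | zero => exact zero_mem N
  | add S T _ _ hS hT => exact add_mem hS hT
  | smul c T _ hT => exact smul_mem_vonNeumann c hT

/-- Polarization: (1 + V) P (1 + V)* - (1 - V) P (1 - V)* = 2 (V P + P V*). This is what makes the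
span of `J` a two-sided ideal of `N`. -/
theorem mul_add_mul_star_mem (h : IsTraceCone N J f) {V P : H →L[ℂ] H} (hV : V ∈ N) (hP : P ∈ J) :
    V * P + P * star V ∈ diffCone J := by
  have h1 := h.conj_mem (1 + V) (add_mem (one_mem N) hV) P hP
  have h2 := h.conj_mem (1 - V) (sub_mem (one_mem N) hV) P hP
  refine ⟨_, h.smul_mem' (1 / 2) (by norm_num) _ h1, _, h.smul_mem' (1 / 2) (by norm_num) _ h2, ?_⟩
  rw [← smul_sub]
  have : (1 + V) * P * star (1 + V) - (1 - V) * P * star (1 - V)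
      = (2 : ℝ) • (V * P + P * star V) := by
    rw [two_smul, star_add, star_sub, star_one]; noncomm_ring
  rw [this, smul_smul]; norm_num

theorem mul_mem_span_left (h : IsTraceCone N J f) {V T : H →L[ℂ] H} (hV : V ∈ N)
    (hT : T ∈ Submodule.span ℂ J) : V * T ∈ Submodule.span ℂ J := by
  have key : ∀ V ∈ N, ∀ P ∈ J, (ℜ (V * P) : H →L[ℂ] H) ∈ diffCone J := by
    intro V hV P hP
    rw [realPart_apply_coe, star_mul, (IsSelfAdjoint.of_nonneg (h.nonneg P hP)).star_eq]
    exact (h.diffCone_smul (h.mul_add_mul_star_mem hV hP) _).1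
  induction hT using Submodule.span_induction with
  | mem P hP =>
    refine mem_span_of_parts (key V hV P hP) ?_
    -- The imaginary part comes for free from the real part, since ℑ(V P) = -ℜ(i V P).
    have h2 := (h.diffCone_neg (key (Complex.I • V) (smul_mem_vonNeumann _ hV) P hP)).1
    rw [smul_mul_assoc, realPart_I_smul] at h2
    simpa using h2
  | zero => simp
  | add S T _ _ hS hT => rw [mul_add]; exact add_mem hS hT
  | smul c T _ hT => rw [mul_smul_comm]; exact Submodule.smul_mem _ _ hT

theorem mul_mem_span_right (h : IsTraceCone N J f) {V T : H →L[ℂ] H} (hV : V ∈ N)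
    (hT : T ∈ Submodule.span ℂ J) : T * V ∈ Submodule.span ℂ J := by
  have := h.star_mem_span (h.mul_mem_span_left (star_mem hV) (h.star_mem_span hT))
  simpa using this

/-- The conjugation inequality holds for U and for U*; used on both, it becomes an equality. -/
theorem map_unitary_conj (h : IsTraceCone N J f) {U P : H →L[ℂ] H} (hU : U ∈ N)
    (hU' : U ∈ unitary (H →L[ℂ] H)) (hP : P ∈ J) : f (U * P * star U) = f P := by
  have hn : ∀ W ∈ unitary (H →L[ℂ] H), ‖W‖ ^ 2 ≤ 1 := by
    intro W hW
    rw [sq, ← CStarRing.norm_star_mul_self, (Unitary.mem_iff.1 hW).1]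
    exact ContinuousLinearMap.norm_id_le
  have key : ∀ U ∈ N, U ∈ unitary (H →L[ℂ] H) → ∀ P ∈ J, f (U * P * star U) ≤ f P := by
    intro U hU hU' P hP
    exact (h.map_conj_le U hU P hP).trans
      (mul_le_of_le_one_left (h.map_nonneg P hP) (hn U hU'))
  refine le_antisymm (key U hU hU' P hP) ?_
  have := key (star U) (star_mem hU) (Unitary.star_mem hU') _ (h.conj_mem U hU P hP)
  rwa [star_star, ← mul_assoc, ← mul_assoc, (Unitary.mem_iff.1 hU').1, one_mul, mul_assoc,
    (Unitary.mem_iff.1 hU').1, mul_one] at this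

/-- Invariance under conjugation by U, applied to T U in place of T. -/
theorem complexExt_unitary_mul (h : IsTraceCone N J f) {U T : H →L[ℂ] H} (hU : U ∈ N)
    (hU' : U ∈ unitary (H →L[ℂ] H)) (hT : T ∈ Submodule.span ℂ J) :
    complexExt f (U * T) = complexExt f (T * U) := by
  have key : ∀ T ∈ Submodule.span ℂ J, complexExt f (U * T * star U) = complexExt f T := by
    intro T hT
    have hm : ∀ S ∈ Submodule.span ℂ J, U * S * star U ∈ Submodule.span ℂ J := fun S hS =>
      h.mul_mem_span_right (star_mem hU) (h.mul_mem_span_left hU hS)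
    induction hT using Submodule.span_induction with
    | mem P hP =>
      rw [h.complexExt_of_mem hP, h.complexExt_of_mem (h.conj_mem U hU P hP),
        h.map_unitary_conj hU hU' hP]
    | zero => simp
    | add S T hS' hT' hS hT =>
      rw [mul_add, add_mul, h.complexExt_add (hm S hS') (hm T hT'), hS, hT,
        h.complexExt_add hS' hT']
    | smul c T hT' hT =>
      rw [mul_smul_comm, smul_mul_assoc, h.complexExt_smul c (hm T hT'), hT,
        h.complexExt_smul c hT']
  have := key (T * U) (h.mul_mem_span_right hU hT)
  rwa [← mul_assoc, mul_assoc, (Unitary.mem_iff.1 hU').2, mul_one] at this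

/-- The functional `f` is bounded by `‖T‖ f(P)` on `T P`. -/
theorem norm_complexExt_mul_le (h : IsTraceCone N J f) {T P : H →L[ℂ] H} (hT : T ∈ N) (hP : P ∈ J) :
    ‖complexExt f (T * P)‖ ≤ ‖T‖ * f P := by
  have hPs : star P = P := (IsSelfAdjoint.of_nonneg (h.nonneg P hP)).star_eq
  -- Expand 0 ≤ f((1 - V) P (1 - V)*) = f(P) + f(V P V*) - 2 Re f(V P) and use f(V P V*) ≤ f(P).
  have key : ∀ V ∈ N, ‖V‖ ≤ 1 → (complexExt f (V * P)).re ≤ f P := by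
    intro V hV hV1
    have hVP := h.mul_mem_span_left hV (Submodule.subset_span hP)
    have h1 : complexExt f (P + V * P * star V - (V * P + star (V * P)))
        = f ((1 - V) * P * star (1 - V)) := by
      rw [← h.complexExt_of_mem (h.conj_mem _ (sub_mem (one_mem N) hV) P hP)]
      congr 1
      rw [star_mul, hPs, star_sub, star_one]; noncomm_ring
    rw [h.complexExt_sub (add_mem (Submodule.subset_span hP)
        (Submodule.subset_span (h.conj_mem V hV P hP))) (add_mem hVP (h.star_mem_span hVP)),
      h.complexExt_add (Submodule.subset_span hP) (Submodule.subset_span (h.conj_mem V hV P hP)),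
      h.complexExt_add hVP (h.star_mem_span hVP), h.complexExt_star hVP, h.complexExt_of_mem hP,
      h.complexExt_of_mem (h.conj_mem V hV P hP)] at h1
    have h2 := congrArg Complex.re h1
    simp at h2
    have h3 := h.map_nonneg _ (h.conj_mem _ (sub_mem (one_mem N) hV) P hP)
    have h4 := h.map_conj_le V hV P hP
    have h5 : ‖V‖ ^ 2 * f P ≤ f P :=
      mul_le_of_le_one_left (h.map_nonneg P hP) (pow_le_one₀ (norm_nonneg _) hV1)
    simp only [star_sub, star_one] at h3
    linarith
  rcases eq_or_ne T 0 with rfl | hT0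
  · simp only [zero_mul, h.complexExt_zero, norm_zero, le_refl]
  have hn : 0 < ‖T‖ := norm_pos_iff.2 hT0
  set z := complexExt f (T * P) with hz
  -- A phase that makes the value real and nonnegative, so that the bound on real parts bounds the
  -- modulus.
  obtain ⟨c, hc, hcz⟩ : ∃ c : ℂ, ‖c‖ = 1 ∧ c * z = ‖z‖ := by
    rcases eq_or_ne z 0 with h0 | h0
    · exact ⟨1, by simp, by simp [h0]⟩
    · refine ⟨(‖z‖ : ℂ) / z, ?_, by field_simp⟩
      simp [h0]
  have h1 := key ((c / ‖T‖) • T) (smul_mem_vonNeumann _ hT) (by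
    rw [norm_smul, norm_div, hc, Complex.norm_real, norm_norm]; field_simp; exact le_rfl)
  rw [smul_mul_assoc, h.complexExt_smul _ (h.mul_mem_span_left hT (Submodule.subset_span hP)), ← hz,
    div_mul_eq_mul_div, hcz, ← Complex.ofReal_div, Complex.ofReal_re, div_le_iff₀ hn] at h1
  linarith

end IsTraceCone

end TraceCone

/-! ### Functional calculus and unitaries inside a von Neumann algebra -/

section VonNeumann

variable {H : Type*} [NormedAddCommGroup H] [InnerProductSpace ℂ H] [CompleteSpace H]

theorem mem_vonNeumann_of_commute {N : VonNeumannAlgebra H} {T : H →L[ℂ] H}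
    (h : ∀ S ∈ N.commutant, S * T = T * S) : T ∈ N := by
  rw [← N.commutant_commutant, VonNeumannAlgebra.mem_commutant_iff]
  exact h

theorem commute_of_mem_commutant {N : VonNeumannAlgebra H} {S T : H →L[ℂ] H} (hT : T ∈ N)
    (hS : S ∈ N.commutant) : Commute T S :=
  VonNeumannAlgebra.mem_commutant_iff.1 hS T hT

theorem cfc_mem_vonNeumann {N : VonNeumannAlgebra H} {T : H →L[ℂ] H} (hT : T ∈ N) (g : ℝ → ℝ) :
    cfc g T ∈ N :=
  mem_vonNeumann_of_commute fun _ hS =>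
    ((commute_of_mem_commutant hT hS).cfc_real g).symm.eq

theorem posPart_eq_cfc (T : H →L[ℂ] H) : T⁺ = cfc (fun x : ℝ => max x 0) T := by
  rw [CFC.posPart_def, cfcₙ_eq_cfc (hf0 := by simp)]
  rfl

theorem posPart_mem_vonNeumann {N : VonNeumannAlgebra H} {T : H →L[ℂ] H} (hT : T ∈ N) :
    T⁺ ∈ N := by
  rw [posPart_eq_cfc]; exact cfc_mem_vonNeumann hT _

theorem sqrt_mem_vonNeumann {N : VonNeumannAlgebra H} {T : H →L[ℂ] H} (hT : T ∈ N) :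
    CFC.sqrt T ∈ N := by
  refine mem_vonNeumann_of_commute fun _ hS => ?_
  exact ((commute_of_mem_commutant hT hS).cfcₙ_nnreal NNReal.sqrt).symm.eq

theorem realPart_mem_vonNeumann {N : VonNeumannAlgebra H} {T : H →L[ℂ] H} (hT : T ∈ N) :
    (ℜ T : H →L[ℂ] H) ∈ N := by
  rw [realPart_apply_coe]
  exact real_smul_mem_vonNeumann _ (add_mem hT (star_mem hT))

theorem imaginaryPart_mem_vonNeumann {N : VonNeumannAlgebra H} {T : H →L[ℂ] H} (hT : T ∈ N) :
    (ℑ T : H →L[ℂ] H) ∈ N := by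
  rw [imaginaryPart_apply_coe]
  exact smul_mem_vonNeumann _ (real_smul_mem_vonNeumann _ (sub_mem hT (star_mem hT)))

/-- Every element of a von Neumann algebra is a linear combination of its unitaries. -/
theorem exists_sum_unitary_vonNeumann {N : VonNeumannAlgebra H} {T : H →L[ℂ] H} (hT : T ∈ N) :
    T ∈ Submodule.span ℂ {U | U ∈ N ∧ U ∈ unitary (H →L[ℂ] H)} := by
  rcases eq_or_ne T 0 with rfl | hx
  · exact zero_mem _
  -- A self-adjoint contraction is the real part of the unitary a + i √(1 - a²), and the square root
  -- stays in `N`.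
  have key : ∀ (a : selfAdjoint (H →L[ℂ] H)) (ha : ‖a‖ ≤ 1), (a : H →L[ℂ] H) ∈ N →
      (selfAdjoint.unitarySelfAddISMul a ha : H →L[ℂ] H) ∈ N := by
    intro a ha haN
    rw [selfAdjoint.unitarySelfAddISMul_coe]
    exact add_mem haN (smul_mem_vonNeumann _ (sqrt_mem_vonNeumann
      (sub_mem (one_mem N) (pow_mem haN 2))))
  have hm : ‖T‖⁻¹ • T ∈ N := real_smul_mem_vonNeumann _ hT
  have e := CStarAlgebra.norm_smul_two_inv_smul_add_four_unitary T hx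
  extract_lets u₁ u₂ at e
  have h1 : (u₁ : H →L[ℂ] H) ∈ N := key _ _ (realPart_mem_vonNeumann hm)
  have h2 : (u₂ : H →L[ℂ] H) ∈ N := key _ _ (imaginaryPart_mem_vonNeumann hm)
  have s : ∀ u : unitary (H →L[ℂ] H), (u : H →L[ℂ] H) ∈ N →
      (u : H →L[ℂ] H) + (star u : unitary (H →L[ℂ] H)) ∈
        Submodule.span ℂ {U | U ∈ N ∧ U ∈ unitary (H →L[ℂ] H)} := fun u hu =>
    add_mem (Submodule.subset_span ⟨hu, u.2⟩)
      (Submodule.subset_span ⟨by rw [Unitary.coe_star]; exact star_mem hu, (star u).2⟩)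
  rw [e, ← Complex.coe_smul, ← Complex.coe_smul]
  refine Submodule.smul_mem _ _ (Submodule.smul_mem _ _ ?_)
  exact add_mem (s u₁ h1) (Submodule.smul_mem _ _ (s u₂ h2))

/-- Both sides are linear in S, and `N` is spanned by its unitaries, for which the identity is
unitary invariance. -/
theorem IsTraceCone.complexExt_mul_comm {N : VonNeumannAlgebra H} {J : Set (H →L[ℂ] H)}
    {f : (H →L[ℂ] H) → ℝ} (h : IsTraceCone N J f) {S T : H →L[ℂ] H} (hS : S ∈ N)
    (hT : T ∈ Submodule.span ℂ J) : complexExt f (S * T) = complexExt f (T * S) := by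
  -- Membership in `N` is carried along, because the linearity used in the induction needs it at
  -- every intermediate element.
  suffices S ∈ N ∧ complexExt f (S * T) = complexExt f (T * S) from this.2
  have hS' := exists_sum_unitary_vonNeumann hS
  clear hS
  induction hS' using Submodule.span_induction with
  | mem U hU => exact ⟨hU.1, h.complexExt_unitary_mul hU.1 hU.2 hT⟩
  | zero => exact ⟨zero_mem N, by simp⟩
  | add A B _ _ hA hB =>
    refine ⟨add_mem hA.1 hB.1, ?_⟩
    rw [add_mul, mul_add, h.complexExt_add (h.mul_mem_span_left hA.1 hT)
      (h.mul_mem_span_left hB.1 hT), h.complexExt_add (h.mul_mem_span_right hA.1 hT)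
      (h.mul_mem_span_right hB.1 hT), hA.2, hB.2]
  | smul c A _ hA =>
    refine ⟨smul_mem_vonNeumann c hA.1, ?_⟩
    rw [smul_mul_assoc, mul_smul_comm, h.complexExt_smul c (h.mul_mem_span_left hA.1 hT),
      h.complexExt_smul c (h.mul_mem_span_right hA.1 hT), hA.2]

theorem le_of_forall_le_add_smul_one {S T : H →L[ℂ] H}
    (h : ∀ ε : ℝ, 0 < ε → S ≤ T + ε • (1 : H →L[ℂ] H)) : S ≤ T := by
  have h1 : Tendsto (fun ε : ℝ => T + ε • (1 : H →L[ℂ] H)) (𝓝[>] 0) (𝓝 T) := by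
    have : Tendsto (fun ε : ℝ => T + ε • (1 : H →L[ℂ] H)) (𝓝 0) (𝓝 (T + (0 : ℝ) • 1)) :=
      (by fun_prop : Continuous fun ε : ℝ => T + ε • (1 : H →L[ℂ] H)).tendsto 0
    rw [zero_smul, add_zero] at this
    exact this.mono_left nhdsWithin_le_nhds
  exact ge_of_tendsto h1 (eventually_nhdsWithin_of_forall fun ε hε => h ε hε)

theorem le_norm_smul_one {T : H →L[ℂ] H} (hT : IsSelfAdjoint T) :
    T ≤ ‖T‖ • (1 : H →L[ℂ] H) := by
  have := hT.le_algebraMap_norm_self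
  rwa [Algebra.algebraMap_eq_smul_one] at this

theorem star_mul_self_le_smul_one (V : H →L[ℂ] H) :
    star V * V ≤ (‖V‖ ^ 2) • (1 : H →L[ℂ] H) := by
  have := CStarAlgebra.star_mul_le_algebraMap_norm_sq (a := V)
  rwa [Algebra.algebraMap_eq_smul_one] at this

theorem cfc_mul_self_mul_cfc {T : H →L[ℂ] H} (hT : IsSelfAdjoint T) {g : ℝ → ℝ}
    (hg : ContinuousOn g (spectrum ℝ T)) :
    cfc g T * T * cfc g T = cfc (fun x => g x * x * g x) T := by
  rw [cfc_mul (fun x => g x * x) g T (hg.mul continuousOn_id) hg,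
    cfc_mul g (fun x => x) T hg continuousOn_id, cfc_id' ℝ T]

theorem cfc_add_smul_one {T : H →L[ℂ] H} (hT : IsSelfAdjoint T) {g : ℝ → ℝ}
    (hg : ContinuousOn g (spectrum ℝ T)) (c : ℝ) :
    cfc g T + c • (1 : H →L[ℂ] H) = cfc (fun x => g x + c) T := by
  rw [cfc_add_const c g T hg, Algebra.algebraMap_eq_smul_one]

theorem cfc_le_cfc_of_nonneg {T : H →L[ℂ] H} (hT : 0 ≤ T) {f g : ℝ → ℝ}
    (hf : ContinuousOn f (Set.Ici 0)) (hg : ContinuousOn g (Set.Ici 0))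
    (h : ∀ x, 0 ≤ x → f x ≤ g x) : cfc f T ≤ cfc g T :=
  have hs : spectrum ℝ T ⊆ Set.Ici 0 := fun _ hx => spectrum_nonneg_of_nonneg hT hx
  cfc_mono (fun x hx => h x (hs hx)) (hf.mono hs) (hg.mono hs)

end VonNeumann

/-! ### Consequences of traciality and normality of τ -/

section TraceFacts

variable {H : Type*} [NormedAddCommGroup H] [InnerProductSpace ℂ H] [CompleteSpace H]

namespace IsFaithfulNormalSemifiniteTrace

variable {N : VonNeumannAlgebra H} {τ : (H →L[ℂ] H) → ℝ≥0∞}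

theorem real_smul (h : IsFaithfulNormalSemifiniteTrace N τ) {c : ℝ} (hc : 0 ≤ c) {T : H →L[ℂ] H}
    (hT : T ∈ N) (hT0 : 0 ≤ T) : τ (c • T) = ENNReal.ofReal c * τ T := by
  have := h.smul ⟨c, hc⟩ T hT hT0
  rw [← Complex.coe_smul, ENNReal.ofReal, Real.toNNReal_of_nonneg hc]
  exact this

theorem map_zero (h : IsFaithfulNormalSemifiniteTrace N τ) : τ 0 = 0 := by
  have := h.real_smul le_rfl (zero_mem N) le_rfl
  simpa using this

theorem mono (h : IsFaithfulNormalSemifiniteTrace N τ) {S T : H →L[ℂ] H} (hS : S ∈ N) (hT : T ∈ N)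
    (hS0 : 0 ≤ S) (hST : S ≤ T) : τ S ≤ τ T := by
  have := h.add S hS (T - S) (sub_mem hT hS) hS0 (sub_nonneg.2 hST)
  rw [add_sub_cancel] at this
  rw [this]; exact le_self_add

theorem map_sum (h : IsFaithfulNormalSemifiniteTrace N τ) {ι : Type*} (s : Finset ι)
    (T : ι → H →L[ℂ] H) (hT : ∀ i ∈ s, T i ∈ N) (hT0 : ∀ i ∈ s, 0 ≤ T i) :
    τ (∑ i ∈ s, T i) = ∑ i ∈ s, τ (T i) := by
  classical
  induction s using Finset.induction_on with
  | empty => simpa using h.map_zero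
  | insert i s hi ih =>
    have h1 := fun j hj => hT j (Finset.mem_insert_of_mem hj)
    have h2 := fun j hj => hT0 j (Finset.mem_insert_of_mem hj)
    rw [Finset.sum_insert hi, Finset.sum_insert hi, h.add _ (hT i (Finset.mem_insert_self _ _)) _
      (sum_mem h1) (hT0 i (Finset.mem_insert_self _ _)) (Finset.sum_nonneg h2), ih h1 h2]

/-- Traciality applied to V √A. Moving V inside as V* V allows an order estimate by ‖V‖² A, and in
the Riesz decomposition lets contributions be added under one √A. -/
theorem conj_eq (h : IsFaithfulNormalSemifiniteTrace N τ) {V A : H →L[ℂ] H} (hV : V ∈ N)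
    (hA : A ∈ N) (hA0 : 0 ≤ A) :
    τ (V * A * star V) = τ (CFC.sqrt A * (star V * V) * CFC.sqrt A) := by
  have hs : star (CFC.sqrt A) = CFC.sqrt A := (CFC.sqrt_nonneg A).isSelfAdjoint.star_eq
  have := h.tracial (star (V * CFC.sqrt A)) (star_mem (mul_mem hV (sqrt_mem_vonNeumann hA)))
  rw [star_star, star_mul, hs] at this
  rw [show V * A * star V = V * CFC.sqrt A * (CFC.sqrt A * star V) by
    conv_lhs => rw [← CFC.sqrt_mul_sqrt_self A hA0]
    simp only [mul_assoc], this]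
  simp only [mul_assoc]

theorem conj_le (h : IsFaithfulNormalSemifiniteTrace N τ) {V A : H →L[ℂ] H} (hV : V ∈ N)
    (hA : A ∈ N) (hA0 : 0 ≤ A) : τ (V * A * star V) ≤ ENNReal.ofReal (‖V‖ ^ 2) * τ A := by
  have hsa : IsSelfAdjoint (CFC.sqrt A) := (CFC.sqrt_nonneg A).isSelfAdjoint
  have hsN := sqrt_mem_vonNeumann hA
  rw [h.conj_eq hV hA hA0, ← h.real_smul (sq_nonneg _) hA hA0]
  refine h.mono (mul_mem (mul_mem hsN (mul_mem (star_mem hV) hV)) hsN)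
    (real_smul_mem_vonNeumann _ hA) (hsa.conjugate_nonneg (star_mul_self_nonneg V)) ?_
  have := hsa.conjugate_le_conjugate (star_mul_self_le_smul_one V)
  rwa [mul_smul_comm, smul_mul_assoc, mul_one, CFC.sqrt_mul_sqrt_self A hA0] at this

theorem conj_le_of_norm_le_one (h : IsFaithfulNormalSemifiniteTrace N τ) {V A : H →L[ℂ] H}
    (hV : V ∈ N) (hV1 : ‖V‖ ≤ 1) (hA : A ∈ N) (hA0 : 0 ≤ A) : τ (V * A * star V) ≤ τ A := by
  refine (h.conj_le hV hA hA0).trans (mul_le_of_le_one_left zero_le ?_)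
  exact ENNReal.ofReal_le_one.2 (pow_le_one₀ (norm_nonneg _) hV1)

theorem eq_iSup_of_monotone (h : IsFaithfulNormalSemifiniteTrace N τ) {S : ℕ → H →L[ℂ] H}
    {T : H →L[ℂ] H} (hm : Monotone S) (hS : ∀ n, S n ∈ N) (hS0 : ∀ n, 0 ≤ S n) (hT : T ∈ N)
    (hlub : IsLUB (Set.range S) T) : τ T = ⨆ n, τ (S n) := by
  rw [h.normal (Set.range S) T (Set.range_nonempty S) ?_ ?_ hT hlub, iSup_range]
  · rintro _ ⟨m, rfl⟩ _ ⟨n, rfl⟩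
    exact ⟨S (max m n), ⟨_, rfl⟩, hm (le_max_left _ _), hm (le_max_right _ _)⟩
  · rintro _ ⟨n, rfl⟩
    exact ⟨hS n, hS0 n⟩

/-- Normality along sequences increasing to a norm limit. -/
theorem le_of_norm_approx (h : IsFaithfulNormalSemifiniteTrace N τ) {S : ℕ → H →L[ℂ] H}
    {T : H →L[ℂ] H} (hm : Monotone S) (hS : ∀ n, S n ∈ N) (hS0 : ∀ n, 0 ≤ S n) (hT : T ∈ N)
    (hle : ∀ n, S n ≤ T) (happ : ∀ ε : ℝ, 0 < ε → ∃ n, T ≤ S n + ε • (1 : H →L[ℂ] H)) {c : ℝ≥0∞}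
    (hc : ∀ n, τ (S n) ≤ c) : τ T ≤ c := by
  rw [h.eq_iSup_of_monotone hm hS hS0 hT ⟨?_, ?_⟩]
  · exact iSup_le hc
  · rintro _ ⟨n, rfl⟩; exact hle n
  · intro B hB
    refine le_of_forall_le_add_smul_one fun ε hε => ?_
    obtain ⟨n, hn⟩ := happ ε hε
    exact hn.trans (add_le_add_left (hB ⟨n, rfl⟩) _)

/-- If `Y ≤ P` then `τ(Y⁺) ≤ τ(P)`. -/
theorem posPart_le (h : IsFaithfulNormalSemifiniteTrace N τ) {Y P : H →L[ℂ] H} (hY : Y ∈ N)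
    (hYs : IsSelfAdjoint Y) (hP : P ∈ N) (hP0 : 0 ≤ P) (hYP : Y ≤ P) : τ Y⁺ ≤ τ P := by
  -- The squares of the g_n increase to the indicator of (0, ∞). Thus g_n(Y) Y g_n(Y) increases to
  -- Y⁺ in norm, while g_n(Y) is a contraction, so Y ≤ P gives τ(g_n(Y) Y g_n(Y)) ≤ τ(P). Normality
  -- passes to the limit.
  let g : ℕ → ℝ → ℝ := fun n x => √(min 1 (n * max x 0))
  have hg : ∀ n, Continuous (g n) := fun n => by fun_prop
  have hg1 : ∀ n x, g n x * g n x = min 1 (n * max x 0) := fun n x =>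
    Real.mul_self_sqrt (by positivity)
  let S : ℕ → H →L[ℂ] H := fun n => cfc (g n) Y * Y * cfc (g n) Y
  have hSe : ∀ n, S n = cfc (fun x => g n x * x * g n x) Y := by
    intro n
    exact cfc_mul_self_mul_cfc hYs (hg n).continuousOn
  have hval : ∀ n x, g n x * x * g n x = min 1 (n * max x 0) * x := fun n x => by
    rw [← hg1]; ring
  have hnn : ∀ n x, 0 ≤ g n x * x * g n x := by
    intro n x
    rw [hval]
    rcases le_total 0 x with hx | hx
    · positivity
    · simp [max_eq_right hx]
  rw [posPart_eq_cfc]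
  refine h.le_of_norm_approx (S := S) ?_ ?_ ?_ (cfc_mem_vonNeumann hY _) ?_ ?_ ?_
  · intro m n hmn
    rw [hSe, hSe]
    refine cfc_mono (fun x _ => ?_) (by fun_prop) (by fun_prop)
    rw [hval, hval]
    rcases le_total 0 x with hx | hx
    · gcongr
    · simp [max_eq_right hx]
  · exact fun n => mul_mem (mul_mem (cfc_mem_vonNeumann hY _) hY) (cfc_mem_vonNeumann hY _)
  · intro n
    rw [hSe]
    exact cfc_nonneg fun x _ => hnn n x
  · intro n
    rw [hSe]
    refine cfc_mono (fun x _ => ?_) (by fun_prop) (by fun_prop)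
    rw [hval]
    rcases le_total 0 x with hx | hx
    · rw [max_eq_left hx]
      exact mul_le_of_le_one_left hx (min_le_left _ _)
    · simp [max_eq_right hx]
  · intro ε hε
    obtain ⟨n, hn⟩ := exists_nat_gt ε⁻¹
    refine ⟨n, ?_⟩
    rw [hSe, cfc_add_smul_one hYs (by fun_prop)]
    refine cfc_mono (fun x _ => ?_) (by fun_prop) (by fun_prop)
    rw [hval]
    rcases le_total 0 x with hx | hx
    · rw [max_eq_left hx]
      rcases le_total x ε with hxe | hxe
      · have : 0 ≤ min 1 (n * x) * x := by positivity
        linarith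
      · have : 1 ≤ n * x := by
          have h1 : ε⁻¹ * ε ≤ n * x := by gcongr
          rwa [inv_mul_cancel₀ hε.ne'] at h1
        rw [min_eq_left this]; linarith
    · simp [max_eq_right hx, hε.le]
  · intro n
    have hgs : IsSelfAdjoint (cfc (g n) Y) := cfc_predicate _ _
    have hn1 : ‖cfc (g n) Y‖ ≤ 1 := by
      refine norm_cfc_le zero_le_one fun x _ => ?_
      rw [Real.norm_eq_abs, abs_of_nonneg (Real.sqrt_nonneg _)]
      exact Real.sqrt_le_one.2 (min_le_left _ _)
    have h1 : S n ≤ cfc (g n) Y * P * cfc (g n) Y := hgs.conjugate_le_conjugate hYP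
    have hgN : cfc (g n) Y ∈ N := cfc_mem_vonNeumann hY _
    refine (h.mono (mul_mem (mul_mem hgN hY) hgN) (mul_mem (mul_mem hgN hP) hgN) ?_ h1).trans ?_
    · change 0 ≤ S n
      rw [hSe]
      exact cfc_nonneg fun x _ => hnn n x
    · have := h.conj_le_of_norm_le_one hgN hn1 hP hP0
      rwa [hgs.star_eq] at this

/-- The finite part of the trace is a trace cone. -/
theorem isTraceCone (h : IsFaithfulNormalSemifiniteTrace N τ) :
    IsTraceCone N {T | T ∈ N ∧ 0 ≤ T ∧ τ T < ∞} fun T => (τ T).toReal where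
  mem P hP := hP.1
  nonneg P hP := hP.2.1
  zero_mem' := ⟨zero_mem N, le_rfl, by simp [h.map_zero]⟩
  add_mem' P hP Q hQ := ⟨add_mem hP.1 hQ.1, add_nonneg hP.2.1 hQ.2.1, by
    rw [h.add P hP.1 Q hQ.1 hP.2.1 hQ.2.1]; exact ENNReal.add_lt_top.2 ⟨hP.2.2, hQ.2.2⟩⟩
  smul_mem' c hc P hP := ⟨real_smul_mem_vonNeumann c hP.1, smul_nonneg hc hP.2.1, by
    rw [h.real_smul hc hP.1 hP.2.1]; exact ENNReal.mul_lt_top ENNReal.ofReal_lt_top hP.2.2⟩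
  posPart_mem Y hY hYs P hP hYP := ⟨posPart_mem_vonNeumann hY, CFC.posPart_nonneg Y,
    (h.posPart_le hY hYs hP.1 hP.2.1 hYP).trans_lt hP.2.2⟩
  conj_mem V hV P hP := ⟨mul_mem (mul_mem hV hP.1) (star_mem hV),
    star_right_conjugate_nonneg hP.2.1 V,
    (h.conj_le hV hP.1 hP.2.1).trans_lt (ENNReal.mul_lt_top ENNReal.ofReal_lt_top hP.2.2)⟩
  map_nonneg P hP := ENNReal.toReal_nonneg
  map_add' P hP Q hQ := by
    rw [h.add P hP.1 Q hQ.1 hP.2.1 hQ.2.1, ENNReal.toReal_add hP.2.2.ne hQ.2.2.ne]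
  map_smul' c hc P hP := by
    rw [h.real_smul hc hP.1 hP.2.1, ENNReal.toReal_mul, ENNReal.toReal_ofReal hc]
  map_conj_le V hV P hP := by
    have := ENNReal.toReal_mono (ENNReal.mul_lt_top ENNReal.ofReal_lt_top hP.2.2).ne
      (h.conj_le hV hP.1 hP.2.1)
    rwa [ENNReal.toReal_mul, ENNReal.toReal_ofReal (sq_nonneg _)] at this

end IsFaithfulNormalSemifiniteTrace

end TraceFacts

/-! ### Kernel projections as limits of resolvents, and comparison of supports -/

section KernelProjection

variable {H : Type*} [NormedAddCommGroup H] [InnerProductSpace ℂ H] [CompleteSpace H]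

/-- The projection onto the kernel of `W`. -/
def kerProj (W : H →L[ℂ] H) : H →L[ℂ] H := W.ker.starProjection

theorem isStarProjection_kerProj (W : H →L[ℂ] H) : IsStarProjection (kerProj W) :=
  isStarProjection_starProjection

theorem mul_kerProj (W : H →L[ℂ] H) : W * kerProj W = 0 := by
  ext x
  exact Submodule.starProjection_apply_mem W.ker x

theorem kerProj_mul_of_mul_eq_zero {W A : H →L[ℂ] H} (h : W * A = 0) : kerProj W * A = A := by
  ext x
  exact Submodule.starProjection_eq_self_iff.2 (congrArg (fun B : H →L[ℂ] H => B x) h)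

theorem kerProj_mem_vonNeumann {N : VonNeumannAlgebra H} {W : H →L[ℂ] H} (hW : W ∈ N) :
    kerProj W ∈ N := by
  refine (VonNeumannAlgebra.IsStarProjection.mem_iff (isStarProjection_kerProj W) N).2 fun y hy => ?_
  rw [kerProj, Submodule.range_starProjection]
  intro x hx
  have h1 := congrArg (fun B : H →L[ℂ] H => B x) (commute_of_mem_commutant hW hy).eq
  have hx0 : W x = 0 := hx
  change W (y x) = y (W x) at h1
  change W (y x) = 0
  rw [h1, hx0, map_zero]

theorem sub_kerProj_mem {W x} : x - kerProj W x ∈ (W : H →L[ℂ] H).kerᗮ :=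
  Submodule.sub_starProjection_mem_orthogonal x

theorem mem_closure_range_of_selfAdjoint {W : H →L[ℂ] H} (hW : IsSelfAdjoint W) (x : H) :
    x - kerProj W x ∈ closure (Set.range W) := by
  have h := sub_kerProj_mem (W := W) (x := x)
  rw [ContinuousLinearMap.orthogonal_ker, hW.adjoint_eq] at h
  exact h

/-- A vanishes on the range of W, hence on its closure, which for self-adjoint W is the orthogonal
complement of the kernel. -/
theorem mul_one_sub_kerProj {A W : H →L[ℂ] H} (hW : IsSelfAdjoint W) (h : A * W = 0) :
    A * (1 - kerProj W) = 0 := by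
  ext x
  have h1 : closure (Set.range W) ⊆ {y | A y = 0} := by
    refine closure_minimal ?_ (isClosed_eq A.continuous continuous_const)
    rintro _ ⟨z, rfl⟩
    exact congrArg (fun B : H →L[ℂ] H => B z) h
  exact h1 (mem_closure_range_of_selfAdjoint hW x)

/-- Such an S equals its compression (1 - F) S (1 - F), so the bound by c can be compressed as well.
-/
theorem le_smul_one_sub_of_mul_eq_zero {S F : H →L[ℂ] H} {c : ℝ} (hS : IsSelfAdjoint S)
    (hF : IsStarProjection F) (hSc : S ≤ c • (1 : H →L[ℂ] H)) (h : S * F = 0) : S ≤ c • (1 - F) := by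
  have h' : F * S = 0 := by
    have := congrArg star h
    rwa [star_mul, hS.star_eq, hF.isSelfAdjoint.star_eq, star_zero] at this
  have h1 := hF.one_sub.isSelfAdjoint.conjugate_le_conjugate hSc
  have h2 : (1 - F) * S * (1 - F) = S := by
    rw [sub_mul, h', one_mul, sub_zero, mul_sub, h, mul_one, sub_zero]
  rwa [h2, mul_smul_comm, smul_mul_assoc, mul_one, hF.one_sub.isIdempotentElem.eq] at h1

/-- The resolvent `(1 + n W)⁻¹`. -/
def cutResolvent (n : ℕ) (W : H →L[ℂ] H) : H →L[ℂ] H := cfc (fun x : ℝ => (1 + n * x)⁻¹) W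

theorem spectrum_subset_of_nonneg {W : H →L[ℂ] H} (hW : 0 ≤ W) : spectrum ℝ W ⊆ Set.Ici 0 :=
  fun _ hx => spectrum_nonneg_of_nonneg hW hx

theorem continuousOn_cutResolvent (n : ℕ) :
    ContinuousOn (fun x : ℝ => (1 + n * x)⁻¹) (Set.Ici 0) := by
  refine ContinuousOn.inv₀ (by fun_prop) fun x hx => ?_
  have : (0 : ℝ) ≤ n * x := mul_nonneg (Nat.cast_nonneg n) hx
  positivity

theorem cutResolvent_mul {W : H →L[ℂ] H} (hW : 0 ≤ W) (n : ℕ) :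
    cutResolvent n W * (1 + (n : ℝ) • W) = 1 ∧ (1 + (n : ℝ) • W) * cutResolvent n W = 1 := by
  have hs := spectrum_subset_of_nonneg hW
  have hsa : IsSelfAdjoint W := .of_nonneg hW
  have e : 1 + (n : ℝ) • W = cfc (fun x : ℝ => 1 + n * x) W := by
    rw [cfc_const_add (1 : ℝ) (fun x => n * x) W, cfc_const_mul_id (n : ℝ) W, map_one]
  have h1 : ∀ x ∈ spectrum ℝ W, (1 + n * x)⁻¹ * (1 + n * x) = 1 := fun x hx => by
    have : (0 : ℝ) ≤ n * x := mul_nonneg (Nat.cast_nonneg n) (hs hx)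
    exact inv_mul_cancel₀ (by positivity)
  constructor
  · rw [e, cutResolvent, ← cfc_mul _ _ W ((continuousOn_cutResolvent n).mono hs) (by fun_prop),
      cfc_congr (g := fun _ => (1 : ℝ)) h1, cfc_const_one ℝ W]
  · rw [e, cutResolvent, ← cfc_mul _ _ W (by fun_prop) ((continuousOn_cutResolvent n).mono hs),
      cfc_congr (g := fun _ => (1 : ℝ)) (fun x hx => (mul_comm _ _).trans (h1 x hx)),
      cfc_const_one ℝ W]

theorem one_sub_cutResolvent {W : H →L[ℂ] H} (hW : 0 ≤ W) (n : ℕ) :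
    1 - cutResolvent n W = cfc (fun x : ℝ => n * x * (1 + n * x)⁻¹) W := by
  have hs := spectrum_subset_of_nonneg hW
  have hsa : IsSelfAdjoint W := .of_nonneg hW
  rw [cutResolvent, ← cfc_const_one ℝ W, ← cfc_sub _ _ W (by fun_prop)
    ((continuousOn_cutResolvent n).mono hs)]
  refine cfc_congr fun x hx => ?_
  have : (0 : ℝ) ≤ n * x := mul_nonneg (Nat.cast_nonneg n) (hs hx)
  have : 1 + n * x ≠ 0 := by positivity
  field_simp
  ring

/-- Inversion is operator antitone. This is the reason for approximating supports by resolvents: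
most other cutoff functions do not respect the operator order. -/
theorem cutResolvent_le_of_le {W P : H →L[ℂ] H} (hW : 0 ≤ W) (hWP : W ≤ P) (n : ℕ) :
    cutResolvent n P ≤ cutResolvent n W := by
  have key : ∀ W : H →L[ℂ] H, 0 ≤ W → cutResolvent n W = Ring.inverse (1 + (n : ℝ) • W) ∧
      IsUnit (1 + (n : ℝ) • W) := by
    intro W hW
    obtain ⟨h1, h2⟩ := cutResolvent_mul hW n
    let u : (H →L[ℂ] H)ˣ := ⟨_, _, h2, h1⟩
    exact ⟨(Ring.inverse_unit u).symm, u.isUnit⟩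
  rw [(key W hW).1, (key P (hW.trans hWP)).1]
  have hle : 1 + (n : ℝ) • W ≤ 1 + (n : ℝ) • P := by gcongr
  refine CStarAlgebra.ringInverse_le_ringInverse hle ?_
  exact (key W hW).2.isStrictlyPositive (add_nonneg zero_le_one (smul_nonneg (by positivity) hW))

theorem one_sub_cutResolvent_nonneg {W : H →L[ℂ] H} (hW : 0 ≤ W) (n : ℕ) :
    0 ≤ 1 - cutResolvent n W := by
  rw [one_sub_cutResolvent hW]
  refine cfc_nonneg fun x hx => ?_
  have : (0 : ℝ) ≤ n * x := mul_nonneg (Nat.cast_nonneg n) (spectrum_subset_of_nonneg hW hx)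
  positivity

theorem cutResolvent_nonneg {W : H →L[ℂ] H} (hW : 0 ≤ W) (n : ℕ) : 0 ≤ cutResolvent n W := by
  refine cfc_nonneg fun x hx => ?_
  have : (0 : ℝ) ≤ n * x := mul_nonneg (Nat.cast_nonneg n) (spectrum_subset_of_nonneg hW hx)
  positivity

theorem cutResolvent_antitone {W : H →L[ℂ] H} (hW : 0 ≤ W) :
    Antitone fun n => cutResolvent n W := by
  intro m n hmn
  refine cfc_le_cfc_of_nonneg hW (continuousOn_cutResolvent n) (continuousOn_cutResolvent m) ?_
  intro x hx
  gcongr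

/-- The resolvents fix the kernel of W, and on its range n (1 + nW)⁻¹ W z = z - (1 + nW)⁻¹ z forces
decay like 1/n. Contractivity extends this to the closure of the range. -/
theorem tendsto_cutResolvent {W : H →L[ℂ] H} (hW : 0 ≤ W) (x : H) :
    Tendsto (fun n => cutResolvent n W x) atTop (𝓝 (kerProj W x)) := by
  have hfix : ∀ n, cutResolvent n W (kerProj W x) = kerProj W x := by
    intro n
    have h1 := congrArg (fun B : H →L[ℂ] H => B (kerProj W x)) (cutResolvent_mul hW n).1
    have h2 : W (kerProj W x) = 0 := congrArg (fun B : H →L[ℂ] H => B x) (mul_kerProj W)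
    simpa [h2] using h1
  have hn : ∀ n, ‖cutResolvent n W‖ ≤ 1 := fun n =>
    (CStarAlgebra.norm_le_one_iff_of_nonneg _ (cutResolvent_nonneg hW n)).2
      (sub_nonneg.1 (one_sub_cutResolvent_nonneg hW n))
  rw [Metric.tendsto_atTop]
  intro ε hε
  obtain ⟨_, ⟨z, rfl⟩, hz⟩ := Metric.mem_closure_iff.1
    (mem_closure_range_of_selfAdjoint (.of_nonneg hW) x) (ε / 2) (half_pos hε)
  obtain ⟨k, hk⟩ := exists_nat_gt (2 * ‖z‖ / ε * 2)
  refine ⟨k + 1, fun n hnk => ?_⟩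
  have hn0 : (0 : ℝ) < n := by exact_mod_cast (Nat.succ_pos k).trans_le hnk
  have hnW : (n : ℝ) • cutResolvent n W (W z) = z - cutResolvent n W z := by
    have h1 := congrArg (fun B : H →L[ℂ] H => B z) (cutResolvent_mul hW n).1
    change cutResolvent n W (z + (n : ℝ) • W z) = z at h1
    rw [map_add, ← Complex.coe_smul, map_smul, Complex.coe_smul] at h1
    exact eq_sub_of_add_eq' h1
  have hWz : ‖cutResolvent n W (W z)‖ ≤ 2 * ‖z‖ / n := by
    rw [le_div_iff₀ hn0, mul_comm, ← Real.norm_of_nonneg hn0.le, ← norm_smul, hnW, two_mul]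
    exact (norm_sub_le _ _).trans (by
      gcongr; exact ((cutResolvent n W).le_of_opNorm_le (hn n) z).trans_eq (one_mul _))
  have hlt : 2 * ‖z‖ / n < ε / 2 := by
    have : (k : ℝ) < n := by exact_mod_cast hnk
    have h2 := hk.trans this
    rw [div_lt_iff₀ hn0]
    rw [div_mul_eq_mul_div, div_lt_iff₀ hε] at h2
    linarith
  have e : cutResolvent n W x - kerProj W x
      = cutResolvent n W (x - kerProj W x - W z) + cutResolvent n W (W z) := by
    rw [← map_add, sub_add_cancel, map_sub, hfix]
  rw [dist_eq_norm, e]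
  calc _ ≤ ‖cutResolvent n W (x - kerProj W x - W z)‖ + ‖cutResolvent n W (W z)‖ := norm_add_le _ _
    _ ≤ 1 * ‖x - kerProj W x - W z‖ + 2 * ‖z‖ / n := by
      gcongr; exact (cutResolvent n W).le_of_opNorm_le (hn n) _
    _ < ε := by rw [one_mul, ← dist_eq_norm]; linarith

/-- Normality of τ speaks of least upper bounds in the operator order; strong convergence supplies
one, because quadratic forms pass to the limit. -/
theorem isLUB_one_sub_cutResolvent {W : H →L[ℂ] H} (hW : 0 ≤ W) :
    IsLUB (Set.range fun n => 1 - cutResolvent n W) (1 - kerProj W) := by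
  have hsa : IsSelfAdjoint W := .of_nonneg hW
  constructor
  · rintro _ ⟨n, rfl⟩
    have h0 : (1 - cutResolvent n W) * kerProj W = 0 := by
      have : (1 - cutResolvent n W) = cutResolvent n W * ((n : ℝ) • W) := by
        rw [sub_eq_iff_eq_add', ← (cutResolvent_mul hW n).1, mul_add, mul_one]
      rw [this, mul_smul_comm, smul_mul_assoc, mul_assoc, mul_kerProj, mul_zero, smul_zero]
    have := le_smul_one_sub_of_mul_eq_zero (c := 1)
      (.of_nonneg (one_sub_cutResolvent_nonneg hW n)) (isStarProjection_kerProj W)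
      (by rw [one_smul]; exact sub_le_self _ (cutResolvent_nonneg hW n)) h0
    rwa [one_smul] at this
  · intro S hS
    have hS' : ∀ n, 1 - cutResolvent n W ≤ S := fun n => hS ⟨n, rfl⟩
    have hSs : IsSelfAdjoint S :=
      .of_nonneg ((one_sub_cutResolvent_nonneg hW 0).trans (hS' 0))
    rw [ContinuousLinearMap.le_def, ContinuousLinearMap.isPositive_def']
    refine ⟨hSs.sub (isStarProjection_kerProj W).one_sub.isSelfAdjoint, fun x => ?_⟩
    have h1 : Tendsto (fun n => (S - (1 - cutResolvent n W)).reApplyInnerSelf x) atTop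
        (𝓝 ((S - (1 - kerProj W)).reApplyInnerSelf x)) := by
      simp only [ContinuousLinearMap.reApplyInnerSelf, sub_apply]
      have := tendsto_cutResolvent hW x
      exact (Complex.continuous_re.tendsto _).comp
        (((tendsto_const_nhds.sub (tendsto_const_nhds.sub this))).inner tendsto_const_nhds)
    refine ge_of_tendsto' h1 fun n => ?_
    exact (ContinuousLinearMap.isPositive_def'.1 ((ContinuousLinearMap.le_def _ _).1 (hS' n))).2 x

theorem IsFaithfulNormalSemifiniteTrace.kerProj_eq_iSup {N : VonNeumannAlgebra H}
    {τ : (H →L[ℂ] H) → ℝ≥0∞} (h : IsFaithfulNormalSemifiniteTrace N τ) {W : H →L[ℂ] H}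
    (hW : 0 ≤ W) (hWN : W ∈ N) : τ (1 - kerProj W) = ⨆ n, τ (1 - cutResolvent n W) :=
  h.eq_iSup_of_monotone (fun _ _ hmn => sub_le_sub_left (cutResolvent_antitone hW hmn) _)
    (fun _ => sub_mem (one_mem N) (cfc_mem_vonNeumann hWN _))
    (one_sub_cutResolvent_nonneg hW) (sub_mem (one_mem N) (kerProj_mem_vonNeumann hWN))
    (isLUB_one_sub_cutResolvent hW)

theorem isStarProjection_mul_self_mul_le {F A : H →L[ℂ] H} (hF : IsStarProjection F) {c : ℝ}
    (hA : A ≤ c • (1 : H →L[ℂ] H)) : F * A * F ≤ c • F := by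
  have := hF.isSelfAdjoint.conjugate_le_conjugate hA
  rwa [mul_smul_comm, smul_mul_assoc, mul_one, hF.isIdempotentElem.eq] at this

/-- If `W ≤ X* X` and `X` has range in the projection `F`, then the support of `W` has trace at
most `τ F`. -/
theorem IsFaithfulNormalSemifiniteTrace.support_le {N : VonNeumannAlgebra H}
    {τ : (H →L[ℂ] H) → ℝ≥0∞} (h : IsFaithfulNormalSemifiniteTrace N τ) {W X F : H →L[ℂ] H}
    (hW : 0 ≤ W) (hWN : W ∈ N) (hX : X ∈ N) (hF : F ∈ N) (hFp : IsStarProjection F)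
    (hFX : F * X = X) (hWX : W ≤ star X * X) : τ (1 - kerProj W) ≤ τ F := by
  rw [h.kerProj_eq_iSup hW hWN]
  refine iSup_le fun n => ?_
  have hXX : 0 ≤ star X * X := star_mul_self_nonneg X
  have hXN : star X * X ∈ N := mul_mem (star_mem hX) hX
  have hXs : IsSelfAdjoint (star X * X) := .of_nonneg hXX
  have hs := spectrum_subset_of_nonneg hXX
  -- The choice g(x)² x = n x / (1 + n x) gives V* V = 1 - (1 + n X* X)⁻¹ for V = X g(X* X). As V is
  -- a contraction with range in F, V V* ≤ F, and traciality exchanges V* V and V V*.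
  let g : ℝ → ℝ := fun x => √(n * (1 + n * x)⁻¹)
  have hg : ContinuousOn g (spectrum ℝ (star X * X)) :=
    (continuousOn_const.mul ((continuousOn_cutResolvent n).mono hs)).sqrt
  have hgs : IsSelfAdjoint (cfc g (star X * X)) := cfc_predicate _ _
  set V := X * cfc g (star X * X) with hV
  have hVN : V ∈ N := mul_mem hX (cfc_mem_vonNeumann hXN _)
  have hVV : star V * V = 1 - cutResolvent n (star X * X) := by
    rw [hV, star_mul, hgs.star_eq, mul_assoc, ← mul_assoc (star X), ← mul_assoc,
      cfc_mul_self_mul_cfc hXs hg, one_sub_cutResolvent hXX]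
    refine cfc_congr fun x hx => ?_
    have h0 : (0 : ℝ) ≤ n * (1 + n * x)⁻¹ := by
      have := hs hx
      have : (0 : ℝ) ≤ x := this
      positivity
    change √(n * (1 + n * x)⁻¹) * x * √(n * (1 + n * x)⁻¹) = _
    rw [mul_right_comm, Real.mul_self_sqrt h0]; ring
  have hVle : star V * V ≤ 1 := by
    rw [hVV]; exact sub_le_self _ (cutResolvent_nonneg hXX n)
  have hV1 : ‖star V‖ ^ 2 ≤ 1 := by
    rw [norm_star, sq, ← CStarRing.norm_star_mul_self]
    exact (CStarAlgebra.norm_le_one_iff_of_nonneg _ (star_mul_self_nonneg V)).2 hVle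
  have hFV : F * V = V := by rw [hV, ← mul_assoc, hFX]
  have hVF : V * star V ≤ F := by
    have h1 := star_mul_self_le_smul_one (star V)
    rw [star_star] at h1
    have h2 := isStarProjection_mul_self_mul_le hFp
      (h1.trans (smul_le_smul_of_nonneg_right hV1 zero_le_one))
    have h3 : star V * F = star V := by
      have := congrArg star hFV
      rwa [star_mul, hFp.isSelfAdjoint.star_eq] at this
    rwa [one_smul, ← mul_assoc, hFV, mul_assoc, h3] at h2
  calc τ (1 - cutResolvent n W) ≤ τ (star V * V) := by
        rw [hVV]
        exact h.mono (sub_mem (one_mem N) (cfc_mem_vonNeumann hWN _))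
          (sub_mem (one_mem N) (cfc_mem_vonNeumann hXN _)) (one_sub_cutResolvent_nonneg hW n)
          (sub_le_sub_left (cutResolvent_le_of_le hW hWX n) _)
    _ = τ (V * star V) := h.tracial V hVN
    _ ≤ τ F := h.mono (mul_mem hVN (star_mem hVN)) hF (mul_star_self_nonneg V) hVF

end KernelProjection

/-! ### Spectral projections and their minimality among projections -/

section SpectralProjection

variable {H : Type*} [NormedAddCommGroup H] [InnerProductSpace ℂ H] [CompleteSpace H]

/-- The spectral projection of `T` for `(-∞, l]`. -/
def specProj (T : H →L[ℂ] H) (l : ℝ) : H →L[ℂ] H := kerProj (cfc (fun x : ℝ => max (x - l) 0) T)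

theorem isStarProjection_specProj (T : H →L[ℂ] H) (l : ℝ) : IsStarProjection (specProj T l) :=
  isStarProjection_kerProj _

theorem specProj_mem_vonNeumann {N : VonNeumannAlgebra H} {T : H →L[ℂ] H} (hT : T ∈ N) (l : ℝ) :
    specProj T l ∈ N :=
  kerProj_mem_vonNeumann (cfc_mem_vonNeumann hT _)

theorem mul_eq_zero_of_conj {S E : H →L[ℂ] H} (h : star E * (star S * S) * E = 0) :
    S * E = 0 := by
  refine CStarRing.star_mul_self_eq_zero_iff _ |>.1 ?_
  rw [star_mul]; simpa only [mul_assoc] using h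

/-- The pointwise domination gives f(T)² ≤ C g(T)²; compressing by the kernel projection of g(T)
kills the right side. -/
theorem cfc_mul_kerProj_eq_zero {T : H →L[ℂ] H} {f g : ℝ → ℝ}
    (hf : ContinuousOn f (spectrum ℝ T)) (hg : ContinuousOn g (spectrum ℝ T)) {C : ℝ}
    (hfg : ∀ x ∈ spectrum ℝ T, f x * f x ≤ C * (g x * g x)) : cfc f T * kerProj (cfc g T) = 0 := by
  have hfs : IsSelfAdjoint (cfc f T) := cfc_predicate _ _
  have hE := (isStarProjection_kerProj (cfc g T)).isSelfAdjoint
  refine mul_eq_zero_of_conj (le_antisymm ?_ (star_left_conjugate_nonneg (star_mul_self_nonneg _) _))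
  have h1 : star (cfc f T) * cfc f T ≤ C • (cfc g T * cfc g T) := by
    rw [hfs.star_eq, ← cfc_mul f f T hf hf, ← cfc_mul g g T hg hg,
      ← cfc_const_mul C (fun x => g x * g x) T (hg.mul hg)]
    exact cfc_mono hfg (hf.mul hf) (continuousOn_const.mul (hg.mul hg))
  have h2 := star_left_conjugate_le_conjugate h1 (kerProj (cfc g T))
  refine h2.trans_eq ?_
  rw [mul_smul_comm, smul_mul_assoc, mul_assoc, mul_assoc (cfc g T), mul_kerProj, mul_zero,
    mul_zero, smul_zero]

/-- On the spectral subspace for (-∞, l], g(T) agrees with g(min(T, l)), whose norm is at most g(l).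
The Lipschitz-type hypothesis ensures that the difference vanishes on the kernel of (T - l)⁺. -/
theorem norm_mul_specProj_le {T : H →L[ℂ] H} (hT : 0 ≤ T) {l : ℝ} (hl : 0 ≤ l) {g : ℝ → ℝ}
    (hg : ContinuousOn g (Set.Ici 0)) (hg' : MonotoneOn g (Set.Ici 0)) (hg0 : 0 ≤ g 0)
    (hgl : ∃ C, ∀ x ∈ spectrum ℝ T, g x - g (min x l) ≤ C * max (x - l) 0) :
    ‖cfc g T * specProj T l‖ ≤ g l := by
  have hs := spectrum_subset_of_nonneg hT
  have hsa : IsSelfAdjoint T := .of_nonneg hT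
  obtain ⟨C, hC⟩ := hgl
  have hmin : ContinuousOn (fun x => g (min x l)) (spectrum ℝ T) :=
    hg.comp (by fun_prop) fun x hx => le_min (hs hx) hl
  have e : cfc g T * specProj T l = cfc (fun x => g (min x l)) T * specProj T l := by
    rw [← sub_eq_zero, ← sub_mul, ← cfc_sub g _ T (hg.mono hs) hmin]
    refine cfc_mul_kerProj_eq_zero (C := C * C) ((hg.mono hs).sub hmin) (by fun_prop) ?_
    intro x hx
    have h0 : 0 ≤ g x - g (min x l) :=
      sub_nonneg.2 (hg' (le_min (hs hx) hl) (hs hx) (min_le_left _ _))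
    calc _ ≤ (C * max (x - l) 0) * (C * max (x - l) 0) :=
          mul_self_le_mul_self h0 (hC x hx)
      _ = _ := by ring
  have hgl0 : 0 ≤ g l := hg0.trans (hg' Set.self_mem_Ici hl hl)
  rw [e]
  calc _ ≤ ‖cfc (fun x => g (min x l)) T‖ * ‖specProj T l‖ := norm_mul_le _ _
    _ ≤ g l * 1 := by
      gcongr
      · refine norm_cfc_le hgl0 fun x hx => ?_
        have hm : min x l ∈ Set.Ici (0 : ℝ) := le_min (hs hx) hl
        rw [Real.norm_eq_abs, abs_of_nonneg (hg0.trans (hg' Set.self_mem_Ici hm hm))]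
        exact hg' hm hl (min_le_right _ _)
      · exact (isStarProjection_specProj T l).norm_le
    _ = g l := mul_one _

/-- With the next lemma this is the layer-cake sandwich: a slice of height e lies between e times
the spectral projections for (l + e, ∞) and for (l, ∞). -/
theorem clip_le_smul_one_sub_specProj {T : H →L[ℂ] H} (hT : IsSelfAdjoint T) {l e : ℝ} (he : 0 ≤ e) :
    cfc (fun x : ℝ => min (max (x - l) 0) e) T ≤ e • (1 - specProj T l) := by
  refine le_smul_one_sub_of_mul_eq_zero (cfc_predicate _ _) (isStarProjection_specProj T l) ?_ ?_
  · rw [← Algebra.algebraMap_eq_smul_one]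
    exact cfc_le_algebraMap _ _ T fun x _ => min_le_right _ _
  · refine cfc_mul_kerProj_eq_zero (C := 1) (by fun_prop) (by fun_prop) fun x _ => ?_
    rw [one_mul]
    exact mul_self_le_mul_self (le_min (le_max_right _ _) he) (min_le_left _ _)

theorem smul_one_sub_specProj_le_clip {T : H →L[ℂ] H} (hT : IsSelfAdjoint T) {l e : ℝ} (he : 0 ≤ e) :
    e • (1 - specProj T (l + e)) ≤ cfc (fun x : ℝ => min (max (x - l) 0) e) T := by
  set S := e • (1 : H →L[ℂ] H) - cfc (fun x : ℝ => min (max (x - l) 0) e) T with hS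
  have hSe : S = cfc (fun x : ℝ => e - min (max (x - l) 0) e) T := by
    rw [hS, cfc_sub (fun _ => e) _ T (by fun_prop) (by fun_prop), cfc_const e T,
      Algebra.algebraMap_eq_smul_one]
  have h0 : S * (1 - specProj T (l + e)) = 0 := by
    refine mul_one_sub_kerProj (cfc_predicate _ _) ?_
    rw [hSe, ← cfc_mul _ _ T (by fun_prop) (by fun_prop)]
    rw [cfc_congr (g := fun _ => (0 : ℝ)), cfc_const_zero]
    intro x _
    change (e - min (max (x - l) 0) e) * max (x - (l + e)) 0 = 0
    rcases le_total x (l + e) with hx | hx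
    · rw [max_eq_right (by linarith : x - (l + e) ≤ 0), mul_zero]
    · rw [max_eq_left (by linarith : 0 ≤ x - l), min_eq_right (by linarith), sub_self, zero_mul]
  have h1 : S ≤ e • (1 : H →L[ℂ] H) :=
    sub_le_self _ (cfc_nonneg fun x _ => le_min (le_max_right _ _) he)
  have h2 := le_smul_one_sub_of_mul_eq_zero (by rw [hSe]; exact cfc_predicate _ _)
    (isStarProjection_specProj T (l + e)).one_sub h1 h0
  rw [hS, sub_sub_cancel, sub_le_comm] at h2
  rwa [smul_sub]

/-- If `‖T E‖ < l`, then the spectral projection of `T` for `(l, ∞)` has trace at most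
`τ (1 - E)`. -/
theorem IsFaithfulNormalSemifiniteTrace.specProj_le {N : VonNeumannAlgebra H}
    {τ : (H →L[ℂ] H) → ℝ≥0∞} (h : IsFaithfulNormalSemifiniteTrace N τ) {T E : H →L[ℂ] H}
    (hT : 0 ≤ T) (hTN : T ∈ N) (hE : E ∈ N) (hEp : IsStarProjection E) {l : ℝ} (hl : ‖T * E‖ < l) :
    τ (1 - specProj T l) ≤ τ (1 - E) := by
  have hsa : IsSelfAdjoint T := .of_nonneg hT
  have hs := spectrum_subset_of_nonneg hT
  set F := 1 - E with hFdef
  have hF : IsStarProjection F := hEp.one_sub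
  have hFN : F ∈ N := sub_mem (one_mem N) hE
  set r := ‖T * E‖ with hr
  have hr0 : 0 ≤ r := norm_nonneg _
  have hl0 : 0 < l := hr0.trans_lt hl
  -- The strict inequality ‖T E‖ < l leaves room for a weight s in |a + b|² ≤ (1 + s²)|a|² + (1 +
  -- s⁻²)|b|² with a = T E and b = T F, so that the first term stays below l².
  obtain ⟨s, hs0, hsr⟩ : ∃ s : ℝ, 0 < s ∧ (1 + s ^ 2) * r ^ 2 ≤ l ^ 2 := by
    have hd : 0 < (l ^ 2 - r ^ 2) / (r ^ 2 + 1) := by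
      have : r ^ 2 < l ^ 2 := by gcongr
      have := sub_pos.2 this
      positivity
    refine ⟨√((l ^ 2 - r ^ 2) / (r ^ 2 + 1)), Real.sqrt_pos.2 hd, ?_⟩
    rw [Real.sq_sqrt hd.le, add_mul, one_mul, div_mul_eq_mul_div, ← le_sub_iff_add_le', div_le_iff₀
      (by positivity)]
    have : r ^ 2 ≤ l ^ 2 := by gcongr
    nlinarith [sub_nonneg.2 this]
  set c := (1 + s⁻¹ ^ 2) * ‖T‖ ^ 2 with hc
  have hc0 : 0 ≤ c := by positivity
  have hsq : T * T ≤ (l ^ 2) • (1 : H →L[ℂ] H) + c • F := by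
    have hT' : T = T * E + T * F := by rw [hFdef, mul_sub, mul_one]; abel
    set a := T * E with ha
    set b := T * F with hb
    have h1 : 0 ≤ star (s • a - s⁻¹ • b) * (s • a - s⁻¹ • b) := star_mul_self_nonneg _
    have h2 : star (s • a - s⁻¹ • b) * (s • a - s⁻¹ • b)
        = (s ^ 2) • (star a * a) + (s⁻¹ ^ 2) • (star b * b) - (star a * b + star b * a) := by
      simp only [star_sub, star_smul, star_trivial, sub_mul, mul_sub, smul_mul_smul_comm]
      rw [mul_inv_cancel₀ hs0.ne', inv_mul_cancel₀ hs0.ne', one_smul, one_smul, sq, sq]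
      abel
    rw [h2, sub_nonneg] at h1
    have h3 : T * T = star a * a + star b * b + (star a * b + star b * a) := by
      have : star T * T = star (a + b) * (a + b) := by rw [← hT']
      rw [hsa.star_eq] at this
      rw [this, star_add]
      noncomm_ring
    have h4 : star a * a ≤ (r ^ 2) • (1 : H →L[ℂ] H) := star_mul_self_le_smul_one a
    have h5 : star b * b ≤ (‖T‖ ^ 2) • F := by
      rw [hb, star_mul, hF.isSelfAdjoint.star_eq, mul_assoc, ← mul_assoc (star T), ← mul_assoc]
      exact isStarProjection_mul_self_mul_le hF (star_mul_self_le_smul_one T)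
    calc T * T ≤ star a * a + star b * b + ((s ^ 2) • (star a * a) + (s⁻¹ ^ 2) • (star b * b)) := by
          rw [h3]; gcongr
      _ = (1 + s ^ 2) • (star a * a) + (1 + s⁻¹ ^ 2) • (star b * b) := by
          rw [add_smul, add_smul, one_smul, one_smul]; abel
      _ ≤ (1 + s ^ 2) • ((r ^ 2) • (1 : H →L[ℂ] H)) + (1 + s⁻¹ ^ 2) • ((‖T‖ ^ 2) • F) := by
          gcongr
      _ ≤ _ := by
          rw [smul_smul, smul_smul]
          gcongr
  set z : ℝ → ℝ := fun x => max (x - l) 0 with hz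
  set Z := cfc z T with hZ
  have hZs : IsSelfAdjoint Z := cfc_predicate _ _
  have hZN : Z ∈ N := cfc_mem_vonNeumann hTN _
  -- From T² - l² ≤ c F follows W = Z (T² - l²) Z ≤ X* X with X = √c F Z, so the support of W has
  -- trace at most τ(F). On the other hand W ≥ Z⁴, so ker W ⊆ ker Z and the support of W dominates
  -- the spectral projection.
  set W := cfc (fun x : ℝ => z x * (x * x - l ^ 2) * z x) T with hW
  have hWN : W ∈ N := cfc_mem_vonNeumann hTN _
  have hWe : W = Z * (T * T - (l ^ 2) • (1 : H →L[ℂ] H)) * Z := by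
    rw [hW, cfc_mul (fun x => z x * (x * x - l ^ 2)) z T (by fun_prop) (by fun_prop),
      cfc_mul z (fun x => x * x - l ^ 2) T (by fun_prop) (by fun_prop),
      cfc_sub (fun x => x * x) (fun _ => l ^ 2) T (by fun_prop) (by fun_prop),
      cfc_mul (fun x => x) (fun x => x) T (by fun_prop) (by fun_prop), cfc_id' ℝ T,
      cfc_const (l ^ 2) T, Algebra.algebraMap_eq_smul_one]
  have hzz : ∀ x ∈ spectrum ℝ T, z x * z x * (z x * z x) ≤ z x * (x * x - l ^ 2) * z x := by
    intro x hx
    have hx0 : 0 ≤ x := hs hx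
    rcases le_total x l with hxl | hxl
    · simp [hz, max_eq_right (sub_nonpos.2 hxl)]
    · have : z x = x - l := max_eq_left (sub_nonneg.2 hxl)
      rw [this]
      have h1 : 0 ≤ x - l := sub_nonneg.2 hxl
      have h2 : x * x - l ^ 2 - (x - l) * (x - l) = 2 * l * (x - l) := by ring
      have h3 : (x - l) * (x * x - l ^ 2) * (x - l) - (x - l) * (x - l) * ((x - l) * (x - l))
          = (x - l) * (x - l) * (2 * l * (x - l)) := by ring
      have h4 : 0 ≤ (x - l) * (x - l) * (2 * l * (x - l)) := by positivity
      linarith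
  have hW0 : 0 ≤ W := cfc_nonneg fun x hx =>
    (by positivity : 0 ≤ (z x * z x) * (z x * z x)).trans (hzz x hx)
  have hZZ : Z * Z * (Z * Z) ≤ W := by
    rw [hZ, hW, ← cfc_mul z z T (by fun_prop) (by fun_prop), ← cfc_mul (fun x => z x * z x)
      (fun x => z x * z x) T (by fun_prop) (by fun_prop)]
    exact cfc_mono hzz (by fun_prop) (by fun_prop)
  have hkW := isStarProjection_kerProj W
  have hkW0 : Z * kerProj W = 0 := by
    have h1 : (Z * Z) * kerProj W = 0 := by
      refine mul_eq_zero_of_conj (le_antisymm ?_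
        (star_left_conjugate_nonneg (star_mul_self_nonneg _) _))
      have h2 := star_left_conjugate_le_conjugate hZZ (kerProj W)
      rw [mul_assoc _ W, mul_kerProj, mul_zero] at h2
      rwa [star_mul, hZs.star_eq]
    refine mul_eq_zero_of_conj ?_
    rw [hZs.star_eq, mul_assoc, h1, mul_zero]
  have hle : 1 - specProj T l ≤ 1 - kerProj W := by
    refine sub_le_sub_left ?_ _
    have h1 : kerProj Z * kerProj W = kerProj W := kerProj_mul_of_mul_eq_zero hkW0
    have h2 : kerProj W * kerProj Z = kerProj W := by
      have := congrArg star h1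
      rwa [star_mul, hkW.isSelfAdjoint.star_eq,
        (isStarProjection_kerProj Z).isSelfAdjoint.star_eq] at this
    have h3 := isStarProjection_mul_self_mul_le (c := 1) (isStarProjection_kerProj Z)
      (A := kerProj W) (by rw [one_smul]; exact hkW.le_one)
    rwa [h1, h2, one_smul] at h3
  refine (h.mono (sub_mem (one_mem N) (specProj_mem_vonNeumann hTN l))
    (sub_mem (one_mem N) (kerProj_mem_vonNeumann hWN))
    (isStarProjection_specProj T l).one_sub.nonneg hle).trans ?_
  have hFZN : (√c) • (F * Z) ∈ N := real_smul_mem_vonNeumann _ (mul_mem hFN hZN)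
  refine h.support_le hW0 hWN hFZN hFN hF ?_ ?_
  · rw [mul_smul_comm, ← mul_assoc, hF.isIdempotentElem.eq]
  · have h1 : T * T - (l ^ 2) • (1 : H →L[ℂ] H) ≤ c • F := by
      rw [sub_le_iff_le_add']; exact hsq
    have h2 := hZs.conjugate_le_conjugate h1
    rw [hWe]
    refine h2.trans_eq ?_
    rw [star_smul, star_mul, hZs.star_eq, hF.isSelfAdjoint.star_eq, star_trivial,
      smul_mul_smul_comm, Real.mul_self_sqrt hc0, mul_smul_comm, smul_mul_assoc, mul_assoc Z F (F * Z),
      ← mul_assoc F F, hF.isIdempotentElem.eq, mul_assoc]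

end SpectralProjection

/-! ### Singular values and the distribution function -/

section SingularValues

variable {H : Type*} [NormedAddCommGroup H] [InnerProductSpace ℂ H] [CompleteSpace H]

/-- The integral `∫_0^t μ_s(T) ds`. -/
def kyFan (N : VonNeumannAlgebra H) (τ : (H →L[ℂ] H) → ℝ≥0∞) (t : ℝ) (T : H →L[ℂ] H) : ℝ :=
  ∫ s in (0 : ℝ)..t, singularValue N τ s T

variable {N : VonNeumannAlgebra H} {τ : (H →L[ℂ] H) → ℝ≥0∞}

theorem le_norm_of_mem_spectrum {T : H →L[ℂ] H} (hT : IsSelfAdjoint T) {x : ℝ}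
    (hx : x ∈ spectrum ℝ T) : x ≤ ‖T‖ :=
  (le_algebraMap_iff_spectrum_le (a := T)).1 hT.le_algebraMap_norm_self x hx

theorem singularValue_nonneg (t : ℝ) (T : H →L[ℂ] H) : 0 ≤ singularValue N τ t T :=
  Real.sInf_nonneg (by rintro _ ⟨E, -, -, -, rfl⟩; exact norm_nonneg _)

theorem singularValue_le {t : ℝ} {T E : H →L[ℂ] H} (hE : E ∈ N) (hEp : IsStarProjection E)
    (hEt : τ (1 - E) ≤ ENNReal.ofReal t) : singularValue N τ t T ≤ ‖T * E‖ :=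
  csInf_le ⟨0, by rintro _ ⟨E, -, -, -, rfl⟩; exact norm_nonneg _⟩ ⟨E, hE, hEp, hEt, rfl⟩

theorem le_of_specProj_le {T : H →L[ℂ] H} (hT : 0 ≤ T) {l : ℝ} (hl : 0 ≤ l) :
    ‖T * specProj T l‖ ≤ l := by
  have hsa : IsSelfAdjoint T := .of_nonneg hT
  have := norm_mul_specProj_le hT hl (g := fun x => x) continuousOn_id
    (fun _ _ _ _ h => h) le_rfl ⟨1, fun x _ => ?_⟩
  · rwa [cfc_id' ℝ T] at this
  · rw [one_mul, sub_le_iff_le_add]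
    rcases le_total x l with h | h
    · simp [min_eq_left h]
    · simp [min_eq_right h, max_eq_left (sub_nonneg.2 h)]

theorem IsFaithfulNormalSemifiniteTrace.singularValue_set_nonempty
    (h : IsFaithfulNormalSemifiniteTrace N τ) (t : ℝ) (T : H →L[ℂ] H) :
    {r : ℝ | ∃ E ∈ N, IsStarProjection E ∧ τ (1 - E) ≤ ENNReal.ofReal t ∧
      r = ‖T * E‖}.Nonempty :=
  ⟨_, 1, one_mem N, .one _, by rw [sub_self, h.map_zero]; exact zero_le, rfl⟩

theorem IsFaithfulNormalSemifiniteTrace.exists_singularValue_lt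
    (h : IsFaithfulNormalSemifiniteTrace N τ) {t : ℝ} {T : H →L[ℂ] H} {r : ℝ}
    (hr : singularValue N τ t T < r) :
    ∃ E ∈ N, IsStarProjection E ∧ τ (1 - E) ≤ ENNReal.ofReal t ∧ ‖T * E‖ < r := by
  obtain ⟨_, ⟨E, h1, h2, h3, rfl⟩, h4⟩ :=
    exists_lt_of_csInf_lt (h.singularValue_set_nonempty t T) hr
  exact ⟨E, h1, h2, h3, h4⟩

theorem IsFaithfulNormalSemifiniteTrace.singularValue_antitone
    (h : IsFaithfulNormalSemifiniteTrace N τ) (T : H →L[ℂ] H) :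
    Antitone fun t => singularValue N τ t T := by
  intro s t hst
  refine le_csInf (h.singularValue_set_nonempty s T) ?_
  rintro _ ⟨E, hE, hEp, hEt, rfl⟩
  exact singularValue_le hE hEp (hEt.trans (ENNReal.ofReal_le_ofReal hst))

theorem IsFaithfulNormalSemifiniteTrace.singularValue_intervalIntegrable
    (h : IsFaithfulNormalSemifiniteTrace N τ) (T : H →L[ℂ] H) (a b : ℝ) :
    IntervalIntegrable (fun s => singularValue N τ s T) volume a b :=
  (h.singularValue_antitone T).intervalIntegrable

theorem IsFaithfulNormalSemifiniteTrace.singularValue_mul_le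
    (h : IsFaithfulNormalSemifiniteTrace N τ) (S T : H →L[ℂ] H) (t : ℝ) :
    singularValue N τ t (S * T) ≤ ‖S‖ * singularValue N τ t T := by
  change _ ≤ ‖S‖ • sInf {r : ℝ | ∃ E ∈ N, IsStarProjection E ∧ τ (1 - E) ≤ ENNReal.ofReal t ∧
    r = ‖T * E‖}
  rw [← Real.sInf_smul_of_nonneg (norm_nonneg S)]
  refine le_csInf (h.singularValue_set_nonempty t T).smul_set ?_
  rintro _ ⟨_, ⟨E, hE, hEp, hEt, rfl⟩, rfl⟩
  refine (singularValue_le (N := N) (τ := τ) hE hEp hEt).trans ?_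
  rw [mul_assoc]; exact norm_mul_le _ _

theorem IsFaithfulNormalSemifiniteTrace.singularValue_le_norm
    (h : IsFaithfulNormalSemifiniteTrace N τ) (T : H →L[ℂ] H) (t : ℝ) :
    singularValue N τ t T ≤ ‖T‖ := by
  have := singularValue_le (N := N) (τ := τ) (t := t) (T := T) (one_mem N) (.one _)
    (by rw [sub_self, h.map_zero]; exact zero_le)
  rwa [mul_one] at this

theorem IsFaithfulNormalSemifiniteTrace.kyFan_mul_le
    (h : IsFaithfulNormalSemifiniteTrace N τ) (S T : H →L[ℂ] H) {t : ℝ} (ht : 0 ≤ t) :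
    kyFan N τ t (S * T) ≤ ‖S‖ * kyFan N τ t T := by
  rw [kyFan, kyFan, ← intervalIntegral.integral_const_mul]
  exact intervalIntegral.integral_mono_on ht (h.singularValue_intervalIntegrable _ _ _)
    ((h.singularValue_intervalIntegrable _ _ _).const_mul _)
    fun s _ => h.singularValue_mul_le S T s

theorem kyFan_nonneg (T : H →L[ℂ] H) {t : ℝ} (ht : 0 ≤ t) : 0 ≤ kyFan N τ t T :=
  intervalIntegral.integral_nonneg ht fun s _ => singularValue_nonneg s T

theorem IsFaithfulNormalSemifiniteTrace.ofReal_kyFan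
    (h : IsFaithfulNormalSemifiniteTrace N τ) (T : H →L[ℂ] H) {t : ℝ} (ht : 0 ≤ t) :
    ENNReal.ofReal (kyFan N τ t T)
      = ∫⁻ s in Set.Ioc 0 t, ENNReal.ofReal (singularValue N τ s T) := by
  rw [kyFan, intervalIntegral.integral_of_le ht]
  exact ofReal_integral_eq_lintegral_ofReal (h.singularValue_intervalIntegrable T 0 t).1
    (.of_forall fun s => singularValue_nonneg s T)

section Distribution

variable {T : H →L[ℂ] H}

/-- With the next lemma this makes μ_s and the distribution function d(l) = τ(1 - `specProj T l`)
generalized inverses: μ_s < l implies d(l) ≤ s, which implies μ_s ≤ l. -/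
theorem IsFaithfulNormalSemifiniteTrace.singularValue_le_of_distribution {l s : ℝ} (hT : 0 ≤ T)
    (hTN : T ∈ N) (hl : 0 ≤ l) (hs : τ (1 - specProj T l) ≤ ENNReal.ofReal s) :
    singularValue N τ s T ≤ l :=
  (singularValue_le (specProj_mem_vonNeumann hTN l) (isStarProjection_specProj T l) hs).trans
    (le_of_specProj_le hT hl)

theorem IsFaithfulNormalSemifiniteTrace.distribution_le
    (h : IsFaithfulNormalSemifiniteTrace N τ) {l s : ℝ} (hT : 0 ≤ T)
    (hTN : T ∈ N) (hs : singularValue N τ s T < l) :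
    τ (1 - specProj T l) ≤ ENNReal.ofReal s := by
  obtain ⟨E, hE, hEp, hEs, hlt⟩ := h.exists_singularValue_lt hs
  exact (h.specProj_le hT hTN hE hEp hlt).trans hEs

theorem IsFaithfulNormalSemifiniteTrace.distribution_antitone
    (h : IsFaithfulNormalSemifiniteTrace N τ) {l l' : ℝ} (hT : 0 ≤ T)
    (hTN : T ∈ N) (hl : 0 ≤ l) (hll : l ≤ l') : τ (1 - specProj T l') ≤ τ (1 - specProj T l) := by
  rcases hll.eq_or_lt with rfl | hlt
  · exact le_rfl
  · exact h.specProj_le hT hTN (specProj_mem_vonNeumann hTN l) (isStarProjection_specProj T l)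
      ((le_of_specProj_le hT hl).trans_lt hlt)

theorem IsFaithfulNormalSemifiniteTrace.distribution_eq_zero
    (h : IsFaithfulNormalSemifiniteTrace N τ) {l : ℝ} (hT : 0 ≤ T) (hl : ‖T‖ ≤ l) :
    τ (1 - specProj T l) = 0 := by
  have hsa : IsSelfAdjoint T := .of_nonneg hT
  have h0 : cfc (fun x : ℝ => max (x - l) 0) T = 0 := by
    rw [cfc_congr (g := fun _ => (0 : ℝ)), cfc_const_zero]
    intro x hx
    exact max_eq_right (by linarith [le_norm_of_mem_spectrum hsa hx])
  have : specProj T l = 1 := by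
    rw [specProj, h0]
    simpa using kerProj_mul_of_mul_eq_zero (W := (0 : H →L[ℂ] H)) (A := 1) (zero_mul _)
  rw [this, sub_self, h.map_zero]

/-- The clipped operator between the levels `l` and `l + e`. -/
def clip (T : H →L[ℂ] H) (l e : ℝ) : H →L[ℂ] H := cfc (fun x : ℝ => min (max (x - l) 0) e) T

theorem clip_nonneg (T : H →L[ℂ] H) (l : ℝ) {e : ℝ} (he : 0 ≤ e) : 0 ≤ clip T l e :=
  cfc_nonneg fun _ _ => le_min (le_max_right _ _) he

/-- Consecutive slices of height e stack up to one slice of height n e, which turns sums over levels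
into a single trace. -/
theorem sum_clip (T : H →L[ℂ] H) (b e : ℝ) (he : 0 ≤ e) (n : ℕ) :
    ∑ k ∈ Finset.range n, clip T (b + k * e) e = clip T b (n * e) := by
  induction n with
  | zero =>
    rw [Finset.sum_range_zero, clip, cfc_congr (g := fun _ => (0 : ℝ)), cfc_const_zero]
    intro x _
    simp
  | succ n ih =>
    rw [Finset.sum_range_succ, ih, clip, clip, clip, ← cfc_add (a := T) (fun x => min (max (x - b) 0) (n * e))
      (fun x => min (max (x - (b + n * e)) 0) e) (by fun_prop) (by fun_prop)]
    refine cfc_congr fun x _ => ?_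
    push_cast
    have hn : 0 ≤ n * e := by positivity
    rcases le_total x b with h1 | h1
    · rw [max_eq_right (by linarith), max_eq_right (by linarith), min_eq_left hn, min_eq_left he,
        min_eq_left (by positivity), add_zero]
    · rw [max_eq_left (by linarith)]
      rcases le_total (x - b) (n * e) with h2 | h2
      · rw [min_eq_left h2, max_eq_right (by linarith), min_eq_left he, min_eq_left (by linarith),
          add_zero]
      · rw [min_eq_right h2, max_eq_left (by linarith)]
        rcases le_total (x - b) ((n + 1) * e) with h3 | h3
        · rw [min_eq_left h3, min_eq_left (by linarith)]; ring
        · rw [min_eq_right h3, min_eq_right (by linarith)]; ring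

theorem clip_eq (hT : IsSelfAdjoint T) {b e : ℝ} (he0 : 0 ≤ e) (he : ‖T‖ ≤ b + e) :
    clip T b e = cfc (fun x : ℝ => max (x - b) 0) T := by
  refine cfc_congr fun x hx => min_eq_left ?_
  exact max_le (by linarith [le_norm_of_mem_spectrum hT hx]) he0

end Distribution

end SingularValues

/-! ### Layer-cake formula for the integral of the singular values -/

section KyFanFormula

variable {H : Type*} [NormedAddCommGroup H] [InnerProductSpace ℂ H] [CompleteSpace H]
variable {N : VonNeumannAlgebra H} {τ : (H →L[ℂ] H) → ℝ≥0∞} {T : H →L[ℂ] H}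

theorem measurableSet_ofReal_lt (d : ℝ≥0∞) : MeasurableSet {s : ℝ | ENNReal.ofReal s < d} :=
  measurableSet_lt ENNReal.measurable_ofReal measurable_const

theorem volume_ofReal_lt_le (t : ℝ) (d : ℝ≥0∞) :
    volume.restrict (Set.Ioc 0 t) {s : ℝ | ENNReal.ofReal s < d} ≤ d := by
  rcases eq_or_ne d ∞ with rfl | hd
  · exact le_top
  rw [Measure.restrict_apply (measurableSet_ofReal_lt d)]
  calc _ ≤ volume (Set.Ioo 0 d.toReal) := by
        refine measure_mono fun s hs => ⟨hs.2.1, ?_⟩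
        exact (ENNReal.ofReal_lt_iff_lt_toReal hs.2.1.le hd).1 hs.1
    _ = d := by rw [Real.volume_Ioo, sub_zero, ENNReal.ofReal_toReal hd]

theorem le_volume_ofReal_lt {t : ℝ} {d : ℝ≥0∞} (hd : d ≤ ENNReal.ofReal t) :
    d ≤ volume.restrict (Set.Ioc 0 t) {s : ℝ | ENNReal.ofReal s < d} := by
  have hd' : d ≠ ∞ := ne_top_of_le_ne_top ENNReal.ofReal_ne_top hd
  rw [Measure.restrict_apply (measurableSet_ofReal_lt d)]
  calc d = volume (Set.Ioo 0 d.toReal) := by rw [Real.volume_Ioo, sub_zero, ENNReal.ofReal_toReal hd']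
    _ ≤ _ := by
        refine measure_mono fun s hs => ⟨?_, hs.1, ?_⟩
        · exact (ENNReal.ofReal_lt_iff_lt_toReal hs.1.le hd').2 hs.2
        · have h1 := ENNReal.toReal_mono ENNReal.ofReal_ne_top hd
          rcases le_total 0 t with ht | ht
          · rw [ENNReal.toReal_ofReal ht] at h1; exact hs.2.le.trans h1
          · rw [ENNReal.ofReal_of_nonpos ht, ENNReal.toReal_zero] at h1
            exact absurd (hs.1.trans (hs.2.trans_le h1)) (lt_irrefl _)

/-- The step function counts levels with d_k > s. It bounds μ_s from above in `kyFan_le` and, up to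
e, from below in `exists_le_kyFan`. -/
theorem lintegral_step (t c e : ℝ) (d : ℕ → ℝ≥0∞) (n : ℕ) :
    ∫⁻ s in Set.Ioc 0 t, (ENNReal.ofReal c + ENNReal.ofReal e *
        ∑ k ∈ Finset.range n, {s : ℝ | ENNReal.ofReal s < d k}.indicator 1 s)
      = ENNReal.ofReal c * ENNReal.ofReal t + ENNReal.ofReal e * ∑ k ∈ Finset.range n,
        volume.restrict (Set.Ioc 0 t) {s : ℝ | ENNReal.ofReal s < d k} := by
  have hm : ∀ k, Measurable fun s : ℝ =>
      ({s : ℝ | ENNReal.ofReal s < d k}.indicator 1 s : ℝ≥0∞) := fun k =>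
    measurable_one.indicator (measurableSet_ofReal_lt (d k))
  rw [lintegral_add_left measurable_const, lintegral_const, Measure.restrict_apply_univ,
    Real.volume_Ioc, sub_zero, lintegral_const_mul _ (Finset.measurable_fun_sum _ fun k _ => hm k),
    lintegral_finsetSum _ fun k _ => hm k]
  simp only [lintegral_indicator_one (measurableSet_ofReal_lt _)]

theorem IsFaithfulNormalSemifiniteTrace.clip_le (h : IsFaithfulNormalSemifiniteTrace N τ)
    (hT : 0 ≤ T) (hTN : T ∈ N) (l : ℝ) {e : ℝ} (he : 0 ≤ e) :
    τ (clip T l e) ≤ ENNReal.ofReal e * τ (1 - specProj T l) := by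
  have hN : 1 - specProj T l ∈ N := sub_mem (one_mem N) (specProj_mem_vonNeumann hTN l)
  rw [← h.real_smul he hN (isStarProjection_specProj T l).one_sub.nonneg]
  exact h.mono (cfc_mem_vonNeumann hTN _) (real_smul_mem_vonNeumann _ hN) (clip_nonneg T l he)
    (clip_le_smul_one_sub_specProj (.of_nonneg hT) he)

theorem IsFaithfulNormalSemifiniteTrace.le_clip (h : IsFaithfulNormalSemifiniteTrace N τ)
    (hT : 0 ≤ T) (hTN : T ∈ N) (l : ℝ) {e : ℝ} (he : 0 ≤ e) :
    ENNReal.ofReal e * τ (1 - specProj T (l + e)) ≤ τ (clip T l e) := by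
  have hN : 1 - specProj T (l + e) ∈ N := sub_mem (one_mem N) (specProj_mem_vonNeumann hTN _)
  have h0 := (isStarProjection_specProj T (l + e)).one_sub.nonneg
  rw [← h.real_smul he hN h0]
  exact h.mono (real_smul_mem_vonNeumann _ hN) (cfc_mem_vonNeumann hTN _) (smul_nonneg he h0)
    (smul_one_sub_specProj_le_clip (.of_nonneg hT) he)

theorem IsFaithfulNormalSemifiniteTrace.sum_trace_clip (h : IsFaithfulNormalSemifiniteTrace N τ)
    (hTN : T ∈ N) (b : ℝ) {e : ℝ} (he : 0 ≤ e) (n : ℕ) :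
    ∑ k ∈ Finset.range n, τ (clip T (b + k * e) e) = τ (clip T b (n * e)) := by
  rw [← sum_clip T b e he n, h.map_sum _ (fun k : ℕ => clip T (b + k * e) e) (fun _ _ => cfc_mem_vonNeumann hTN _)
    fun _ _ => clip_nonneg _ _ he]

theorem clip_le_posPart (b e : ℝ) :
    clip T b e ≤ cfc (fun x : ℝ => max (x - b) 0) T :=
  cfc_mono (fun _ _ => min_le_left _ _) (by fun_prop) (by fun_prop)

/-- Cut the part of T above b into slices of height e: μ_s is at most b plus e times the number of
levels with d_k > s. Integrating over (0, t] yields the slice traces, with an error t e. -/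
theorem IsFaithfulNormalSemifiniteTrace.kyFan_le (h : IsFaithfulNormalSemifiniteTrace N τ)
    (hT : 0 ≤ T) (hTN : T ∈ N) {t b : ℝ} (ht : 0 ≤ t) (hb : 0 ≤ b) :
    ENNReal.ofReal (kyFan N τ t T)
      ≤ τ (cfc (fun x : ℝ => max (x - b) 0) T) + ENNReal.ofReal (t * b) := by
  have key : ∀ e : ℝ, 0 < e → ENNReal.ofReal (kyFan N τ t T)
      ≤ τ (cfc (fun x : ℝ => max (x - b) 0) T) + ENNReal.ofReal (t * b)
        + ENNReal.ofReal (t * e) := by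
    intro e he
    obtain ⟨n, hn⟩ := exists_nat_gt (‖T‖ / e)
    have hn' : ‖T‖ ≤ b + (n + 1 : ℕ) * e := by
      rw [div_lt_iff₀ he] at hn
      push_cast; linarith
    set d : ℕ → ℝ≥0∞ := fun k => τ (1 - specProj T (b + k * e)) with hd
    have hpt : ∀ s, ENNReal.ofReal (singularValue N τ s T) ≤ ENNReal.ofReal b + ENNReal.ofReal e *
        ∑ k ∈ Finset.range (n + 1), {s : ℝ | ENNReal.ofReal s < d k}.indicator 1 s := by
      intro s
      have hex : ∃ k, d k ≤ ENNReal.ofReal s :=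
        ⟨n + 1, by rw [hd]; dsimp only; rw [h.distribution_eq_zero hT hn']; exact zero_le⟩
      classical
      -- The first level whose distribution value is at most s; all earlier levels contribute an
      -- indicator equal to 1, and μ_s ≤ b + m e.
      set m := Nat.find hex with hm
      have hm1 : d m ≤ ENNReal.ofReal s := Nat.find_spec hex
      have hmn : m ≤ n + 1 := Nat.find_min' hex
        (by rw [hd]; dsimp only; rw [h.distribution_eq_zero hT hn']; exact zero_le)
      have hsum : (m : ℝ≥0∞) ≤ ∑ k ∈ Finset.range (n + 1),
          {s : ℝ | ENNReal.ofReal s < d k}.indicator 1 s := by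
        calc (m : ℝ≥0∞) = ∑ k ∈ Finset.range m, 1 := by simp
          _ ≤ ∑ k ∈ Finset.range m, {s : ℝ | ENNReal.ofReal s < d k}.indicator 1 s := by
            refine Finset.sum_le_sum fun k hk => ?_
            have : ENNReal.ofReal s < d k := not_le.1 (Nat.find_min hex (Finset.mem_range.1 hk))
            rw [Set.indicator_of_mem (by exact this)]; rfl
          _ ≤ _ := Finset.sum_le_sum_of_subset (Finset.range_mono hmn)
      have hsv := singularValue_le_of_distribution hT hTN
        (by positivity : 0 ≤ b + m * e) hm1
      calc ENNReal.ofReal (singularValue N τ s T) ≤ ENNReal.ofReal (b + m * e) :=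
            ENNReal.ofReal_le_ofReal hsv
        _ = ENNReal.ofReal b + ENNReal.ofReal e * m := by
          rw [ENNReal.ofReal_add hb (by positivity), mul_comm (m : ℝ), ENNReal.ofReal_mul he.le,
            ENNReal.ofReal_natCast]
        _ ≤ _ := by gcongr
    -- `le_clip` controls a slice by the distribution at its top, so level k + 1 is charged to slice
    -- k. The unmatched level 0 is bounded by t and produces the error t e.
    rw [h.ofReal_kyFan T ht]
    refine (lintegral_mono hpt).trans ?_
    rw [lintegral_step, Finset.sum_range_succ', mul_add]
    have h0 : volume.restrict (Set.Ioc 0 t) {s : ℝ | ENNReal.ofReal s < d 0} ≤ ENNReal.ofReal t := by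
      refine (measure_mono (Set.subset_univ _)).trans ?_
      rw [Measure.restrict_apply_univ, Real.volume_Ioc, sub_zero]
    have h1 : ENNReal.ofReal e * ∑ k ∈ Finset.range n,
        volume.restrict (Set.Ioc 0 t) {s : ℝ | ENNReal.ofReal s < d (k + 1)}
        ≤ τ (cfc (fun x : ℝ => max (x - b) 0) T) := by
      calc _ ≤ ∑ k ∈ Finset.range n, τ (clip T (b + k * e) e) := by
            rw [Finset.mul_sum]
            refine Finset.sum_le_sum fun k _ => ?_
            refine le_trans ?_ (h.le_clip hT hTN _ he.le)
            gcongr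
            refine (volume_ofReal_lt_le _ _).trans_eq ?_
            rw [hd]; dsimp only; push_cast
            rw [add_mul, one_mul, add_assoc]
        _ = τ (clip T b (n * e)) := h.sum_trace_clip hTN b he.le n
        _ ≤ _ := h.mono (cfc_mem_vonNeumann hTN _) (cfc_mem_vonNeumann hTN _)
            (clip_nonneg T b (by positivity)) (clip_le_posPart b _)
    calc _ ≤ ENNReal.ofReal b * ENNReal.ofReal t + (τ (cfc (fun x : ℝ => max (x - b) 0) T)
          + ENNReal.ofReal e * ENNReal.ofReal t) := by gcongr
      _ = _ := by
        rw [← ENNReal.ofReal_mul hb, ← ENNReal.ofReal_mul he.le, mul_comm b, mul_comm e]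
        ring
  refine ge_of_tendsto (f := fun e : ℝ => τ (cfc (fun x : ℝ => max (x - b) 0) T)
    + ENNReal.ofReal (t * b) + ENNReal.ofReal (t * e)) (x := 𝓝[>] 0) ?_
    (eventually_nhdsWithin_of_forall fun e he => key e he)
  have h1 : Tendsto (fun e : ℝ => ENNReal.ofReal (t * e)) (𝓝[>] 0) (𝓝 0) := by
    have : Tendsto (fun e : ℝ => ENNReal.ofReal (t * e)) (𝓝 0) (𝓝 (ENNReal.ofReal (t * 0))) :=
      (ENNReal.continuous_ofReal.comp (continuous_const_mul t)).tendsto 0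
    rw [mul_zero, ENNReal.ofReal_zero] at this
    exact this.mono_left nhdsWithin_le_nhds
  simpa using h1.const_add (τ (cfc (fun x : ℝ => max (x - b) 0) T) + ENNReal.ofReal (t * b))

/-- The infimum over b is nearly attained at the first multiple b of e where the distribution drops
to t or below. -/
theorem IsFaithfulNormalSemifiniteTrace.exists_le_kyFan (h : IsFaithfulNormalSemifiniteTrace N τ)
    (hT : 0 ≤ T) (hTN : T ∈ N) {t e : ℝ} (ht : 0 ≤ t) (he : 0 < e) :
    ∃ b, 0 ≤ b ∧ τ (cfc (fun x : ℝ => max (x - b) 0) T) + ENNReal.ofReal (t * b)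
      ≤ ENNReal.ofReal (kyFan N τ t T + t * e) := by
  obtain ⟨n, hn⟩ := exists_nat_gt (‖T‖ / e)
  have hn' : ‖T‖ ≤ n * e := by rw [div_lt_iff₀ he] at hn; exact hn.le
  have hex : ∃ k : ℕ, τ (1 - specProj T (k * e)) ≤ ENNReal.ofReal t :=
    ⟨n, by rw [h.distribution_eq_zero hT hn']; exact zero_le⟩
  classical
  set m := Nat.find hex with hm
  have hm1 : τ (1 - specProj T (m * e)) ≤ ENNReal.ofReal t := Nat.find_spec hex
  set b : ℝ := m * e with hb
  have hb0 : 0 ≤ b := by positivity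
  refine ⟨b, hb0, ?_⟩
  set d : ℕ → ℝ≥0∞ := fun k => τ (1 - specProj T (b + k * e)) with hd
  -- Above b every distribution value is at most t, so each set {s < d_k} fits inside (0, t] and has
  -- full measure d_k there.
  have hdt : ∀ k, d k ≤ ENNReal.ofReal t := fun k =>
    (h.distribution_antitone hT hTN hb0 (le_add_of_nonneg_right (by positivity))).trans hm1
  have hlow : ∀ s ∈ Set.Ioc 0 t, s < t → b ≤ singularValue N τ s T + e := by
    intro s hs hst
    rcases Nat.eq_zero_or_pos m with h0 | h0
    · rw [hb, h0, Nat.cast_zero, zero_mul]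
      exact add_nonneg (singularValue_nonneg _ _) he.le
    -- Otherwise μ_s lies below the preceding level b - e = (m - 1) e, and the distribution there
    -- would already be at most t, contradicting the minimality of m.
    · by_contra! hlt
      have h1 : singularValue N τ s T < (m - 1 : ℕ) * e := by
        rw [Nat.cast_sub h0, Nat.cast_one, sub_mul, one_mul]; linarith
      have h2 := (h.distribution_le hT hTN h1).trans (ENNReal.ofReal_le_ofReal hst.le)
      have h3 := Nat.find_min' hex h2
      omega
  have hpt : ∀ s ∈ Set.Ioc 0 t, s < t → ENNReal.ofReal b + ENNReal.ofReal e *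
      ∑ k ∈ Finset.range n, {s : ℝ | ENNReal.ofReal s < d k}.indicator 1 s
      ≤ ENNReal.ofReal (singularValue N τ s T + e) := by
    intro s hs hst
    rcases ((Finset.range n).filter fun k => ENNReal.ofReal s < d k).eq_empty_or_nonempty with h0 | h0
    · rw [Finset.sum_eq_zero, mul_zero, add_zero]
      · exact ENNReal.ofReal_le_ofReal (hlow s hs hst)
      · intro k hk
        refine Set.indicator_of_notMem (fun hk' => ?_) _
        have : k ∈ (Finset.range n).filter fun k => ENNReal.ofReal s < d k :=
          Finset.mem_filter.2 ⟨hk, hk'⟩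
        rw [h0] at this
        exact absurd this (Finset.notMem_empty k)
    · obtain ⟨j, hj, hjmax⟩ := Finset.exists_max_image _ (fun k => k) h0
      have hjs : ENNReal.ofReal s < d j := (Finset.mem_filter.1 hj).2
      have h1 : b + j * e ≤ singularValue N τ s T := by
        by_contra! hlt
        exact absurd hjs (not_lt.2 (h.distribution_le hT hTN hlt))
      have h2 : ∑ k ∈ Finset.range n, {s : ℝ | ENNReal.ofReal s < d k}.indicator 1 s
          ≤ ((j + 1 : ℕ) : ℝ≥0∞) := by
        calc _ = ∑ k ∈ (Finset.range n).filter fun k => ENNReal.ofReal s < d k, (1 : ℝ≥0∞) := by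
              rw [Finset.sum_filter]
              exact Finset.sum_congr rfl fun k _ => by simp [Set.indicator_apply]
          _ ≤ ∑ k ∈ Finset.range (j + 1), (1 : ℝ≥0∞) :=
              Finset.sum_le_sum_of_subset fun k hk =>
                Finset.mem_range.2 (Nat.lt_succ_of_le (hjmax k hk))
          _ = _ := by simp
      calc _ ≤ ENNReal.ofReal b + ENNReal.ofReal e * ((j + 1 : ℕ) : ℝ≥0∞) := by gcongr
        _ = ENNReal.ofReal (b + e * (j + 1 : ℕ)) := by
          rw [ENNReal.ofReal_add hb0 (by positivity), ENNReal.ofReal_mul he.le,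
            ENNReal.ofReal_natCast]
        _ ≤ _ := ENNReal.ofReal_le_ofReal (by push_cast; linarith)
  have hint : ENNReal.ofReal (kyFan N τ t T + t * e)
      = ∫⁻ s in Set.Ioc 0 t, ENNReal.ofReal (singularValue N τ s T + e) := by
    rw [ENNReal.ofReal_add (kyFan_nonneg T ht) (by positivity), h.ofReal_kyFan T ht]
    simp only [ENNReal.ofReal_add (singularValue_nonneg _ T) he.le]
    rw [lintegral_add_right _ measurable_const, lintegral_const, Measure.restrict_apply_univ,
      Real.volume_Ioc, sub_zero, mul_comm t, ENNReal.ofReal_mul he.le]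
  have hne : ∀ᵐ s ∂(volume.restrict (Set.Ioc 0 t)), s ≠ t := ae_iff.2 (by simp)
  have hle : ∫⁻ s in Set.Ioc 0 t, (ENNReal.ofReal b + ENNReal.ofReal e *
      ∑ k ∈ Finset.range n, {s : ℝ | ENNReal.ofReal s < d k}.indicator 1 s)
      ≤ ENNReal.ofReal (kyFan N τ t T + t * e) := by
    rw [hint]
    refine lintegral_mono_ae ?_
    filter_upwards [hne, ae_restrict_mem measurableSet_Ioc] with s h1 h2
    exact hpt s h2 (lt_of_le_of_ne h2.2 h1)
  rw [lintegral_step] at hle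
  refine le_trans ?_ hle
  rw [add_comm, ← ENNReal.ofReal_mul hb0, mul_comm b]
  gcongr
  rw [← clip_eq (.of_nonneg hT) (by positivity : 0 ≤ (n : ℝ) * e) (by linarith),
    ← h.sum_trace_clip hTN b he.le n, Finset.mul_sum]
  refine Finset.sum_le_sum fun k _ => (h.clip_le hT hTN _ he.le).trans ?_
  gcongr
  exact le_volume_ofReal_lt (hdt k)

end KyFanFormula

/-! ### The K-functional, its superadditivity, and the formula for singular values -/

section KFunctional

variable {H : Type*} [NormedAddCommGroup H] [InnerProductSpace ℂ H] [CompleteSpace H]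

/-- The pairs `(A, b)` with `A ∈ N` positive, `b ≥ 0` and `Y ≤ A + b`. -/
def majorants (N : VonNeumannAlgebra H) (Y : H →L[ℂ] H) : Set ((H →L[ℂ] H) × ℝ) :=
  {p | p.1 ∈ N ∧ 0 ≤ p.1 ∧ 0 ≤ p.2 ∧ Y ≤ p.1 + p.2 • (1 : H →L[ℂ] H)}

/-- The `K`-functional `inf {τ(A) + t b : Y ≤ A + b}` of the pair (trace, operator norm). -/
def kFun (N : VonNeumannAlgebra H) (τ : (H →L[ℂ] H) → ℝ≥0∞) (t : ℝ) (Y : H →L[ℂ] H) : ℝ≥0∞ :=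
  ⨅ p : majorants N Y, τ p.1.1 + ENNReal.ofReal (t * p.1.2)

variable {N : VonNeumannAlgebra H} {τ : (H →L[ℂ] H) → ℝ≥0∞}

theorem kFun_le {t : ℝ} {Y A : H →L[ℂ] H} {b : ℝ} (hA : A ∈ N) (hA0 : 0 ≤ A) (hb : 0 ≤ b)
    (h : Y ≤ A + b • (1 : H →L[ℂ] H)) : kFun N τ t Y ≤ τ A + ENNReal.ofReal (t * b) :=
  iInf_le_of_le ⟨(A, b), hA, hA0, hb, h⟩ le_rfl

theorem kFun_mono (t : ℝ) {Y Y' : H →L[ℂ] H} (h : Y ≤ Y') : kFun N τ t Y ≤ kFun N τ t Y' :=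
  le_iInf fun ⟨_, h1, h2, h3, h4⟩ => kFun_le h1 h2 h3 (h.trans h4)

theorem kFun_le_of_le_add {t : ℝ} (ht : 0 ≤ t) {Y Y' : H →L[ℂ] H} {c : ℝ} (hc : 0 ≤ c)
    (h : Y ≤ Y' + c • (1 : H →L[ℂ] H)) :
    kFun N τ t Y ≤ kFun N τ t Y' + ENNReal.ofReal (t * c) := by
  rw [kFun, kFun, ENNReal.iInf_add]
  refine le_iInf fun ⟨p, h1, h2, h3, h4⟩ => ?_
  refine (kFun_le (b := p.2 + c) h1 h2 (add_nonneg h3 hc) ?_).trans_eq ?_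
  · rw [add_smul, ← add_assoc]
    exact h.trans (add_le_add_left h4 _)
  · rw [mul_add, ENNReal.ofReal_add (by positivity) (by positivity), add_assoc]

theorem le_of_forall_le_add_ofReal {t : ℝ} {a c : ℝ≥0∞}
    (h : ∀ e : ℝ, 0 < e → a ≤ c + ENNReal.ofReal (t * e)) : a ≤ c := by
  refine ge_of_tendsto (f := fun e : ℝ => c + ENNReal.ofReal (t * e)) (x := 𝓝[>] 0) ?_
    (eventually_nhdsWithin_of_forall fun e he => h e he)
  have h1 : Tendsto (fun e : ℝ => ENNReal.ofReal (t * e)) (𝓝[>] 0) (𝓝 0) := by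
    have : Tendsto (fun e : ℝ => ENNReal.ofReal (t * e)) (𝓝 0) (𝓝 (ENNReal.ofReal (t * 0))) :=
      (ENNReal.continuous_ofReal.comp (continuous_const_mul t)).tendsto 0
    rw [mul_zero, ENNReal.ofReal_zero] at this
    exact this.mono_left nhdsWithin_le_nhds
  simpa using h1.const_add c

/-- Continuity in norm: bounds proved for continuous-calculus approximants pass to the operator
itself, at a cost t e that vanishes. -/
theorem kFun_le_of_forall_le_add {t : ℝ} (ht : 0 ≤ t) {Y : H →L[ℂ] H} {c : ℝ≥0∞}
    (h : ∀ e : ℝ, 0 < e → ∃ Y', Y ≤ Y' + e • (1 : H →L[ℂ] H) ∧ kFun N τ t Y' ≤ c) :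
    kFun N τ t Y ≤ c := by
  refine le_of_forall_le_add_ofReal (t := t) fun e he => ?_
  obtain ⟨Y', h1, h2⟩ := h e he
  exact (kFun_le_of_le_add ht he.le h1).trans (by gcongr)

namespace IsFaithfulNormalSemifiniteTrace

theorem kFun_zero (h : IsFaithfulNormalSemifiniteTrace N τ) (t : ℝ) : kFun N τ t 0 = 0 := by
  refine le_antisymm ?_ zero_le
  have := kFun_le (N := N) (τ := τ) (t := t) (Y := 0) (zero_mem N) le_rfl le_rfl (by simp)
  simpa [h.map_zero] using this

theorem kFun_add_le (h : IsFaithfulNormalSemifiniteTrace N τ) {t : ℝ} (ht : 0 ≤ t)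
    (Y Y' : H →L[ℂ] H) : kFun N τ t (Y + Y') ≤ kFun N τ t Y + kFun N τ t Y' := by
  rw [kFun, kFun, kFun, ENNReal.iInf_add]
  refine le_iInf fun ⟨p, h1, h2, h3, h4⟩ => ?_
  rw [ENNReal.add_iInf]
  refine le_iInf fun ⟨q, k1, k2, k3, k4⟩ => ?_
  refine (kFun_le (A := p.1 + q.1) (b := p.2 + q.2) (add_mem h1 k1) (add_nonneg h2 k2)
    (add_nonneg h3 k3) ?_).trans_eq ?_
  · rw [add_smul, add_add_add_comm]; exact add_le_add h4 k4
  · rw [h.add _ h1 _ k1 h2 k2, mul_add, ENNReal.ofReal_add (by positivity) (by positivity),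
      add_add_add_comm]

theorem kFun_conj_le (h : IsFaithfulNormalSemifiniteTrace N τ) {t : ℝ} {V : H →L[ℂ] H} (hV : V ∈ N)
    (Y : H →L[ℂ] H) :
    kFun N τ t (V * Y * star V) ≤ ENNReal.ofReal (‖V‖ ^ 2) * kFun N τ t Y := by
  rcases eq_or_ne V 0 with rfl | hV0
  · simp [h.kFun_zero]
  have hn : 0 < ‖V‖ := norm_pos_iff.2 hV0
  rw [kFun, kFun, ENNReal.mul_iInf_of_ne (by simpa using hn) ENNReal.ofReal_ne_top]
  refine le_iInf fun ⟨p, h1, h2, h3, h4⟩ => ?_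
  refine (kFun_le (A := V * p.1 * star V) (b := ‖V‖ ^ 2 * p.2) (mul_mem (mul_mem hV h1)
    (star_mem hV)) (star_right_conjugate_nonneg h2 V) (by positivity) ?_).trans ?_
  · have h5 := star_right_conjugate_le_conjugate h4 V
    rw [mul_add, add_mul, mul_smul_comm, smul_mul_assoc, mul_one] at h5
    refine h5.trans ?_
    have h6 := star_mul_self_le_smul_one (star V)
    rw [star_star, norm_star] at h6
    rw [mul_comm, ← smul_smul]
    gcongr
  · rw [mul_add]
    refine add_le_add (h.conj_le hV h1 h2) ?_
    rw [← ENNReal.ofReal_mul (by positivity), mul_left_comm]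

theorem kFun_conj_le_of_norm_le_one (h : IsFaithfulNormalSemifiniteTrace N τ) {t : ℝ}
    {V : H →L[ℂ] H} (hV : V ∈ N) (hV1 : ‖V‖ ≤ 1) (Y : H →L[ℂ] H) :
    kFun N τ t (V * Y * star V) ≤ kFun N τ t Y :=
  (h.kFun_conj_le hV Y).trans (mul_le_of_le_one_left zero_le
    (ENNReal.ofReal_le_one.2 (pow_le_one₀ (norm_nonneg _) hV1)))

/-- Y⁺ is within e of g(Y) Y g(Y) for a cutoff g(Y) of norm at most one, and conjugation by a
contraction does not increase the K-functional. -/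
theorem kFun_posPart_le (h : IsFaithfulNormalSemifiniteTrace N τ) {t : ℝ} (ht : 0 ≤ t)
    {Y : H →L[ℂ] H} (hY : Y ∈ N) (hYs : IsSelfAdjoint Y) : kFun N τ t Y⁺ ≤ kFun N τ t Y := by
  refine kFun_le_of_forall_le_add ht fun e he => ?_
  let g : ℝ → ℝ := fun x => √(min 1 (e⁻¹ * max x 0))
  have hg : Continuous g := by fun_prop
  have hg1 : ∀ x, g x * g x = min 1 (e⁻¹ * max x 0) := fun x =>
    Real.mul_self_sqrt (by positivity)
  have hgs : IsSelfAdjoint (cfc g Y) := cfc_predicate _ _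
  refine ⟨cfc g Y * Y * cfc g Y, ?_, ?_⟩
  · rw [cfc_mul_self_mul_cfc hYs hg.continuousOn, cfc_add_smul_one hYs (by fun_prop),
      posPart_eq_cfc]
    refine cfc_mono (fun x _ => ?_) (by fun_prop) (by fun_prop)
    have e1 : g x * x * g x = min 1 (e⁻¹ * max x 0) * x := by rw [← hg1]; ring
    rw [e1]
    rcases le_total 0 x with hx | hx
    · rw [max_eq_left hx]
      rcases le_total x e with hxe | hxe
      · have : 0 ≤ min 1 (e⁻¹ * x) * x := by positivity
        linarith
      · have : 1 ≤ e⁻¹ * x := by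
          have h1 : e⁻¹ * e ≤ e⁻¹ * x := by gcongr
          rwa [inv_mul_cancel₀ he.ne'] at h1
        rw [min_eq_left this]; linarith
    · simp [max_eq_right hx, he.le]
  · have := h.kFun_conj_le_of_norm_le_one (t := t) (cfc_mem_vonNeumann hY g) ?_ Y
    · rwa [hgs.star_eq] at this
    · refine norm_cfc_le zero_le_one fun x _ => ?_
      rw [Real.norm_eq_abs, abs_of_nonneg (Real.sqrt_nonneg _)]
      exact Real.sqrt_le_one.2 (min_le_left _ _)

/-- `G = (P + e)^(-1/2)`. -/
theorem _root_.SemifiniteNCG.exists_conj_add_smul_one_eq_one {P : H →L[ℂ] H} (hPN : P ∈ N)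
    (hP0 : 0 ≤ P) {e : ℝ} (he : 0 < e) :
    ∃ G ∈ N, IsSelfAdjoint G ∧ G * (P + e • (1 : H →L[ℂ] H)) * G = 1 ∧ G * P * G ≤ 1 := by
  have hPs : IsSelfAdjoint P := .of_nonneg hP0
  have hs := spectrum_subset_of_nonneg hP0
  let g : ℝ → ℝ := fun x => (√(x + e))⁻¹
  have hpos : ∀ x ∈ spectrum ℝ P, 0 < x + e := fun x hx => add_pos_of_nonneg_of_pos (hs hx) he
  have hg : ContinuousOn g (spectrum ℝ P) :=
    ContinuousOn.inv₀ (by fun_prop) fun x hx => (Real.sqrt_pos.2 (hpos x hx)).ne'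
  have hGs : IsSelfAdjoint (cfc g P) := cfc_predicate _ _
  have hG1 : cfc g P * (P + e • (1 : H →L[ℂ] H)) * cfc g P = 1 := by
    have e1 : P + e • (1 : H →L[ℂ] H) = cfc (fun x => x + e) P := by
      rw [cfc_add_const e (fun x => x) P, cfc_id' ℝ P, Algebra.algebraMap_eq_smul_one]
    rw [e1, ← cfc_mul g (fun x => x + e) P hg (by fun_prop),
      ← cfc_mul (fun x => g x * (x + e)) g P (hg.mul (by fun_prop)) hg,
      cfc_congr (g := fun _ => (1 : ℝ)), cfc_const_one ℝ P]
    intro x hx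
    have h1 := hpos x hx
    have h2 : √(x + e) ≠ 0 := (Real.sqrt_pos.2 h1).ne'
    change (√(x + e))⁻¹ * (x + e) * (√(x + e))⁻¹ = 1
    have h3 := Real.mul_self_sqrt h1.le
    field_simp
    rw [sq, h3]
  refine ⟨_, cfc_mem_vonNeumann hPN g, hGs, hG1, ?_⟩
  rw [← hG1]
  exact hGs.conjugate_le_conjugate (le_add_of_nonneg_right (smul_nonneg he.le zero_le_one))

/-- Superadditivity of the `K`-functional, by a Riesz decomposition. -/
theorem kFun_superadd (h : IsFaithfulNormalSemifiniteTrace N τ) {t : ℝ} (ht : 0 ≤ t)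
    {S T : H →L[ℂ] H} (hS : S ∈ N) (hT : T ∈ N) (hS0 : 0 ≤ S) (hT0 : 0 ≤ T) :
    kFun N τ t S + kFun N τ t T ≤ kFun N τ (2 * t) (S + T) := by
  rw [kFun.eq_1 N τ (2 * t)]
  refine le_iInf fun ⟨⟨A, b⟩, hA, hA0, hb, hle⟩ => ?_
  dsimp only at hA hA0 hb hle ⊢
  refine le_of_forall_le_add_ofReal (t := 2 * t) fun e he => ?_
  set P := S + T with hP
  have hP0 : 0 ≤ P := add_nonneg hS0 hT0
  have hPN : P ∈ N := add_mem hS hT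
  obtain ⟨G, hGN, hGs, hG1, hGP⟩ := exists_conj_add_smul_one_eq_one hPN hP0 he
  -- For x = √Q G one has x (P + e) x* = Q and x* x = G Q G. Conjugating P + e ≤ A + b + e by x
  -- majorizes Q by x A x* + (b + e), and traciality rewrites τ(x A x*) as the trace of √A (G Q G)
  -- √A.
  have key : ∀ Q : H →L[ℂ] H, Q ∈ N → 0 ≤ Q → Q ≤ P → kFun N τ t Q ≤
      τ (CFC.sqrt A * (G * Q * G) * CFC.sqrt A) + ENNReal.ofReal (t * (b + e)) := by
    intro Q hQ hQ0 hQP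
    set x := CFC.sqrt Q * G with hx
    have hsq : IsSelfAdjoint (CFC.sqrt Q) := (CFC.sqrt_nonneg Q).isSelfAdjoint
    have hxN : x ∈ N := mul_mem (sqrt_mem_vonNeumann hQ) hGN
    have hsx : star x = G * CFC.sqrt Q := by rw [hx, star_mul, hGs.star_eq, hsq.star_eq]
    have hxx : star x * x = G * Q * G := by
      rw [hsx, hx, mul_assoc, ← mul_assoc (CFC.sqrt Q), CFC.sqrt_mul_sqrt_self Q hQ0, mul_assoc]
    have hx1 : ‖x‖ ^ 2 ≤ 1 := by
      rw [sq, ← CStarRing.norm_star_mul_self]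
      refine (CStarAlgebra.norm_le_one_iff_of_nonneg _ (star_mul_self_nonneg x)).2 ?_
      rw [hxx]
      exact (hGs.conjugate_le_conjugate hQP).trans hGP
    have hxQ : x * (P + e • (1 : H →L[ℂ] H)) * star x = Q := by
      have hG3 : G * (P + e • (1 : H →L[ℂ] H)) * G = 1 := hG1
      rw [hsx, hx, show CFC.sqrt Q * G * (P + e • (1 : H →L[ℂ] H)) * (G * CFC.sqrt Q)
        = CFC.sqrt Q * (G * (P + e • (1 : H →L[ℂ] H)) * G) * CFC.sqrt Q by
          simp only [mul_assoc], hG3, mul_one, CFC.sqrt_mul_sqrt_self Q hQ0]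
    have hxA := h.conj_eq hxN hA hA0
    rw [hxx] at hxA
    rw [← hxA]
    refine kFun_le (mul_mem (mul_mem hxN hA) (star_mem hxN)) (star_right_conjugate_nonneg hA0 x)
      (by positivity) ?_
    have h1 : P + e • (1 : H →L[ℂ] H) ≤ A + (b + e) • (1 : H →L[ℂ] H) := by
      rw [add_smul, ← add_assoc]; gcongr
    have h2 := star_right_conjugate_le_conjugate h1 x
    rw [hxQ, mul_add, add_mul, mul_smul_comm, smul_mul_assoc, mul_one] at h2
    refine h2.trans ?_
    have h3 := star_mul_self_le_smul_one (star x)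
    rw [star_star, norm_star] at h3
    have h4 : x * star x ≤ 1 := by
      have := h3.trans (smul_le_smul_of_nonneg_right hx1 zero_le_one)
      rwa [one_smul] at this
    gcongr
  have hsA : IsSelfAdjoint (CFC.sqrt A) := (CFC.sqrt_nonneg A).isSelfAdjoint
  have hsAN := sqrt_mem_vonNeumann hA
  have hmem : ∀ Q ∈ N, CFC.sqrt A * (G * Q * G) * CFC.sqrt A ∈ N := fun Q hQ =>
    mul_mem (mul_mem hsAN (mul_mem (mul_mem hGN hQ) hGN)) hsAN
  have hnn : ∀ Q : H →L[ℂ] H, 0 ≤ Q → 0 ≤ CFC.sqrt A * (G * Q * G) * CFC.sqrt A := fun Q hQ =>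
    hsA.conjugate_nonneg (hGs.conjugate_nonneg hQ)
  -- Since G S G + G T G = G P G ≤ 1, the two trace parts together cost at most τ(A). The scalar
  -- part is paid twice, which is the source of the factor 2 in 2t.
  have hsum : τ (CFC.sqrt A * (G * S * G) * CFC.sqrt A)
      + τ (CFC.sqrt A * (G * T * G) * CFC.sqrt A) ≤ τ A := by
    rw [← h.add _ (hmem S hS) _ (hmem T hT) (hnn S hS0) (hnn T hT0), ← add_mul, ← mul_add,
      ← add_mul, ← mul_add, ← hP]
    refine h.mono (hmem P hPN) hA (hnn P hP0) ?_
    have := hsA.conjugate_le_conjugate hGP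
    rwa [mul_one, CFC.sqrt_mul_sqrt_self A hA0] at this
  calc kFun N τ t S + kFun N τ t T
      ≤ (τ (CFC.sqrt A * (G * S * G) * CFC.sqrt A) + ENNReal.ofReal (t * (b + e)))
        + (τ (CFC.sqrt A * (G * T * G) * CFC.sqrt A) + ENNReal.ofReal (t * (b + e))) :=
        add_le_add (key S hS hS0 (le_add_of_nonneg_right hT0))
          (key T hT hT0 (le_add_of_nonneg_left hS0))
    _ = (τ (CFC.sqrt A * (G * S * G) * CFC.sqrt A) + τ (CFC.sqrt A * (G * T * G) * CFC.sqrt A))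
        + (ENNReal.ofReal (2 * t * b) + ENNReal.ofReal (2 * t * e)) := by
        have h1 : ENNReal.ofReal (t * (b + e)) + ENNReal.ofReal (t * (b + e))
            = ENNReal.ofReal (2 * t * b) + ENNReal.ofReal (2 * t * e) := by
          rw [← ENNReal.ofReal_add (by positivity) (by positivity),
            ← ENNReal.ofReal_add (by positivity) (by positivity)]
          exact congrArg _ (by ring)
        rw [add_add_add_comm, h1]
    _ ≤ τ A + (ENNReal.ofReal (2 * t * b) + ENNReal.ofReal (2 * t * e)) := by gcongr
    _ = _ := (add_assoc _ _ _).symm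

theorem kFun_le_norm (h : IsFaithfulNormalSemifiniteTrace N τ) {t : ℝ}
    {Y : H →L[ℂ] H} (hYs : IsSelfAdjoint Y) : kFun N τ t Y ≤ ENNReal.ofReal (t * ‖Y‖) := by
  have := kFun_le (τ := τ) (t := t) (zero_mem N) le_rfl (norm_nonneg Y)
    ((le_norm_smul_one hYs).trans_eq (zero_add _).symm)
  rwa [h.map_zero, zero_add] at this

/-- The integral of the singular values is the `K`-functional. -/
theorem ofReal_kyFan_eq_kFun (h : IsFaithfulNormalSemifiniteTrace N τ) {t : ℝ} (ht : 0 ≤ t)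
    {T : H →L[ℂ] H} (hT : T ∈ N) (hT0 : 0 ≤ T) :
    ENNReal.ofReal (kyFan N τ t T) = kFun N τ t T := by
  have hTs : IsSelfAdjoint T := .of_nonneg hT0
  apply le_antisymm
  · refine le_iInf fun ⟨p, h1, h2, h3, h4⟩ => ?_
    refine (h.kyFan_le hT0 hT ht h3).trans ?_
    gcongr
    -- Among the majorants with a given scalar b, (T - b)⁺ has the least trace, by `posPart_le`.
    have h5 : (T - p.2 • (1 : H →L[ℂ] H))⁺ = cfc (fun x : ℝ => max (x - p.2) 0) T := by
      have : T - p.2 • (1 : H →L[ℂ] H) = cfc (fun x => x - p.2) T := by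
        rw [cfc_sub (fun x => x) (fun _ => p.2) T, cfc_id' ℝ T, cfc_const p.2 T,
          Algebra.algebraMap_eq_smul_one]
      rw [this, posPart_eq_cfc, ← cfc_comp' (fun x => max x 0) (fun x => x - p.2) T]
    rw [← h5]
    refine h.posPart_le (sub_mem hT (real_smul_mem_vonNeumann _ (one_mem N)))
      (hTs.sub (IsSelfAdjoint.smul (star_trivial p.2) (.one _))) h1 h2 (sub_le_iff_le_add.2 h4)
  · refine le_of_forall_le_add_ofReal (t := t) fun e he => ?_
    obtain ⟨b, hb, hle⟩ := h.exists_le_kyFan hT0 hT ht he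
    rw [← ENNReal.ofReal_add (kyFan_nonneg T ht) (by positivity)]
    refine le_trans (kFun_le (cfc_mem_vonNeumann hT _)
      (cfc_nonneg fun x _ => le_max_right _ _) hb ?_) hle
    rw [cfc_add_smul_one hTs (by fun_prop)]
    conv_lhs => rw [← cfc_id' ℝ T]
    exact cfc_mono (fun x _ => by linarith [le_max_left (x - b) 0]) (by fun_prop) (by fun_prop)

end IsFaithfulNormalSemifiniteTrace

end KFunctional

/-! ### Generalized limits -/

section OmegaLim

variable {ω : LInfty →ₗ[ℝ] ℝ} {f g : ℝ → ℝ}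

theorem omegaLim_of_memLp (hf : MemLp f ∞ (volume.restrict (Set.Ioi (0 : ℝ)))) :
    omegaLim ω f = ω (hf.toLp f) := dif_pos hf

theorem omegaLim_add (hf : MemLp f ∞ (volume.restrict (Set.Ioi (0 : ℝ))))
    (hg : MemLp g ∞ (volume.restrict (Set.Ioi (0 : ℝ)))) :
    omegaLim ω (fun t => f t + g t) = omegaLim ω f + omegaLim ω g := by
  have e := omegaLim_of_memLp (ω := ω) (hf.add hg)
  rw [omegaLim_of_memLp hf, omegaLim_of_memLp hg, ← map_add]
  exact e

theorem omegaLim_const_mul (c : ℝ) (hf : MemLp f ∞ (volume.restrict (Set.Ioi (0 : ℝ)))) :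
    omegaLim ω (fun t => c * f t) = c * omegaLim ω f := by
  rw [omegaLim_of_memLp hf, omegaLim_of_memLp (hf.const_mul c), ← smul_eq_mul, ← map_smul]
  rfl

namespace IsDixmierFunctional

theorem omegaLim_mono (hω : IsDixmierFunctional ω)
    (hf : MemLp f ∞ (volume.restrict (Set.Ioi (0 : ℝ))))
    (hg : MemLp g ∞ (volume.restrict (Set.Ioi (0 : ℝ)))) (h : ∀ t > 0, f t ≤ g t) :
    omegaLim ω f ≤ omegaLim ω g := by
  rw [omegaLim_of_memLp hf, omegaLim_of_memLp hg, ← sub_nonneg, ← map_sub]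
  refine hω.nonneg _ (sub_nonneg.2 ?_)
  rw [← Lp.coeFn_le]
  filter_upwards [hf.coeFn_toLp, hg.coeFn_toLp, ae_restrict_mem measurableSet_Ioi] with t h1 h2 h3
  rw [h1, h2]
  exact h t h3

theorem omegaLim_of_tendsto (hω : IsDixmierFunctional ω)
    (hf : MemLp f ∞ (volume.restrict (Set.Ioi (0 : ℝ)))) {c : ℝ} (h : Tendsto f atTop (𝓝 c)) :
    omegaLim ω f = c := by
  rw [omegaLim_of_memLp hf]
  exact hω.eq_lim _ f c hf.coeFn_toLp h

theorem ae_comp_mul_left {p : ℝ → Prop} {a : ℝ} (ha : 0 < a)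
    (h : ∀ᵐ t ∂(volume.restrict (Set.Ioi (0 : ℝ))), p t) :
    ∀ᵐ t ∂(volume.restrict (Set.Ioi (0 : ℝ))), p (a * t) := by
  rw [ae_restrict_iff' measurableSet_Ioi] at h ⊢
  have h1 : ∀ᵐ t ∂(Measure.map (a * ·) volume), t ∈ Set.Ioi (0 : ℝ) → p t := by
    rw [Real.map_volume_mul_left ha.ne']
    exact Measure.ae_smul_measure h _
  filter_upwards [ae_of_ae_map (measurable_const_mul a).aemeasurable h1] with t ht ht0
  exact ht (mul_pos ha ht0)

theorem omegaLim_dilation (hω : IsDixmierFunctional ω) {a : ℝ} (ha : 0 < a)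
    (hf : MemLp f ∞ (volume.restrict (Set.Ioi (0 : ℝ))))
    (hg : MemLp (fun t => f (a * t)) ∞ (volume.restrict (Set.Ioi (0 : ℝ)))) :
    omegaLim ω (fun t => f (a * t)) = omegaLim ω f := by
  rw [omegaLim_of_memLp hf, omegaLim_of_memLp hg]
  refine hω.dilation a ha _ _ ?_
  filter_upwards [hg.coeFn_toLp, ae_comp_mul_left ha hf.coeFn_toLp] with t h1 h2
  rw [h1, h2]

end IsDixmierFunctional

end OmegaLim

/-! ### Additivity of the Dixmier trace and its vanishing on trace-class operators -/

section DixmierCone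

variable {H : Type*} [NormedAddCommGroup H] [InnerProductSpace ℂ H] [CompleteSpace H]
variable {N : VonNeumannAlgebra H} {τ : (H →L[ℂ] H) → ℝ≥0∞}

namespace IsFaithfulNormalSemifiniteTrace

theorem kyFan_le_of_kFun_le (h : IsFaithfulNormalSemifiniteTrace N τ) {t c : ℝ} (ht : 0 ≤ t)
    (hc : 0 ≤ c) {T : H →L[ℂ] H} (hT : T ∈ N) (hT0 : 0 ≤ T)
    (hle : kFun N τ t T ≤ ENNReal.ofReal c) : kyFan N τ t T ≤ c := by
  rwa [← h.ofReal_kyFan_eq_kFun ht hT hT0, ENNReal.ofReal_le_ofReal_iff hc] at hle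

theorem kyFan_add_le (h : IsFaithfulNormalSemifiniteTrace N τ) {t : ℝ} (ht : 0 ≤ t)
    {S T : H →L[ℂ] H} (hS : S ∈ N) (hT : T ∈ N) (hS0 : 0 ≤ S) (hT0 : 0 ≤ T) :
    kyFan N τ t (S + T) ≤ kyFan N τ t S + kyFan N τ t T := by
  refine h.kyFan_le_of_kFun_le ht (add_nonneg (kyFan_nonneg S ht) (kyFan_nonneg T ht))
    (add_mem hS hT) (add_nonneg hS0 hT0) ?_
  rw [ENNReal.ofReal_add (kyFan_nonneg S ht) (kyFan_nonneg T ht),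
    h.ofReal_kyFan_eq_kFun ht hS hS0, h.ofReal_kyFan_eq_kFun ht hT hT0]
  exact h.kFun_add_le ht S T

theorem kyFan_superadd (h : IsFaithfulNormalSemifiniteTrace N τ) {t : ℝ} (ht : 0 ≤ t)
    {S T : H →L[ℂ] H} (hS : S ∈ N) (hT : T ∈ N) (hS0 : 0 ≤ S) (hT0 : 0 ≤ T) :
    kyFan N τ t S + kyFan N τ t T ≤ kyFan N τ (2 * t) (S + T) := by
  have ht2 : 0 ≤ 2 * t := by positivity
  rw [← ENNReal.ofReal_le_ofReal_iff (kyFan_nonneg _ ht2),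
    ENNReal.ofReal_add (kyFan_nonneg S ht) (kyFan_nonneg T ht),
    h.ofReal_kyFan_eq_kFun ht hS hS0, h.ofReal_kyFan_eq_kFun ht hT hT0,
    h.ofReal_kyFan_eq_kFun ht2 (add_mem hS hT) (add_nonneg hS0 hT0)]
  exact h.kFun_superadd ht hS hT hS0 hT0

theorem kyFan_mono (h : IsFaithfulNormalSemifiniteTrace N τ) {t : ℝ} (ht : 0 ≤ t)
    {S T : H →L[ℂ] H} (hS : S ∈ N) (hT : T ∈ N) (hS0 : 0 ≤ S) (hST : S ≤ T) :
    kyFan N τ t S ≤ kyFan N τ t T := by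
  refine h.kyFan_le_of_kFun_le ht (kyFan_nonneg T ht) hS hS0 ?_
  rw [h.ofReal_kyFan_eq_kFun ht hT (hS0.trans hST)]
  exact kFun_mono t hST

theorem kyFan_posPart_le (h : IsFaithfulNormalSemifiniteTrace N τ) {t : ℝ} (ht : 0 ≤ t)
    {Y P : H →L[ℂ] H} (hY : Y ∈ N) (hYs : IsSelfAdjoint Y) (hP : P ∈ N) (hP0 : 0 ≤ P)
    (hYP : Y ≤ P) : kyFan N τ t Y⁺ ≤ kyFan N τ t P := by
  refine h.kyFan_le_of_kFun_le ht (kyFan_nonneg P ht) (posPart_mem_vonNeumann hY)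
    (CFC.posPart_nonneg Y) ?_
  rw [h.ofReal_kyFan_eq_kFun ht hP hP0]
  exact (h.kFun_posPart_le ht hY hYs).trans (kFun_mono t hYP)

theorem kyFan_conj_le (h : IsFaithfulNormalSemifiniteTrace N τ) {t : ℝ} (ht : 0 ≤ t)
    {V P : H →L[ℂ] H} (hV : V ∈ N) (hP : P ∈ N) (hP0 : 0 ≤ P) :
    kyFan N τ t (V * P * star V) ≤ ‖V‖ ^ 2 * kyFan N τ t P := by
  have h0 := kyFan_nonneg (N := N) (τ := τ) P ht
  refine h.kyFan_le_of_kFun_le ht (by positivity) (mul_mem (mul_mem hV hP) (star_mem hV))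
    (star_right_conjugate_nonneg hP0 V) ?_
  rw [ENNReal.ofReal_mul (by positivity), h.ofReal_kyFan_eq_kFun ht hP hP0]
  exact h.kFun_conj_le hV P

theorem kyFan_smul (h : IsFaithfulNormalSemifiniteTrace N τ) {t : ℝ} (ht : 0 ≤ t) {c : ℝ}
    (hc : 0 ≤ c) (T : H →L[ℂ] H) : kyFan N τ t (c • T) = c * kyFan N τ t T := by
  have key : ∀ c : ℝ, 0 ≤ c → ∀ T : H →L[ℂ] H, kyFan N τ t (c • T) ≤ c * kyFan N τ t T := by
    intro c hc T
    have h1 := h.kyFan_mul_le (c • (1 : H →L[ℂ] H)) T ht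
    rw [smul_mul_assoc, one_mul] at h1
    refine h1.trans (mul_le_mul_of_nonneg_right ?_ (kyFan_nonneg T ht))
    rw [norm_smul, Real.norm_of_nonneg hc]
    exact mul_le_of_le_one_right hc ContinuousLinearMap.norm_id_le
  refine le_antisymm (key c hc T) ?_
  rcases hc.eq_or_lt with rfl | hc'
  · rw [zero_mul]; exact kyFan_nonneg _ ht
  · have h1 := key c⁻¹ (inv_nonneg.2 hc) (c • T)
    rw [smul_smul, inv_mul_cancel₀ hc'.ne', one_smul, inv_mul_eq_div, le_div_iff₀ hc'] at h1
    linarith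

theorem continuous_kyFan (h : IsFaithfulNormalSemifiniteTrace N τ) (T : H →L[ℂ] H) :
    Continuous fun t => kyFan N τ t T :=
  intervalIntegral.continuous_primitive (h.singularValue_intervalIntegrable T) 0

end IsFaithfulNormalSemifiniteTrace

/-- The positive cone of `L^(1,∞)`. -/
def dixmierCone (N : VonNeumannAlgebra H) (τ : (H →L[ℂ] H) → ℝ≥0∞) : Set (H →L[ℂ] H) :=
  {T | T ∈ N ∧ 0 ≤ T ∧ ∃ C : ℝ, ∀ t > 0, kyFan N τ t T ≤ C * Real.log (1 + t)}

/-- The quotients `(1 / log (1 + t)) ∫_0^t μ_s(T) ds`. -/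
def logMean (N : VonNeumannAlgebra H) (τ : (H →L[ℂ] H) → ℝ≥0∞) (T : H →L[ℂ] H) (t : ℝ) : ℝ :=
  1 / Real.log (1 + t) * kyFan N τ t T

theorem log_one_add_pos {t : ℝ} (ht : 0 < t) : 0 < Real.log (1 + t) := Real.log_pos (by linarith)

theorem logMean_nonneg (T : H →L[ℂ] H) {t : ℝ} (ht : 0 < t) : 0 ≤ logMean N τ T t :=
  mul_nonneg (one_div_nonneg.2 (log_one_add_pos ht).le) (kyFan_nonneg T ht.le)

theorem logMean_le_iff {T : H →L[ℂ] H} {t C : ℝ} (ht : 0 < t) :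
    logMean N τ T t ≤ C ↔ kyFan N τ t T ≤ C * Real.log (1 + t) := by
  rw [logMean, one_div_mul_eq_div, div_le_iff₀ (log_one_add_pos ht)]

theorem memLp_top_of_continuousOn {f : ℝ → ℝ} (hf : ContinuousOn f (Set.Ioi 0)) {C : ℝ}
    (h : ∀ t > 0, |f t| ≤ C) : MemLp f ∞ (volume.restrict (Set.Ioi (0 : ℝ))) :=
  memLp_top_of_bound (hf.aestronglyMeasurable measurableSet_Ioi) C
    ((ae_restrict_mem measurableSet_Ioi).mono fun t ht => h t ht)

theorem continuousOn_one_div_log : ContinuousOn (fun t => 1 / Real.log (1 + t)) (Set.Ioi 0) := by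
  refine ContinuousOn.div continuousOn_const ?_ fun t ht => (log_one_add_pos ht).ne'
  refine ContinuousOn.log (by fun_prop) fun t ht => ?_
  have : 0 < t := ht
  positivity

theorem tendsto_one_div_log : Tendsto (fun t => 1 / Real.log (1 + t)) atTop (𝓝 0) := by
  simp only [one_div]
  exact (Real.tendsto_log_atTop.comp (tendsto_atTop_add_const_left _ 1 tendsto_id)).inv_tendsto_atTop

namespace IsFaithfulNormalSemifiniteTrace

theorem continuousOn_logMean (h : IsFaithfulNormalSemifiniteTrace N τ) (T : H →L[ℂ] H) :
    ContinuousOn (logMean N τ T) (Set.Ioi 0) :=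
  continuousOn_one_div_log.mul (h.continuous_kyFan T).continuousOn

theorem memLp_logMean (h : IsFaithfulNormalSemifiniteTrace N τ) {T : H →L[ℂ] H}
    (hT : T ∈ dixmierCone N τ) :
    MemLp (logMean N τ T) ∞ (volume.restrict (Set.Ioi (0 : ℝ))) := by
  obtain ⟨-, -, C, hC⟩ := hT
  refine memLp_top_of_continuousOn (h.continuousOn_logMean T) (C := C) fun t ht => ?_
  rw [abs_of_nonneg (logMean_nonneg T ht)]
  exact (logMean_le_iff ht).2 (hC t ht)

theorem add_mem_dixmierCone (h : IsFaithfulNormalSemifiniteTrace N τ) {S T : H →L[ℂ] H}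
    (hS : S ∈ dixmierCone N τ) (hT : T ∈ dixmierCone N τ) : S + T ∈ dixmierCone N τ := by
  obtain ⟨hS, hS0, C, hC⟩ := hS
  obtain ⟨hT, hT0, C', hC'⟩ := hT
  refine ⟨add_mem hS hT, add_nonneg hS0 hT0, C + C', fun t ht => ?_⟩
  have := h.kyFan_add_le ht.le hS hT hS0 hT0
  linarith [hC t ht, hC' t ht]

/-- One inequality is subadditivity of the integrals. The other is the superadditivity K_t(S) +
K_t(T) ≤ K_{2t}(S + T), read through the invariance of ω under dilation by 2. -/
theorem dixmierTracePos_add (h : IsFaithfulNormalSemifiniteTrace N τ) {ω : LInfty →ₗ[ℝ] ℝ}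
    (hω : IsDixmierFunctional ω) {S T : H →L[ℂ] H}
    (hS : S ∈ dixmierCone N τ) (hT : T ∈ dixmierCone N τ) :
    dixmierTracePos N τ ω (S + T) = dixmierTracePos N τ ω S + dixmierTracePos N τ ω T := by
  have hST := h.add_mem_dixmierCone hS hT
  have mS := h.memLp_logMean hS
  have mT := h.memLp_logMean hT
  have mST := h.memLp_logMean hST
  change omegaLim ω (logMean N τ (S + T)) = omegaLim ω (logMean N τ S) + omegaLim ω (logMean N τ T)
  rw [← omegaLim_add mS mT]
  obtain ⟨hSN, hS0, C₁, hC₁⟩ := id hS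
  obtain ⟨hTN, hT0, C₂, hC₂⟩ := id hT
  obtain ⟨-, -, C, hC⟩ := id hST
  have hC0 : 0 ≤ C := (logMean_nonneg (S + T) one_pos).trans ((logMean_le_iff one_pos).2
    (hC 1 one_pos))
  refine le_antisymm (hω.omegaLim_mono mST (mS.add mT) fun t ht => ?_) ?_
  · rw [logMean, logMean, logMean, ← mul_add]
    exact mul_le_mul_of_nonneg_left (h.kyFan_add_le ht.le hSN hTN hS0 hT0)
      (one_div_nonneg.2 (log_one_add_pos ht).le)
  · have mD : MemLp (fun t => logMean N τ (S + T) (2 * t)) ∞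
        (volume.restrict (Set.Ioi (0 : ℝ))) := by
      refine memLp_top_of_continuousOn (C := C) ?_ fun t ht => ?_
      · refine (h.continuousOn_logMean (S + T)).comp (by fun_prop) fun t ht => ?_
        exact mul_pos two_pos (Set.mem_Ioi.1 ht)
      · have h2 : 0 < 2 * t := by positivity
        rw [abs_of_nonneg (logMean_nonneg _ h2)]
        exact (logMean_le_iff h2).2 (hC _ h2)
    -- The error from log(1 + 2t) ≤ log 2 + log(1 + t). The minimum with C₁ + C₂ keeps it bounded
    -- near 0, where 1 / log(1 + t) blows up; at infinity it tends to 0.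
    let r : ℝ → ℝ := fun t => min (C₁ + C₂) (C * Real.log 2 * (1 / Real.log (1 + t)))
    have hCC : 0 ≤ C₁ + C₂ := add_nonneg
      ((logMean_nonneg S one_pos).trans ((logMean_le_iff one_pos).2 (hC₁ 1 one_pos)))
      ((logMean_nonneg T one_pos).trans ((logMean_le_iff one_pos).2 (hC₂ 1 one_pos)))
    have mr : MemLp r ∞ (volume.restrict (Set.Ioi (0 : ℝ))) := by
      refine memLp_top_of_continuousOn (C := C₁ + C₂)
        (continuousOn_const.inf (continuousOn_const.mul continuousOn_one_div_log)) fun t ht => ?_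
      have h1 := log_one_add_pos ht
      have h2 : 0 ≤ C * Real.log 2 * (1 / Real.log (1 + t)) := by
        have := Real.log_nonneg one_le_two
        positivity
      rw [abs_of_nonneg (le_min hCC h2)]
      exact min_le_left _ _
    have hr : Tendsto r atTop (𝓝 0) := by
      have := (tendsto_const_nhds (x := C₁ + C₂)).min
        ((tendsto_one_div_log).const_mul (C * Real.log 2))
      rwa [mul_zero, min_eq_right hCC] at this
    calc omegaLim ω (fun t => logMean N τ S t + logMean N τ T t)
        ≤ omegaLim ω (fun t => logMean N τ (S + T) (2 * t) + r t) := by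
          refine hω.omegaLim_mono (mS.add mT) (mD.add mr) fun t ht => ?_
          have h2 : 0 < 2 * t := by positivity
          have hl := log_one_add_pos ht
          have e0 := logMean_nonneg (N := N) (τ := τ) (S + T) h2
          rw [← sub_le_iff_le_add']
          refine le_min ?_ ?_
          · linarith [(logMean_le_iff ht).2 (hC₁ t ht), (logMean_le_iff ht).2 (hC₂ t ht)]
          · have e1 := h.kyFan_superadd ht.le hSN hTN hS0 hT0
            have e2 : kyFan N τ (2 * t) (S + T)
                = logMean N τ (S + T) (2 * t) * Real.log (1 + 2 * t) := by
              rw [logMean, mul_right_comm, one_div_mul_cancel (log_one_add_pos h2).ne', one_mul]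
            have e3 : Real.log (1 + 2 * t) ≤ Real.log 2 + Real.log (1 + t) := by
              rw [← Real.log_mul two_ne_zero (by positivity)]
              exact Real.log_le_log (by positivity) (by linarith)
            have e4 : logMean N τ (S + T) (2 * t) ≤ C := (logMean_le_iff h2).2 (hC _ h2)
            have e5 : logMean N τ S t + logMean N τ T t
                = (kyFan N τ t S + kyFan N τ t T) / Real.log (1 + t) := by
              rw [logMean, logMean]; ring
            have e6 := Real.log_nonneg one_le_two
            rw [sub_le_iff_le_add, e5, div_le_iff₀ hl, add_mul, mul_assoc (C * Real.log 2),
              one_div_mul_cancel hl.ne', mul_one]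
            nlinarith [mul_le_mul_of_nonneg_left e3 e0, mul_le_mul_of_nonneg_right e4 e6]
      _ = omegaLim ω (logMean N τ (S + T)) := by
          rw [omegaLim_add mD mr, hω.omegaLim_of_tendsto mr hr, add_zero,
            hω.omegaLim_dilation two_pos mST mD]

theorem dixmierTracePos_smul (h : IsFaithfulNormalSemifiniteTrace N τ) {ω : LInfty →ₗ[ℝ] ℝ}
    {c : ℝ} (hc : 0 ≤ c) {T : H →L[ℂ] H} (hT : T ∈ dixmierCone N τ) :
    c • T ∈ dixmierCone N τ ∧
      dixmierTracePos N τ ω (c • T) = c * dixmierTracePos N τ ω T := by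
  have hm : c • T ∈ dixmierCone N τ := by
    obtain ⟨hTN, hT0, C, hC⟩ := hT
    refine ⟨real_smul_mem_vonNeumann c hTN, smul_nonneg hc hT0, c * C, fun t ht => ?_⟩
    rw [h.kyFan_smul ht.le hc, mul_assoc]
    exact mul_le_mul_of_nonneg_left (hC t ht) hc
  refine ⟨hm, ?_⟩
  change omegaLim ω (logMean N τ (c • T)) = c * omegaLim ω (logMean N τ T)
  rw [← omegaLim_const_mul c (h.memLp_logMean hT), omegaLim_of_memLp (h.memLp_logMean hm),
    omegaLim_of_memLp ((h.memLp_logMean hT).const_mul c)]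
  congr 1
  rw [MemLp.toLp_eq_toLp_iff]
  filter_upwards [ae_restrict_mem measurableSet_Ioi] with t ht
  rw [logMean, logMean, h.kyFan_smul (le_of_lt ht) hc]
  ring

/-- The Dixmier trace on the positive cone of `L^(1,∞)` is a trace cone. -/
theorem isTraceCone_dixmier (h : IsFaithfulNormalSemifiniteTrace N τ) {ω : LInfty →ₗ[ℝ] ℝ}
    (hω : IsDixmierFunctional ω) :
    IsTraceCone N (dixmierCone N τ) (dixmierTracePos N τ ω) := by
  have hmono : ∀ S ∈ dixmierCone N τ, ∀ T ∈ dixmierCone N τ, ∀ c : ℝ, 0 ≤ c →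
      (∀ t > 0, kyFan N τ t S ≤ c * kyFan N τ t T) →
      dixmierTracePos N τ ω S ≤ c * dixmierTracePos N τ ω T := by
    intro S hS T hT c hc hle
    change omegaLim ω (logMean N τ S) ≤ c * omegaLim ω (logMean N τ T)
    rw [← omegaLim_const_mul c (h.memLp_logMean hT)]
    refine hω.omegaLim_mono (h.memLp_logMean hS) ((h.memLp_logMean hT).const_mul c) fun t ht => ?_
    rw [logMean, logMean, mul_left_comm]
    exact mul_le_mul_of_nonneg_left (hle t ht) (one_div_nonneg.2 (log_one_add_pos ht).le)
  have hzero : (0 : H →L[ℂ] H) ∈ dixmierCone N τ := by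
    refine ⟨zero_mem N, le_rfl, 0, fun t ht => ?_⟩
    have := h.kyFan_smul ht.le le_rfl (0 : H →L[ℂ] H)
    rw [smul_zero, zero_mul] at this
    rw [this, zero_mul]
  have hconj : ∀ V ∈ N, ∀ P ∈ dixmierCone N τ, V * P * star V ∈ dixmierCone N τ := by
    rintro V hV P ⟨hP, hP0, C, hC⟩
    refine ⟨mul_mem (mul_mem hV hP) (star_mem hV), star_right_conjugate_nonneg hP0 V,
      ‖V‖ ^ 2 * C, fun t ht => (h.kyFan_conj_le ht.le hV hP hP0).trans ?_⟩
    rw [mul_assoc]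
    exact mul_le_mul_of_nonneg_left (hC t ht) (by positivity)
  exact
  { mem := fun P hP => hP.1
    nonneg := fun P hP => hP.2.1
    zero_mem' := hzero
    add_mem' := fun P hP Q hQ => h.add_mem_dixmierCone hP hQ
    smul_mem' := fun c hc P hP => (h.dixmierTracePos_smul (ω := ω) hc hP).1
    posPart_mem := by
      rintro Y hY hYs P ⟨hP, hP0, C, hC⟩ hYP
      exact ⟨posPart_mem_vonNeumann hY, CFC.posPart_nonneg Y, C, fun t ht =>
        (h.kyFan_posPart_le ht.le hY hYs hP hP0 hYP).trans (hC t ht)⟩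
    conj_mem := hconj
    map_nonneg := by
      intro P hP
      have := hmono 0 hzero P hP 1 zero_le_one fun t ht => by
        rw [one_mul]; exact h.kyFan_mono ht.le (zero_mem N) hP.1 le_rfl hP.2.1
      have h0 := (h.dixmierTracePos_smul (ω := ω) le_rfl hzero).2
      rw [smul_zero, zero_mul] at h0
      rwa [h0, one_mul] at this
    map_add' := fun P hP Q hQ => h.dixmierTracePos_add hω hP hQ
    map_smul' := fun c hc P hP => (h.dixmierTracePos_smul hc hP).2
    map_conj_le := fun V hV P hP => hmono _ (hconj V hV P hP) P hP _ (by positivity) fun t ht =>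
      h.kyFan_conj_le ht.le hV hP.1 hP.2.1 }

/-- Operators with bounded `∫_0^t μ_s` have Dixmier trace zero. -/
theorem dixmierTracePos_eq_zero (h : IsFaithfulNormalSemifiniteTrace N τ) {ω : LInfty →ₗ[ℝ] ℝ}
    (hω : IsDixmierFunctional ω) {T : H →L[ℂ] H} (hT : T ∈ N) (hT0 : 0 ≤ T) {C : ℝ}
    (hC : ∀ t > 0, kyFan N τ t T ≤ C) :
    T ∈ dixmierCone N τ ∧ dixmierTracePos N τ ω T = 0 := by
  have hm : T ∈ dixmierCone N τ := by
    -- The first summand serves t ≤ 1, where the integral is at most t ‖T‖ and t ≤ 2 log(1 + t); the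
    -- second serves t ≥ 1, where log(1 + t) ≥ log 2.
    refine ⟨hT, hT0, 2 * ‖T‖ + C / Real.log 2, fun t ht => ?_⟩
    have hl := log_one_add_pos ht
    have hC0 : 0 ≤ C := (kyFan_nonneg T zero_le_one).trans (hC 1 one_pos)
    have hl2 : 0 < Real.log 2 := Real.log_pos one_lt_two
    rcases le_total t 1 with h1 | h1
    · have h2 : kyFan N τ t T ≤ t * ‖T‖ := by
        refine h.kyFan_le_of_kFun_le ht.le (by positivity) hT hT0 ?_
        exact h.kFun_le_norm (.of_nonneg hT0)
      have h3 : t / 2 ≤ Real.log (1 + t) := by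
        have := Real.one_sub_inv_le_log_of_pos (by positivity : 0 < 1 + t)
        refine le_trans ?_ this
        rw [show 1 - (1 + t)⁻¹ = t / (1 + t) by field_simp; ring, div_le_div_iff₀ two_pos (by positivity)]
        nlinarith
      have h4 : 0 ≤ C / Real.log 2 * Real.log (1 + t) := by positivity
      nlinarith [mul_le_mul_of_nonneg_right h3 (norm_nonneg T)]
    · have h2 : Real.log 2 ≤ Real.log (1 + t) := Real.log_le_log two_pos (by linarith)
      have h3 : C ≤ C / Real.log 2 * Real.log (1 + t) := by
        rw [div_mul_eq_mul_div, le_div_iff₀ hl2]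
        exact mul_le_mul_of_nonneg_left h2 hC0
      have h4 : 0 ≤ 2 * ‖T‖ * Real.log (1 + t) := by positivity
      linarith [hC t ht]
  refine ⟨hm, hω.omegaLim_of_tendsto (h.memLp_logMean hm) ?_⟩
  refine squeeze_zero' (g := fun t => C * (1 / Real.log (1 + t))) ?_ ?_ ?_
  · filter_upwards [eventually_gt_atTop 0] with t ht using logMean_nonneg T ht
  · filter_upwards [eventually_gt_atTop 0] with t ht
    rw [mul_comm C]
    exact mul_le_mul_of_nonneg_left (hC t ht) (one_div_nonneg.2 (log_one_add_pos ht).le)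
  · simpa using tendsto_one_div_log.const_mul C

end IsFaithfulNormalSemifiniteTrace

end DixmierCone

/-! ### The operators (1 + D²)^(-1/2) and |D|, and commutators with them -/

section Unbounded

variable {H : Type*} [NormedAddCommGroup H] [InnerProductSpace ℂ H] [CompleteSpace H]
  {D : H →ₗ.[ℂ] H}

theorem eq_of_mem_graph {x y z : H} (h : (x, y) ∈ D.graph) (h' : (x, z) ∈ D.graph) : y = z := by
  obtain ⟨a, ha, hb⟩ := (LinearPMap.mem_graph_iff D).1 h
  obtain ⟨c, hc, hd⟩ := (LinearPMap.mem_graph_iff D).1 h'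
  have : a = c := Subtype.ext (ha.trans hc.symm)
  exact hb.symm.trans (this ▸ hd)

theorem inner_eq_of_mem_graph (hD : IsSelfAdjoint D) {x y u v : H} (h : (x, y) ∈ D.graph)
    (h' : (u, v) ∈ D.graph) : ⟪y, u⟫_ℂ = ⟪x, v⟫_ℂ := by
  have key := LinearPMap.adjoint_isFormalAdjoint hD.dense_domain
  have e : D.adjoint = D := hD
  rw [e] at key
  obtain ⟨a, ha, hb⟩ := (LinearPMap.mem_graph_iff D).1 h
  obtain ⟨c, hc, hd⟩ := (LinearPMap.mem_graph_iff D).1 h'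
  simp only at ha hb hc hd
  rw [← ha, ← hb, ← hc, ← hd]
  exact key a c

/-- The operator `1 + D²` is injective. -/
theorem eq_zero_of_add_sq_eq_zero (hD : IsSelfAdjoint D) {x y : H} (h : (x, y) ∈ D.graph)
    (h' : (y, -x) ∈ D.graph) : x = 0 := by
  have e := inner_eq_of_mem_graph hD h h
  have e' := inner_eq_of_mem_graph hD h h'
  rw [inner_neg_right, inner_self_eq_norm_sq_to_K, inner_self_eq_norm_sq_to_K] at e'
  have e2 : ‖y‖ ^ 2 = -‖x‖ ^ 2 := by exact_mod_cast e'
  have : ‖x‖ = 0 := by nlinarith [sq_nonneg ‖x‖, sq_nonneg ‖y‖]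
  exact norm_eq_zero.1 this

/-- Graph form of the defining property, which avoids carrying domain proofs: the intermediate
vector is D (1 + D²)⁻¹ y. -/
theorem invOneAddSq_spec (hD : IsSelfAdjoint D) (y : H) :
    ∃ z, (invOneAddSq D y, z) ∈ D.graph ∧ (z, y - invOneAddSq D y) ∈ D.graph := by
  have hs : IsInvOneAddSq D (invOneAddSq D) := by
    unfold invOneAddSq
    rw [dif_pos (exists_isInvOneAddSq hD)]
    exact (exists_isInvOneAddSq hD).choose_spec
  obtain ⟨h, h', e⟩ := hs y
  refine ⟨D ⟨_, h⟩, LinearPMap.mem_graph D ⟨_, h⟩, ?_⟩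
  rw [← eq_sub_iff_add_eq'.2 e]
  exact LinearPMap.mem_graph D ⟨_, h'⟩

theorem eq_invOneAddSq (hD : IsSelfAdjoint D) {x y z : H} (h : (x, z) ∈ D.graph)
    (h' : (z, y - x) ∈ D.graph) : invOneAddSq D y = x := by
  obtain ⟨w, h1, h2⟩ := invOneAddSq_spec hD y
  have e1 := D.graph.sub_mem h1 h
  have e2 := D.graph.sub_mem h2 h'
  refine sub_eq_zero.1 (eq_zero_of_add_sq_eq_zero hD e1 (y := w - z) ?_)
  have e3 : -(invOneAddSq D y - x) = (y - invOneAddSq D y) - (y - x) := by abel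
  rw [e3]
  exact e2

/-- Put y = (1 + D²) u and move one D across by symmetry. Positivity, contractivity and injectivity
all follow from this identity. -/
theorem invOneAddSq_inner (hD : IsSelfAdjoint D) {y z : H}
    (h : (invOneAddSq D y, z) ∈ D.graph) :
    ⟪invOneAddSq D y, y⟫_ℂ = ((‖invOneAddSq D y‖ ^ 2 + ‖z‖ ^ 2 : ℝ) : ℂ) := by
  obtain ⟨w, h1, h2⟩ := invOneAddSq_spec hD y
  have hz : z = w := by
    obtain ⟨a, ha, hb⟩ := (LinearPMap.mem_graph_iff D).1 h
    obtain ⟨c, hc, hd⟩ := (LinearPMap.mem_graph_iff D).1 h1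
    have : a = c := Subtype.ext (ha.trans hc.symm)
    exact hb.symm.trans (this ▸ hd)
  rw [hz]
  have := inner_eq_of_mem_graph hD h1 h2
  rw [inner_sub_right, inner_self_eq_norm_sq_to_K, inner_self_eq_norm_sq_to_K] at this
  push_cast
  linear_combination -this

theorem invOneAddSq_nonneg (hD : IsSelfAdjoint D) : 0 ≤ invOneAddSq D := by
  rw [ContinuousLinearMap.nonneg_iff_isPositive, ContinuousLinearMap.isPositive_iff_complex]
  intro x
  obtain ⟨w, h1, -⟩ := invOneAddSq_spec hD x
  rw [invOneAddSq_inner hD h1]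
  have e (r : ℝ) : RCLike.re (r : ℂ) = r := Complex.ofReal_re r
  rw [e]
  exact ⟨rfl, by positivity⟩

theorem norm_invOneAddSq_le (hD : IsSelfAdjoint D) : ‖invOneAddSq D‖ ≤ 1 := by
  refine ContinuousLinearMap.opNorm_le_bound _ zero_le_one fun x => ?_
  obtain ⟨w, h1, -⟩ := invOneAddSq_spec hD x
  have h2 := norm_inner_le_norm (𝕜 := ℂ) (invOneAddSq D x) x
  rw [invOneAddSq_inner hD h1, Complex.norm_real, Real.norm_of_nonneg (by positivity)] at h2
  by_contra hc
  rw [one_mul, not_le] at hc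
  nlinarith [norm_nonneg x, norm_nonneg (invOneAddSq D x), sq_nonneg ‖w‖]

theorem invOneAddSq_le_one (hD : IsSelfAdjoint D) : invOneAddSq D ≤ 1 := by
  refine (le_norm_smul_one (IsSelfAdjoint.of_nonneg (invOneAddSq_nonneg hD))).trans ?_
  calc ‖invOneAddSq D‖ • (1 : H →L[ℂ] H) ≤ (1 : ℝ) • 1 := by
        gcongr
        exact norm_invOneAddSq_le hD
    _ = 1 := one_smul _ _

theorem invOneAddSq_mem {N : VonNeumannAlgebra H} (hD : IsSelfAdjoint D)
    (hA : IsAffiliated N D) : invOneAddSq D ∈ N := by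
  refine mem_vonNeumann_of_commute fun T hT => ?_
  have key : ∀ x y : H, (x, y) ∈ D.graph → (T x, T y) ∈ D.graph := by
    intro x y hxy
    obtain ⟨a, ha, hb⟩ := (LinearPMap.mem_graph_iff D).1 hxy
    obtain ⟨h, e⟩ := hA T hT a
    simp only at ha hb
    rw [← ha, ← hb, ← e]
    exact LinearPMap.mem_graph D ⟨_, h⟩
  ext y
  obtain ⟨w, h1, h2⟩ := invOneAddSq_spec hD y
  have h3 := key _ _ h2
  rw [map_sub] at h3
  exact (eq_invOneAddSq hD (key _ _ h1) h3).symm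

theorem invSqrtOneAddSq_nonneg (D : H →ₗ.[ℂ] H) : 0 ≤ invSqrtOneAddSq D := CFC.sqrt_nonneg _

theorem invSqrtOneAddSq_mul_self (hD : IsSelfAdjoint D) :
    invSqrtOneAddSq D * invSqrtOneAddSq D = invOneAddSq D :=
  CFC.sqrt_mul_sqrt_self _ (invOneAddSq_nonneg hD)

theorem invSqrtOneAddSq_injective (hD : IsSelfAdjoint D) :
    Function.Injective (invSqrtOneAddSq D) := by
  refine (injective_iff_map_eq_zero _).2 fun y hy => ?_
  have h0 : invOneAddSq D y = 0 := by
    rw [← invSqrtOneAddSq_mul_self hD, mul_apply_eq_comp, hy, map_zero]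
  obtain ⟨w, h1, h2⟩ := invOneAddSq_spec hD y
  have h3 := invOneAddSq_inner hD h1
  rw [h0, inner_zero_left, norm_zero] at h3
  have : w = 0 := by
    have : (0 : ℝ) ^ 2 + ‖w‖ ^ 2 = 0 := by exact_mod_cast h3.symm
    simpa using this
  rw [h0, sub_zero, this] at h2
  obtain ⟨a, ha, hb⟩ := (LinearPMap.mem_graph_iff D).1 h2
  have ha' : a = 0 := Subtype.ext ha
  rw [ha', LinearPMap.map_zero] at hb
  exact hb.symm

/-- The orthogonal complement of the range of a self-adjoint operator is its kernel, which is zero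
here. -/
theorem dense_range_invSqrtOneAddSq (hD : IsSelfAdjoint D) :
    DenseRange (invSqrtOneAddSq D) := by
  have h := (invSqrtOneAddSq D).orthogonal_range
  have hs : ContinuousLinearMap.adjoint (invSqrtOneAddSq D) = invSqrtOneAddSq D :=
    IsSelfAdjoint.of_nonneg (invSqrtOneAddSq_nonneg D)
  rw [hs, LinearMap.ker_eq_bot.2 (invSqrtOneAddSq_injective hD)] at h
  have := Submodule.dense_iff_topologicalClosure_eq_top.2
    ((Submodule.topologicalClosure_eq_top_iff).2 h)
  simpa [DenseRange] using! this

/-- With R = (1 + D²)^(-1/2), the product D R is a contraction. On y = R x the quadratic identity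
gives ‖D R² x‖ ≤ ‖R x‖; density of the range of R and closedness of D do the rest. -/
theorem exists_mem_graph_invSqrtOneAddSq (hD : IsSelfAdjoint D) (y : H) :
    ∃ z, (invSqrtOneAddSq D y, z) ∈ D.graph ∧ ‖z‖ ≤ ‖y‖ := by
  set R := invSqrtOneAddSq D with hR
  have hRR : ∀ y, R (R y) = invOneAddSq D y := fun y => by
    rw [← invSqrtOneAddSq_mul_self hD]; rfl
  choose G hG hG' using invOneAddSq_spec hD
  have hdiff : ∀ x y, ‖G x - G y‖ ≤ ‖R x - R y‖ := by
    intro x y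
    have h1 := D.graph.sub_mem (hG x) (hG y)
    have h2 : (invOneAddSq D (x - y), G x - G y) ∈ D.graph := by rw [map_sub]; exact h1
    have h3 := invOneAddSq_inner hD h2
    have hs : IsSelfAdjoint R := IsSelfAdjoint.of_nonneg (invSqrtOneAddSq_nonneg D)
    rw [← hRR, hs.isSymmetric.apply_clm] at h3
    rw [inner_self_eq_norm_sq_to_K] at h3
    have h4 : ‖R (x - y)‖ ^ 2 = ‖R (R (x - y))‖ ^ 2 + ‖G x - G y‖ ^ 2 :=
      Complex.ofReal_injective (by rw [← h3]; push_cast; rfl)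
    rw [← map_sub]
    exact abs_le_of_sq_le_sq' (by nlinarith [sq_nonneg ‖R (R (x - y))‖]) (norm_nonneg _) |>.2
  obtain ⟨u, hu⟩ := mem_closure_iff_seq_limit.1 (dense_range_invSqrtOneAddSq hD y)
  obtain ⟨hu, hlim⟩ := hu
  choose x hx using hu
  have hc : CauchySeq fun n => G (x n) := by
    have h5 := hlim.cauchySeq
    rw [Metric.cauchySeq_iff] at h5 ⊢
    intro ε hε
    obtain ⟨n, hn⟩ := h5 ε hε
    refine ⟨n, fun k hk l hl => lt_of_le_of_lt ?_ (hn k hk l hl)⟩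
    rw [dist_eq_norm, dist_eq_norm, ← hx k, ← hx l]
    exact hdiff _ _
  obtain ⟨z, hz⟩ := cauchySeq_tendsto_of_complete hc
  refine ⟨z, ?_, ?_⟩
  · have hcl : IsClosed (D.graph : Set (H × H)) := hD.isClosed
    refine hcl.mem_of_tendsto (b := atTop) (f := fun n => (R (u n), G (x n)))
      (((R.continuous.tendsto _).comp hlim).prodMk_nhds hz) (Eventually.of_forall fun n => ?_)
    rw [← hx n]
    change (R (R (x n)), G (x n)) ∈ D.graph
    rw [hRR]
    exact hG _
  · refine le_of_tendsto_of_tendsto hz.norm hlim.norm (Eventually.of_forall fun n => ?_)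
    have h0 : G 0 = 0 := by
      have := hG 0
      rw [map_zero] at this
      obtain ⟨a, ha, hb⟩ := (LinearPMap.mem_graph_iff D).1 this
      have ha' : a = 0 := Subtype.ext ha
      rw [ha', LinearPMap.map_zero] at hb
      exact hb.symm
    have := hdiff (x n) 0
    rw [h0, map_zero, sub_zero, sub_zero] at this
    simp only [← hx n]
    exact this

/-- The bounded F = D R commutes with (1 + D²)⁻¹, hence with its square root R. For x in the domain
of D and v = D x, this turns x = (1 + D²)⁻¹ x + D² (1 + D²)⁻¹ x into x = R (R x + F v). -/
theorem mem_domain_iff_mem_range (hD : IsSelfAdjoint D) {x : H} :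
    x ∈ D.domain ↔ ∃ y, invSqrtOneAddSq D y = x := by
  set R := invSqrtOneAddSq D with hR
  constructor
  · intro hx
    have hRR : ∀ y, R (R y) = invOneAddSq D y := fun y => by
      rw [← invSqrtOneAddSq_mul_self hD]; rfl
    choose F hF hF' using exists_mem_graph_invSqrtOneAddSq hD
    let F₁ : H →L[ℂ] H := LinearMap.mkContinuous
      { toFun := F
        map_add' := fun a b => eq_of_mem_graph (hF (a + b))
          (by rw [map_add]; exact D.graph.add_mem (hF a) (hF b))
        map_smul' := fun c a => eq_of_mem_graph (hF (c • a))
          (by rw [map_smul]; exact D.graph.smul_mem c (hF a)) } 1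
      fun a => by rw [one_mul]; exact hF' a
    have hF1 : ∀ y, F₁ y = F y := fun y => rfl
    have hQD : ∀ u v, (u, v) ∈ D.graph → (invOneAddSq D u, invOneAddSq D v) ∈ D.graph := by
      intro u v huv
      obtain ⟨w, h1, h2⟩ := invOneAddSq_spec hD u
      obtain ⟨w', h3, h4⟩ := invOneAddSq_spec hD v
      have : invOneAddSq D v = w := by
        refine eq_invOneAddSq hD h2 ?_
        exact D.graph.sub_mem huv h1
      rw [this]
      exact h1
    have hcomm : Commute (invOneAddSq D) F₁ := by
      ext y
      change invOneAddSq D (F y) = F (invOneAddSq D y)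
      refine eq_of_mem_graph (hQD _ _ (hF y)) ?_
      have := hF (invOneAddSq D y)
      rwa [← hRR y, ← hR, hRR (R y), hRR y] at this
    have hcomm' : Commute R F₁ := hcomm.cfcₙ_nnreal NNReal.sqrt
    have hc : ∀ y, F (R y) = R (F y) := fun y => (congr($(hcomm'.eq) y)).symm
    have hxg := LinearPMap.mem_graph D ⟨x, hx⟩
    simp only at hxg
    set v := D ⟨x, hx⟩
    obtain ⟨w, h1, h2⟩ := invOneAddSq_spec hD x
    have hw : w = invOneAddSq D v := eq_of_mem_graph h1 (hQD _ _ hxg)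
    have h3 : x - invOneAddSq D x = F (R v) := by
      refine eq_of_mem_graph h2 ?_
      rw [hw, ← hRR]
      exact hF _
    refine ⟨R x + F v, ?_⟩
    rw [map_add, hRR, ← hc, ← h3]
    abel
  · rintro ⟨y, rfl⟩
    obtain ⟨z, hz, -⟩ := exists_mem_graph_invSqrtOneAddSq hD y
    exact LinearPMap.mem_domain_of_mem_graph hz

/-- Parametrizes the graph of |D| by all of the Hilbert space, so that identities for |D| become
identities between bounded operators. -/
theorem mem_absOp_graph (hD : IsSelfAdjoint D) {x z : H} :
    (x, z) ∈ (absOp D).graph ↔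
      ∃ y, x = invSqrtOneAddSq D y ∧ z = CFC.sqrt (1 - invOneAddSq D) y := by
  have hker : LinearMap.ker ((invSqrtOneAddSq D : H →ₗ[ℂ] H).toPMap ⊤).toFun = ⊥ := by
    rw [LinearMap.ker_eq_bot]
    intro a b hab
    exact Subtype.ext (invSqrtOneAddSq_injective hD hab)
  have hg : ∀ u v, (u, v) ∈ (sqrtOneAddSq D).graph ↔ u = invSqrtOneAddSq D v := by
    intro u v
    unfold sqrtOneAddSq
    rw [LinearPMap.inverse_graph hker]
    constructor
    · rintro ⟨⟨a, b⟩, hab, e⟩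
      obtain ⟨c, hc, hd⟩ := (LinearPMap.mem_graph_iff _).1 hab
      simp only [LinearEquiv.coe_coe, LinearEquiv.prodComm_apply, Prod.swap_prod_mk,
        Prod.mk.injEq] at e hc hd
      rw [← e.1, ← e.2, ← hd, ← hc]
      rfl
    · intro e
      refine ⟨(v, u), ?_, rfl⟩
      rw [e]
      exact LinearPMap.mem_graph ((invSqrtOneAddSq D : H →ₗ[ℂ] H).toPMap ⊤) ⟨v, trivial⟩
  rw [LinearPMap.mem_graph_iff]
  constructor
  · rintro ⟨a, ha, hb⟩
    refine ⟨sqrtOneAddSq D a, ?_, hb.symm⟩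
    exact ha.symm.trans ((hg _ _).1 (LinearPMap.mem_graph (sqrtOneAddSq D) a))
  · rintro ⟨y, hx, hz⟩
    obtain ⟨a, ha, hb⟩ := (LinearPMap.mem_graph_iff _).1 ((hg x y).2 hx)
    refine ⟨a, ha, ?_⟩
    rw [hz]
    simp only at hb
    rw [← hb]
    rfl

/-- If `[|D|, a]` is bounded, then `a` commutes with `(1 + D²)^(-1/2)` up to a product with two
factors `(1 + D²)^(-1/2)`. -/
theorem IsDelta.exists_commutator_eq {N : VonNeumannAlgebra H} (hD : IsSelfAdjoint D)
    (hA : IsAffiliated N D) {a B₀ : H →L[ℂ] H} (ha : a ∈ N) (hB₀ : B₀ ∈ N)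
    (h : IsDelta D a B₀) : ∃ B ∈ N,
      a * invSqrtOneAddSq D - invSqrtOneAddSq D * a
        = invSqrtOneAddSq D * B * invSqrtOneAddSq D := by
  set R := invSqrtOneAddSq D with hR
  set Q := invOneAddSq D with hQ
  set c : H →L[ℂ] H := CFC.sqrt (1 - Q) with hc
  have hQ0 : 0 ≤ Q := invOneAddSq_nonneg hD
  have hQs : IsSelfAdjoint Q := IsSelfAdjoint.of_nonneg hQ0
  have hQ1 : Q ≤ 1 := invOneAddSq_le_one hD
  have hQN : Q ∈ N := invOneAddSq_mem hD hA
  -- In terms of D this k = g(Q) is the bounded difference (1 + D²)^(1/2) - |D|, since √x / (1 + √(1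
  -- - x)) = (1 - √(1 - x)) / √x for 0 < x ≤ 1.
  let g : ℝ → ℝ := fun x => √x / (1 + √(1 - x))
  have hpos : ∀ x : ℝ, 1 + √(1 - x) ≠ 0 := fun x => by positivity
  have hgc : Continuous g := by
    refine Continuous.div (by fun_prop) (by fun_prop) hpos
  have hRe : R = cfc (fun x : ℝ => √x) Q := by
    rw [hR, invSqrtOneAddSq, CFC.sqrt_eq_real_sqrt _ hQ0, cfcₙ_eq_cfc (hf0 := by simp)]
  have h1Q : 1 - Q = cfc (fun x : ℝ => 1 - x) Q := by
    rw [cfc_sub (fun _ => (1 : ℝ)) (fun x => x) Q, cfc_const_one ℝ Q, cfc_id' ℝ Q]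
  have hce : c = cfc (fun x : ℝ => √(1 - x)) Q := by
    rw [hc, CFC.sqrt_eq_real_sqrt _ (sub_nonneg.2 hQ1), cfcₙ_eq_cfc (hf0 := by simp), h1Q,
      ← cfc_comp' (fun x : ℝ => √x) (fun x : ℝ => 1 - x) Q]
  set k : H →L[ℂ] H := cfc g Q with hk
  have hkR : k * R = 1 - c := by
    rw [hk, hRe, hce, ← cfc_mul g (fun x : ℝ => √x) Q hgc.continuousOn]
    have h1 : (1 : H →L[ℂ] H) = cfc (fun _ => (1 : ℝ)) Q := (cfc_const_one ℝ Q).symm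
    rw [h1, ← cfc_sub (fun _ => (1 : ℝ)) (fun x => √(1 - x)) Q]
    refine cfc_congr fun x hx => ?_
    have hx0 : 0 ≤ x := spectrum_nonneg_of_nonneg hQ0 hx
    have hx1 : x ≤ 1 := by
      have := (le_algebraMap_iff_spectrum_le (R := ℝ) (r := 1) (a := Q)).1
        (by simpa using hQ1) x hx
      exact this
    have e1 : √x * √x = x := Real.mul_self_sqrt hx0
    have e2 : √(1 - x) * √(1 - x) = 1 - x := Real.mul_self_sqrt (by linarith)
    simp only [g]
    rw [div_mul_eq_mul_div, div_eq_iff (hpos x), e1]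
    linear_combination e2
  have hkN : k ∈ N := cfc_mem_vonNeumann hQN g
  -- The witness is the bounded extension of [(1 + D²)^(1/2), a] = [|D|, a] + [k, a], and [a, R] = R
  -- [R⁻¹, a] R.
  refine ⟨B₀ + k * a - a * k, sub_mem (add_mem hB₀ (mul_mem hkN ha)) (mul_mem ha hkN), ?_⟩
  ext y
  have hg1 : (R y, c y) ∈ (absOp D).graph := (mem_absOp_graph hD).2 ⟨y, rfl, rfl⟩
  obtain ⟨⟨x, hx⟩, hx1, hx2⟩ := (LinearPMap.mem_graph_iff _).1 hg1
  obtain ⟨hax, e⟩ := h ⟨x, hx⟩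
  simp only at hx1 hx2 hax e
  obtain ⟨w, hw1, hw2⟩ := (mem_absOp_graph hD).1 (LinearPMap.mem_graph _ ⟨a x, hax⟩)
  simp only at hw1 hw2
  rw [hw2, hx2, hx1] at e
  rw [hx1] at hw1
  have hkR' : ∀ v, k (R v) = v - c v := fun v => congr($hkR v)
  -- Here w = R⁻¹ a R y, so this is a R = R (a + B R) before the outer R is applied.
  have e1 : w = a y + (B₀ (R y) + k (a (R y)) - a (k (R y))) := by
    rw [hkR' y, map_sub, hw1]
    change _ = a y + (B₀ (R y) + k (R w) - (a y - a (c y)))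
    rw [hkR' w, ← e]
    abel
  change a (R y) - R (a y) = R (B₀ (R y) + k (a (R y)) - a (k (R y)))
  have e2 : a (R y) - R (a y) = R (w - a y) := by rw [hw1, map_sub]
  rw [e2, sub_eq_iff_eq_add'.2 e1]

/-- An operator which commutes with `(1 + D²)^(-1/2)` modulo its left ideal preserves `dom D`. -/
theorem map_mem_domain_of_commutator_eq (hD : IsSelfAdjoint D) {a B : H →L[ℂ] H}
    (h : a * invSqrtOneAddSq D - invSqrtOneAddSq D * a
        = invSqrtOneAddSq D * B * invSqrtOneAddSq D) {x : H} (hx : x ∈ D.domain) :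
    a x ∈ D.domain := by
  rw [mem_domain_iff_mem_range hD] at hx ⊢
  obtain ⟨y, rfl⟩ := hx
  refine ⟨a y + B (invSqrtOneAddSq D y), ?_⟩
  rw [map_add]
  have : a (invSqrtOneAddSq D y) - invSqrtOneAddSq D (a y)
    = invSqrtOneAddSq D (B (invSqrtOneAddSq D y)) := congr($h y)
  rw [← this]
  abel

theorem IsBoundedCommutator.eq {a B B' : H →L[ℂ] H} (h : IsBoundedCommutator D a B)
    (h' : IsBoundedCommutator D a B') : B = B' := by
  ext x
  refine congrFun (Continuous.ext_on h.1 B.continuous B'.continuous fun x hx => ?_) x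
  rw [← h.2 x hx.1 hx.2, ← h'.2 x hx.1 hx.2]

theorem IsBoundedCommutator.commutator_eq {a B : H →L[ℂ] H} (h : IsBoundedCommutator D a B) :
    commutator D a = B := by
  have hex : ∃ B, IsBoundedCommutator D a B := ⟨B, h⟩
  unfold commutator
  rw [dif_pos hex]
  exact hex.choose_spec.eq h

/-- Leibniz rule on the domain of D. Preservation of the domain by both factors makes the
intermediate D b x meaningful. -/
theorem isBoundedCommutator_mul (hD : IsSelfAdjoint D) {a b A B : H →L[ℂ] H}
    (ha : IsBoundedCommutator D a A) (hb : IsBoundedCommutator D b B)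
    (ha' : ∀ x ∈ D.domain, a x ∈ D.domain) (hb' : ∀ x ∈ D.domain, b x ∈ D.domain) :
    IsBoundedCommutator D (a * b) (A * b + a * B) := by
  refine ⟨?_, fun x hx hax => ?_⟩
  · convert hD.dense_domain using 1
    ext x
    exact ⟨fun h => h.1, fun h => ⟨h, ha' _ (hb' _ h)⟩⟩
  · have h1 := ha.2 (b x) (hb' x hx) hax
    have h2 := hb.2 x hx (hb' x hx)
    change _ = A (b x) + a (B x)
    rw [← h1, ← h2, map_sub]
    change D ⟨a (b x), _⟩ - a (b (D ⟨x, hx⟩)) = _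
    abel

theorem isBoundedCommutator_add (hD : IsSelfAdjoint D) {a b A B : H →L[ℂ] H}
    (ha : IsBoundedCommutator D a A) (hb : IsBoundedCommutator D b B)
    (ha' : ∀ x ∈ D.domain, a x ∈ D.domain) (hb' : ∀ x ∈ D.domain, b x ∈ D.domain) :
    IsBoundedCommutator D (a + b) (A + B) := by
  refine ⟨?_, fun x hx hax => ?_⟩
  · convert hD.dense_domain using 1
    ext x
    exact ⟨fun h => h.1, fun h => ⟨h, add_mem (ha' _ h) (hb' _ h)⟩⟩
  · have h1 := ha.2 x hx (ha' x hx)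
    have h2 := hb.2 x hx (hb' x hx)
    change _ = A x + B x
    rw [← h1, ← h2]
    have : (⟨(a + b) x, hax⟩ : D.domain) = ⟨a x, ha' x hx⟩ + ⟨b x, hb' x hx⟩ := rfl
    rw [this, LinearPMap.map_add, add_apply]
    abel

theorem isBoundedCommutator_smul (hD : IsSelfAdjoint D) {a A : H →L[ℂ] H} (c : ℂ)
    (ha : IsBoundedCommutator D a A) (ha' : ∀ x ∈ D.domain, a x ∈ D.domain) :
    IsBoundedCommutator D (c • a) (c • A) := by
  refine ⟨?_, fun x hx hax => ?_⟩
  · convert hD.dense_domain using 1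
    ext x
    exact ⟨fun h => h.1, fun h => ⟨h, Submodule.smul_mem _ c (ha' _ h)⟩⟩
  · have h1 := ha.2 x hx (ha' x hx)
    change _ = c • A x
    rw [← h1]
    have : (⟨(c • a) x, hax⟩ : D.domain) = c • ⟨a x, ha' x hx⟩ := rfl
    rw [this, LinearPMap.map_smul, smul_sub, smul_apply]

end Unbounded

/-! ### From (p,∞)-summability to weak trace class of R^p and trace class of R^(p+1) -/

section Summability

variable {H : Type*} [NormedAddCommGroup H] [InnerProductSpace ℂ H] [CompleteSpace H]
  {N : VonNeumannAlgebra H} {τ : (H →L[ℂ] H) → ℝ≥0∞}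

namespace IsFaithfulNormalSemifiniteTrace

/-- For any level l > μ_t(T), the spectral projection of T for (-∞, l] is admissible at t and bounds
T^k by l^k there. -/
theorem singularValue_pow_le (h : IsFaithfulNormalSemifiniteTrace N τ) {T : H →L[ℂ] H}
    (hT : T ∈ N) (hT0 : 0 ≤ T) (t : ℝ) (k : ℕ) :
    singularValue N τ t (T ^ k) ≤ singularValue N τ t T ^ k := by
  have hsa : IsSelfAdjoint T := .of_nonneg hT0
  have key : ∀ l, singularValue N τ t T < l → singularValue N τ t (T ^ k) ≤ l ^ k := by
    intro l hl
    have hl0 : 0 ≤ l := (singularValue_nonneg t T).trans hl.le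
    refine (singularValue_le (specProj_mem_vonNeumann hT l) (isStarProjection_specProj T l)
      (h.distribution_le hT0 hT hl)).trans ?_
    rw [← cfc_pow_id (R := ℝ) T k]
    refine norm_mul_specProj_le hT0 hl0 (g := fun x => x ^ k) (by fun_prop)
      (fun x hx y _ hxy => pow_le_pow_left₀ hx hxy k) (by positivity)
      -- The geometric sum from x^k - l^k = (x - l) ∑ x^i l^(k-1-i), with x replaced by its upper
      -- bound ‖T‖.
      ⟨∑ i ∈ Finset.range k, ‖T‖ ^ i * l ^ (k - 1 - i), fun x hx => ?_⟩
    have hx0 : 0 ≤ x := spectrum_nonneg_of_nonneg hT0 hx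
    have hxT := le_norm_of_mem_spectrum hsa hx
    rcases le_total x l with hxl | hxl
    · rw [min_eq_left hxl, sub_self, max_eq_right (by linarith), mul_zero]
    · rw [min_eq_right hxl, max_eq_left (by linarith), ← geom_sum₂_mul]
      gcongr
  have hlim : Tendsto (fun l : ℝ => l ^ k) (𝓝[>] (singularValue N τ t T))
      (𝓝 (singularValue N τ t T ^ k)) :=
    ((continuous_pow k).tendsto _).mono_left nhdsWithin_le_nhds
  exact ge_of_tendsto hlim (eventually_nhdsWithin_of_forall fun l hl => key l hl)

theorem mul_singularValue_le_kyFan (h : IsFaithfulNormalSemifiniteTrace N τ) (T : H →L[ℂ] H)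
    {t : ℝ} (ht : 0 ≤ t) : t * singularValue N τ t T ≤ kyFan N τ t T := by
  have := intervalIntegral.integral_mono_on ht (f := fun _ => singularValue N τ t T)
    (g := fun s => singularValue N τ s T) (μ := volume) (by simp)
    (h.singularValue_intervalIntegrable T 0 t) fun s hs => h.singularValue_antitone T hs.2
  simpa [kyFan] using! this

theorem kyFan_le_mul_norm (h : IsFaithfulNormalSemifiniteTrace N τ) (T : H →L[ℂ] H)
    {t : ℝ} (ht : 0 ≤ t) : kyFan N τ t T ≤ t * ‖T‖ := by
  have := intervalIntegral.integral_mono_on ht (f := fun s => singularValue N τ s T)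
    (g := fun _ => ‖T‖) (μ := volume) (h.singularValue_intervalIntegrable T 0 t) (by simp)
    fun s hs => h.singularValue_le_norm T s
  simpa [kyFan] using! this

theorem kyFan_mono_left (h : IsFaithfulNormalSemifiniteTrace N τ) (T : H →L[ℂ] H)
    {s t : ℝ} (hst : s ≤ t) : kyFan N τ s T ≤ kyFan N τ t T := by
  rw [kyFan, kyFan, ← intervalIntegral.integral_add_adjacent_intervals
    (h.singularValue_intervalIntegrable T 0 s) (h.singularValue_intervalIntegrable T s t)]
  have := intervalIntegral.integral_nonneg (μ := volume) hst
    fun u _ => singularValue_nonneg (N := N) (τ := τ) u T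
  linarith

theorem kyFan_le_norm_add (h : IsFaithfulNormalSemifiniteTrace N τ) (T : H →L[ℂ] H)
    {t : ℝ} (ht : 1 ≤ t) {g : ℝ → ℝ} (hg : IntervalIntegrable g volume 1 t)
    (hle : ∀ s, 1 ≤ s → singularValue N τ s T ≤ g s) :
    kyFan N τ t T ≤ ‖T‖ + ∫ s in (1 : ℝ)..t, g s := by
  rw [kyFan, ← intervalIntegral.integral_add_adjacent_intervals
    (h.singularValue_intervalIntegrable T 0 1) (h.singularValue_intervalIntegrable T 1 t)]
  have h1 := h.kyFan_le_mul_norm T zero_le_one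
  rw [one_mul] at h1
  exact add_le_add h1 (intervalIntegral.integral_mono_on ht
    (h.singularValue_intervalIntegrable T 1 t) hg fun s hs => hle s hs.1)

/-- The tail ∫_1^∞ s^(-b) ds = 1/(b - 1) converges; the part over (0, 1) is bounded by the norm. -/
theorem exists_kyFan_le_of_singularValue_le_rpow (h : IsFaithfulNormalSemifiniteTrace N τ)
    (T : H →L[ℂ] H) {C b : ℝ} (hb : 1 < b)
    (hle : ∀ s, 1 ≤ s → singularValue N τ s T ≤ C * s ^ (-b)) :
    ∀ t > 0, kyFan N τ t T ≤ ‖T‖ + C / (b - 1) := by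
  have hC : 0 ≤ C := by
    have := hle 1 le_rfl
    rw [Real.one_rpow, mul_one] at this
    exact (singularValue_nonneg 1 T).trans this
  have key : ∀ t, 1 ≤ t → kyFan N τ t T ≤ ‖T‖ + C / (b - 1) := by
    intro t ht
    have hni : (0 : ℝ) ∉ Set.uIcc 1 t := by
      rw [Set.uIcc_of_le ht]; intro hh; linarith [hh.1]
    have hi : IntervalIntegrable (fun s : ℝ => C * s ^ (-b)) volume 1 t :=
      (intervalIntegral.intervalIntegrable_rpow (Or.inr hni)).const_mul C
    refine (h.kyFan_le_norm_add T ht hi hle).trans ?_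
    rw [intervalIntegral.integral_const_mul, integral_rpow (Or.inr ⟨by linarith, hni⟩),
      Real.one_rpow, div_eq_mul_one_div C]
    have h0 : 0 ≤ t ^ (-b + 1) := Real.rpow_nonneg (by linarith) _
    have : (t ^ (-b + 1) - 1) / (-b + 1) ≤ 1 / (b - 1) := by
      rw [show -b + 1 = -(b - 1) by ring, div_neg, ← neg_div]
      rw [show -b + 1 = -(b - 1) by ring] at h0
      exact div_le_div_of_nonneg_right (by linarith) (by linarith)
    gcongr
  intro t _
  exact (h.kyFan_mono_left T (le_max_left t 1)).trans (key _ (le_max_right t 1))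

/-- The trace is recovered from below: the truncations (T - 1/(n + 1))⁺ increase to T and have trace
at most C + 1, so normality gives τ(T) ≤ C + 1. -/
theorem lt_top_of_kyFan_le (h : IsFaithfulNormalSemifiniteTrace N τ) {T : H →L[ℂ] H}
    (hT : T ∈ N) (hT0 : 0 ≤ T) {C : ℝ} (hC : ∀ t > 0, kyFan N τ t T ≤ C) : τ T < ∞ := by
  have hC0 : 0 ≤ C := (kyFan_nonneg T zero_le_one).trans (hC 1 one_pos)
  have hsa : IsSelfAdjoint T := .of_nonneg hT0
  refine lt_of_le_of_lt (h.le_of_norm_approx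
    (S := fun n => cfc (fun x : ℝ => max (x - 1 / (n + 1 : ℝ)) 0) T) ?_
    (fun n => cfc_mem_vonNeumann hT _) (fun n => cfc_nonneg fun x _ => le_max_right _ _) hT
    (fun n => ?_) (fun ε hε => ?_) (c := ENNReal.ofReal (C + 1)) (fun n => ?_))
    ENNReal.ofReal_lt_top
  · intro m n hmn
    refine cfc_mono (fun x _ => ?_) (by fun_prop) (by fun_prop)
    have : 1 / (n + 1 : ℝ) ≤ 1 / (m + 1) := Nat.one_div_le_one_div hmn
    exact max_le_max (by linarith) le_rfl
  · nth_rewrite 2 [← cfc_id' ℝ T]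
    refine cfc_le_cfc_of_nonneg hT0 (by fun_prop) (by fun_prop) fun x hx => ?_
    have : 0 < 1 / (n + 1 : ℝ) := Nat.one_div_pos_of_nat
    exact max_le (by linarith) hx
  · obtain ⟨n, hn⟩ := exists_nat_one_div_lt hε
    refine ⟨n, ?_⟩
    rw [cfc_add_smul_one hsa (by fun_prop)]
    nth_rewrite 1 [← cfc_id' ℝ T]
    refine cfc_mono (fun x _ => ?_) (by fun_prop) (by fun_prop)
    have := le_max_left (x - 1 / (n + 1 : ℝ)) 0
    linarith
  -- With t this large, the nearly optimal b satisfies t b ≤ C + 1, hence b ≤ 1/(n + 1), and (T -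
  -- b)⁺ dominates the truncation.
  · set t : ℝ := (C + 1) * (n + 1) with ht
    have ht0 : 0 < t := by positivity
    obtain ⟨b, hb0, hb⟩ := h.exists_le_kyFan hT0 hT ht0.le (one_div_pos.2 ht0)
    rw [mul_one_div_cancel ht0.ne'] at hb
    have hb' := hb.trans (ENNReal.ofReal_le_ofReal (add_le_add_left (hC t ht0) 1))
    have hb1 : t * b ≤ C + 1 :=
      (ENNReal.ofReal_le_ofReal_iff (by positivity)).1 (le_add_self.trans hb')
    have hbn : b ≤ 1 / (n + 1 : ℝ) := by
      rw [le_div_iff₀ (by positivity)]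
      have h2 : 0 < C + 1 := by positivity
      have : (C + 1) * (b * (n + 1)) ≤ (C + 1) * 1 := by
        calc (C + 1) * (b * (n + 1)) = t * b := by rw [ht]; ring
          _ ≤ _ := by linarith
      exact le_of_mul_le_mul_left this h2
    refine le_trans (h.mono (cfc_mem_vonNeumann hT _) (cfc_mem_vonNeumann hT _)
      (cfc_nonneg fun x _ => le_max_right _ _) ?_) (le_self_add.trans hb')
    refine cfc_mono (fun x _ => max_le_max (by linarith) le_rfl) (by fun_prop) (by fun_prop)

/-- Decay of the singular values of a positive `R ∈ L^(p,∞)`. -/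
theorem exists_singularValue_le_rpow (h : IsFaithfulNormalSemifiniteTrace N τ)
    {R : H →L[ℂ] H} {p : ℕ} (hp : 1 ≤ p) (hR : R ∈ weakIdeal N τ p) :
    ∃ C a : ℝ, 0 ≤ C ∧ 1 < a * (p + 1) ∧ (1 < p → a = 1 / p) ∧
      ∀ s, 1 ≤ s → singularValue N τ s R ≤ C * s ^ (-a) := by
  obtain ⟨-, C, hC⟩ := hR
  have hgp : ∀ t, 1 ≤ t → 0 < gauge p t := by
    intro t ht
    unfold gauge
    split_ifs with h1 h2
    · exact log_one_add_pos (by linarith)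
    · linarith
    · exact Real.rpow_pos_of_pos (by linarith) _
  have hC' : ∀ t, 1 ≤ t → t * singularValue N τ t R ≤ C * gauge p t := fun t ht =>
    (h.mul_singularValue_le_kyFan R (by linarith)).trans
      ((div_le_iff₀ (hgp t ht)).1 (hC t (by linarith)))
  have hC0 : 0 ≤ C := by
    have h1 := hC' 1 le_rfl
    have h2 : 0 ≤ 1 * singularValue N τ 1 R := by
      rw [one_mul]; exact singularValue_nonneg 1 R
    exact nonneg_of_mul_nonneg_left (h2.trans h1) (hgp 1 le_rfl)
  rcases hp.eq_or_lt with rfl | hp1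
  -- For p = 1 the bound on μ_s is C log(1 + s)/s. The logarithm is absorbed in s^(1/4); the
  -- exponent 3/4 works because it exceeds 1/2, which makes R² trace class.
  · refine ⟨C * 8, 3 / 4, by positivity, by norm_num, fun h => absurd h (lt_irrefl _),
      fun s hs => ?_⟩
    have hs0 : 0 < s := by linarith
    have h1 := hC' s hs
    simp only [gauge, Nat.cast_one, if_true] at h1
    have h2 : Real.log (1 + s) ≤ 8 * s ^ (1 / 4 : ℝ) := by
      have h3 := Real.log_le_rpow_div (x := 1 + s) (by linarith) (ε := 1 / 4) (by norm_num)
      have h4 : (1 + s) ^ (1 / 4 : ℝ) ≤ (16 * s) ^ (1 / 4 : ℝ) :=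
        Real.rpow_le_rpow (by linarith) (by linarith) (by norm_num)
      have h5 : (16 : ℝ) ^ (1 / 4 : ℝ) = 2 := by
        rw [show (16 : ℝ) = 2 ^ (4 : ℝ) by norm_num, ← Real.rpow_mul (by norm_num)]
        norm_num
      rw [Real.mul_rpow (by norm_num) hs0.le, h5] at h4
      linarith
    have h6 : s * (s ^ (-(3 / 4) : ℝ)) = s ^ (1 / 4 : ℝ) := by
      nth_rewrite 1 [← Real.rpow_one s]
      rw [← Real.rpow_add hs0]
      norm_num
    refine le_of_mul_le_mul_left (h1.trans ?_) hs0
    calc C * Real.log (1 + s) ≤ C * (8 * s ^ (1 / 4 : ℝ)) := by gcongr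
      _ = s * (C * 8 * s ^ (-(3 / 4) : ℝ)) := by rw [← h6]; ring
  · have hp0 : (0 : ℝ) < p := by positivity
    refine ⟨C, 1 / p, hC0, ?_, fun _ => rfl, fun s hs => ?_⟩
    · rw [one_div_mul_eq_div, one_lt_div hp0]; linarith
    · have hs0 : 0 < s := by linarith
      have h1 := hC' s hs
      have hg : gauge p s = s * s ^ (-(1 / p : ℝ)) := by
        have hne : (p : ℝ) ≠ 1 := by exact_mod_cast hp1.ne'
        have e : s ^ (1 - 1 / p : ℝ) = s * s ^ (-(1 / p : ℝ)) := by
          rw [sub_eq_add_neg, Real.rpow_add hs0, Real.rpow_one]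
        unfold gauge
        rw [if_neg hne]
        split_ifs with h2
        · rw [le_antisymm h2 hs, Real.one_rpow, one_mul]
        · exact e
      rw [hg] at h1
      refine le_of_mul_le_mul_left (h1.trans (le_of_eq ?_)) hs0
      ring

/-- For p = 1 this is the hypothesis. For p > 1, μ_s(R) = O(s^(-1/p)) gives μ_s(R^p) = O(1/s), whose
integral grows like the logarithm. -/
theorem pow_mem_dixmierCone (h : IsFaithfulNormalSemifiniteTrace N τ)
    {R : H →L[ℂ] H} (hR0 : 0 ≤ R) {p : ℕ} (hp : 1 ≤ p) (hR : R ∈ weakIdeal N τ p) :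
    R ^ p ∈ dixmierCone N τ := by
  have hRN := hR.1
  refine ⟨pow_mem hRN p, CStarAlgebra.pow_nonneg hR0 p, ?_⟩
  rcases hp.eq_or_lt with rfl | hp1
  · obtain ⟨-, C, hC⟩ := hR
    refine ⟨C, fun t ht => ?_⟩
    have := hC t ht
    simp only [gauge, Nat.cast_one, if_true] at this
    rw [pow_one]
    exact (div_le_iff₀ (log_one_add_pos ht)).1 this
  · obtain ⟨C, a, hC0, -, ha, hC⟩ := h.exists_singularValue_le_rpow hp hR
    have hp0 : (0 : ℝ) < p := by positivity
    have hsv : ∀ s, 1 ≤ s → singularValue N τ s (R ^ p) ≤ C ^ p * s⁻¹ := by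
      intro s hs
      have hs0 : 0 < s := by linarith
      refine (h.singularValue_pow_le hRN hR0 s p).trans ?_
      refine (pow_le_pow_left₀ (singularValue_nonneg s R) (hC s hs) p).trans (le_of_eq ?_)
      rw [mul_pow, ← Real.rpow_natCast (s ^ (-a)), ← Real.rpow_mul hs0.le, ha hp1]
      congr 1
      rw [show -(1 / (p : ℝ)) * p = -1 by field_simp, Real.rpow_neg_one]
    -- The norm term covers t ≤ 1 as well as the contribution of (0, 1) for t ≥ 1, where 1 ≤ 2 log(1
    -- + t); the term C^p covers ∫_1^t ds/s.
    refine ⟨2 * ‖R ^ p‖ + C ^ p, fun t ht => ?_⟩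
    have hl := log_one_add_pos ht
    have hn := norm_nonneg (R ^ p)
    have hCp : 0 ≤ C ^ p := by positivity
    have hlog := Real.one_sub_inv_le_log_of_pos (x := 1 + t) (by linarith)
    have e : 1 - (1 + t)⁻¹ = t / (1 + t) := by field_simp; ring
    rw [e] at hlog
    rcases le_total t 1 with ht1 | ht1
    · have h1 := h.kyFan_le_mul_norm (R ^ p) ht.le
      have h2 : t ≤ 2 * Real.log (1 + t) := by
        have : t / 2 ≤ t / (1 + t) := div_le_div_of_nonneg_left ht.le (by linarith) (by linarith)
        linarith
      nlinarith
    · have hni : (0 : ℝ) ∉ Set.uIcc 1 t := by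
        rw [Set.uIcc_of_le ht1]; intro hh; linarith [hh.1]
      have hi : IntervalIntegrable (fun s : ℝ => C ^ p * s⁻¹) volume 1 t :=
        (intervalIntegral.intervalIntegrable_inv (fun x hx h0 => hni (h0 ▸ hx))
          continuousOn_id).const_mul _
      have h1 := h.kyFan_le_norm_add (R ^ p) ht1 hi hsv
      rw [intervalIntegral.integral_const_mul, integral_inv_of_pos one_pos ht, div_one] at h1
      have h2 : 1 ≤ 2 * Real.log (1 + t) := by
        have : 1 / 2 ≤ t / (1 + t) := by
          rw [div_le_div_iff₀ (by norm_num) (by linarith)]; linarith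
        linarith
      have h3 : Real.log t ≤ Real.log (1 + t) := Real.log_le_log ht (by linarith)
      nlinarith

theorem trace_pow_succ_lt_top (h : IsFaithfulNormalSemifiniteTrace N τ)
    {R : H →L[ℂ] H} (hR0 : 0 ≤ R) {p : ℕ} (hp : 1 ≤ p) (hR : R ∈ weakIdeal N τ p) :
    τ (R ^ (p + 1)) < ∞ := by
  have hRN := hR.1
  obtain ⟨C, a, hC0, ha, -, hC⟩ := h.exists_singularValue_le_rpow hp hR
  refine h.lt_top_of_kyFan_le (pow_mem hRN _) (CStarAlgebra.pow_nonneg hR0 _)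
    (h.exists_kyFan_le_of_singularValue_le_rpow (R ^ (p + 1)) (C := C ^ (p + 1)) ha ?_)
  intro s hs
  have hs0 : 0 < s := by linarith
  refine (h.singularValue_pow_le hRN hR0 s _).trans ?_
  refine (pow_le_pow_left₀ (singularValue_nonneg s R) (hC s hs) _).trans (le_of_eq ?_)
  rw [mul_pow, ← Real.rpow_natCast (s ^ (-a)), ← Real.rpow_mul hs0.le]
  push_cast
  rw [neg_mul]

end IsFaithfulNormalSemifiniteTrace

end Summability

/-! ### Hölder inequality and vanishing of the Dixmier trace on terms of order p + 1 -/

section Holder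

variable {H : Type*} [NormedAddCommGroup H] [InnerProductSpace ℂ H] [CompleteSpace H]

/-- A discrete maximum principle, used in place of a three-lines argument for Hölder. -/
theorem le_of_midpoint_convex {s : ℕ → ℝ} {q : ℕ} {M : ℝ} (h0 : s 0 ≤ M) (hq : s q ≤ M)
    (hc : ∀ j, j + 2 ≤ q → 2 * s (j + 1) ≤ s j + s (j + 2)) {j : ℕ} (hj : j ≤ q) : s j ≤ M := by
  -- The chord inequality from 0 to j + 1; combined with the bound at j + 1, it bounds the value at
  -- j, descending from q.
  have key : ∀ j : ℕ, j + 1 ≤ q → (j + 1) * s j ≤ j * s (j + 1) + s 0 := by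
    intro j
    induction j with
    | zero => intro _; simp
    | succ j ih =>
      intro hj
      have h1 := ih (by omega)
      have h2 := mul_le_mul_of_nonneg_left (hc j hj) (by positivity : (0 : ℝ) ≤ j + 1)
      push_cast
      linarith
  induction hj using Nat.decreasingInduction with
  | self => exact hq
  | of_succ k hk ih =>
    have h1 := key k hk
    have h2 := mul_le_mul_of_nonneg_left ih (by positivity : (0 : ℝ) ≤ k)
    exact le_of_mul_le_mul_left (h1.trans (by linarith)) (by positivity : (0 : ℝ) < k + 1)

namespace IsTraceCone

variable {N : VonNeumannAlgebra H} {J : Set (H →L[ℂ] H)} {f : (H →L[ℂ] H) → ℝ}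

theorem mem_of_mem_span_of_nonneg (h : IsTraceCone N J f) {T : H →L[ℂ] H}
    (hT : T ∈ Submodule.span ℂ J) (hT0 : 0 ≤ T) : T ∈ J := by
  have h1 := (h.parts_mem_diffCone hT).1
  rw [(IsSelfAdjoint.of_nonneg hT0).coe_realPart] at h1
  obtain ⟨P, hP, Q, hQ, e⟩ := h1
  refine h.mem_of_le hP (h.mem_of_mem_span hT) hT0 ?_
  rw [e]
  exact sub_le_self P (h.nonneg Q hQ)

/-- Positivity of f on (X - Y)* (X - Y): Cauchy–Schwarz in arithmetic-mean form. -/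
theorem two_mul_re_le (h : IsTraceCone N J f) {X Y : H →L[ℂ] H} (hX : X ∈ Submodule.span ℂ J)
    (hY : Y ∈ Submodule.span ℂ J) :
    2 * (complexExt f (star X * Y)).re
      ≤ (complexExt f (star X * X)).re + (complexExt f (star Y * Y)).re := by
  have hXN := h.mem_of_mem_span hX
  have hYN := h.mem_of_mem_span hY
  have hXX := h.mul_mem_span_left (star_mem hXN) hX
  have hXY := h.mul_mem_span_left (star_mem hXN) hY
  have hYY := h.mul_mem_span_left (star_mem hYN) hY
  have hD := h.mem_of_mem_span_of_nonneg
    (h.mul_mem_span_left (star_mem (sub_mem hXN hYN)) (sub_mem hX hY)) (star_mul_self_nonneg _)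
  have e : star (X - Y) * (X - Y)
      = star X * X + star Y * Y - (star X * Y + star (star X * Y)) := by
    rw [star_sub, star_mul, star_star]; noncomm_ring
  have h1 := h.complexExt_of_mem hD
  rw [e, h.complexExt_sub (add_mem hXX hYY) (add_mem hXY (h.star_mem_span hXY)),
    h.complexExt_add hXX hYY, h.complexExt_add hXY (h.star_mem_span hXY),
    h.complexExt_star hXY, ← e] at h1
  have h2 := congrArg Complex.re h1
  have h3 := h.map_nonneg _ hD
  simp only [Complex.sub_re, Complex.add_re, Complex.ofReal_re, Complex.star_def,
    Complex.conj_re] at h2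
  linarith

variable {C : H →L[ℂ] H}

theorem mul_pow_mul_pow_mem_span (h : IsTraceCone N J f) (hC : C ∈ N)
    (hCJ : ∀ k, 1 ≤ k → C ^ k ∈ J) {S T B : H →L[ℂ] H} (hS : S ∈ N) (hT : T ∈ N) (hB : B ∈ N)
    {m n : ℕ} (hmn : 1 ≤ m + n) : T * C ^ m * B * C ^ n * S ∈ Submodule.span ℂ J := by
  refine h.mul_mem_span_right hS ?_
  rcases Nat.eq_zero_or_pos n with rfl | hn
  · exact h.mul_mem_span_right (pow_mem hC _) (h.mul_mem_span_right hB (h.mul_mem_span_left hT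
      (Submodule.subset_span (hCJ m (by omega)))))
  · exact h.mul_mem_span_left (mul_mem (mul_mem hT (pow_mem hC _)) hB)
      (Submodule.subset_span (hCJ n hn))

/-- Apply `two_mul_re_le` to X = C^(v+2) T* C^u and Y = C^v B C^(u+2), then cycle the outer powers
of C together. The total power of C is the same in all three terms, so the suprema over contractions
T, B are midpoint convex in the exponent of the first power. -/
theorem holder_midpoint (h : IsTraceCone N J f) (hC : C ∈ N) (hCs : IsSelfAdjoint C)
    (hCJ : ∀ k, 1 ≤ k → C ^ k ∈ J) {T B : H →L[ℂ] H} (hT : T ∈ N) (hB : B ∈ N) (u v : ℕ) :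
    2 * (complexExt f (T * C ^ (2 * (v + 1)) * B * C ^ (2 * (u + 1)))).re
      ≤ (complexExt f (T * C ^ (2 * (v + 2)) * star T * C ^ (2 * u))).re
        + (complexExt f (star B * C ^ (2 * v) * B * C ^ (2 * (u + 2)))).re := by
  have hCk : ∀ k, star (C ^ k) = C ^ k := fun k => (hCs.pow k).star_eq
  have hN : ∀ k, C ^ k ∈ N := fun k => pow_mem hC k
  have hTs := star_mem hT
  have hBs := star_mem hB
  have hX : C ^ (v + 2) * star T * C ^ u ∈ Submodule.span ℂ J := by
    have := h.mul_pow_mul_pow_mem_span hC hCJ (one_mem N) (one_mem N) hTs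
      (m := v + 2) (n := u) (by omega)
    rwa [one_mul, mul_one] at this
  have hY : C ^ v * B * C ^ (u + 2) ∈ Submodule.span ℂ J := by
    have := h.mul_pow_mul_pow_mem_span hC hCJ (one_mem N) (one_mem N) hB
      (m := v) (n := u + 2) (by omega)
    rwa [one_mul, mul_one] at this
  have key := h.two_mul_re_le hX hY
  have e1 : star (C ^ (v + 2) * star T * C ^ u) * (C ^ v * B * C ^ (u + 2))
      = C ^ u * (T * C ^ (2 * (v + 1)) * B * C ^ (u + 2)) := by
    rw [show 2 * (v + 1) = (v + 2) + v by omega, pow_add C (v + 2) v]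
    simp only [star_mul, hCk, star_star, mul_assoc]
  have e2 : star (C ^ (v + 2) * star T * C ^ u) * (C ^ (v + 2) * star T * C ^ u)
      = C ^ u * (T * C ^ (2 * (v + 2)) * star T * C ^ u) := by
    rw [show 2 * (v + 2) = (v + 2) + (v + 2) by omega, pow_add C (v + 2) (v + 2)]
    simp only [star_mul, hCk, star_star, mul_assoc]
  have e3 : star (C ^ v * B * C ^ (u + 2)) * (C ^ v * B * C ^ (u + 2))
      = C ^ (u + 2) * (star B * C ^ (2 * v) * B * C ^ (u + 2)) := by
    rw [two_mul, pow_add C v v]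
    simp only [star_mul, hCk, mul_assoc]
  have m1 : ∀ {S S' : H →L[ℂ] H}, S ∈ N → S' ∈ N → ∀ {m n : ℕ}, 1 ≤ m + n →
      S * C ^ m * S' * C ^ n ∈ Submodule.span ℂ J := fun hS hS' _ _ hmn => by
    have := h.mul_pow_mul_pow_mem_span hC hCJ (one_mem N) hS hS' hmn
    rwa [mul_one] at this
  rw [e1, e2, e3, h.complexExt_mul_comm (hN u) (m1 hT hB (by omega)),
    h.complexExt_mul_comm (hN u) (m1 hT hTs (by omega)),
    h.complexExt_mul_comm (hN (u + 2)) (m1 hBs hB (by omega))] at key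
  simp only [mul_assoc, ← pow_add] at key ⊢
  rwa [show u + 2 + u = 2 * (u + 1) by omega, show u + u = 2 * u by omega,
    show u + 2 + (u + 2) = 2 * (u + 2) by omega] at key

/-- Hölder's inequality for products with two powers of one positive operator. -/
theorem re_complexExt_le (h : IsTraceCone N J f) (hC : C ∈ N) (hCs : IsSelfAdjoint C)
    (hCJ : ∀ k, 1 ≤ k → C ^ k ∈ J) {T B : H →L[ℂ] H} (hT : T ∈ N) (hB : B ∈ N) {m n : ℕ}
    (hmn : 1 ≤ m + n) :
    (complexExt f (T * C ^ (2 * m) * B * C ^ (2 * n))).re ≤ ‖T‖ * ‖B‖ * f (C ^ (2 * (m + n))) := by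
  have hN : ∀ k, C ^ k ∈ N := fun k => pow_mem hC k
  have m1 : ∀ {S S' : H →L[ℂ] H}, S ∈ N → S' ∈ N → ∀ {m n : ℕ}, 1 ≤ m + n →
      S * C ^ m * S' * C ^ n ∈ Submodule.span ℂ J := fun hS hS' _ _ hmn => by
    have := h.mul_pow_mul_pow_mem_span hC hCJ (one_mem N) hS hS' hmn
    rwa [mul_one] at this
  set q := m + n with hq
  set M := f (C ^ (2 * q)) with hM
  have hM0 : 0 ≤ M := h.map_nonneg _ (hCJ _ (by omega))
  -- Values over all contractions T, B, with exponent j on one power and q - j on the other. At j =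
  -- 0 and j = q the powers merge and the bound M is immediate; convexity covers the exponents
  -- between.
  let Φ : ℕ → Set ℝ := fun j => {r | ∃ T ∈ N, ∃ B ∈ N, ‖T‖ ≤ 1 ∧ ‖B‖ ≤ 1 ∧
    r = (complexExt f (T * C ^ (2 * j) * B * C ^ (2 * (q - j)))).re}
  have hne : ∀ j, (Φ j).Nonempty := fun j => ⟨_, 0, zero_mem N, 0, zero_mem N, by simp, by simp, rfl⟩
  have hre : ∀ {S P : H →L[ℂ] H}, S ∈ N → ‖S‖ ≤ 1 → P ∈ J → (complexExt f (S * P)).re ≤ f P := by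
    intro S P hS hS1 hP
    refine (Complex.re_le_norm _).trans ((h.norm_complexExt_mul_le hS hP).trans ?_)
    exact mul_le_of_le_one_left (h.map_nonneg P hP) hS1
  have hend : ∀ r ∈ Φ q, r ≤ M := by
    rintro _ ⟨T, hT, B, hB, hT1, hB1, rfl⟩
    rw [Nat.sub_self, mul_zero, pow_zero, mul_one,
      ← h.complexExt_mul_comm hB (h.mul_mem_span_left hT
        (Submodule.subset_span (hCJ _ (by omega)))), ← mul_assoc]
    exact hre (mul_mem hB hT) ((norm_mul_le _ _).trans (mul_le_one₀ hB1 (norm_nonneg _) hT1))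
      (hCJ _ (by omega))
  have hstart : ∀ r ∈ Φ 0, r ≤ M := by
    rintro _ ⟨T, hT, B, hB, hT1, hB1, rfl⟩
    rw [mul_zero, pow_zero, mul_one, Nat.sub_zero]
    exact hre (mul_mem hT hB) ((norm_mul_le _ _).trans (mul_le_one₀ hT1 (norm_nonneg _) hB1))
      (hCJ _ (by omega))
  -- A crude bound depending on j suffices: real suprema are meaningful only for bounded sets.
  have hbdd : ∀ j ≤ q, BddAbove (Φ j) := by
    intro j hj
    rcases hj.eq_or_lt with rfl | hlt
    · exact ⟨M, hend⟩
    · refine ⟨‖C ^ (2 * j)‖ * f (C ^ (2 * (q - j))), ?_⟩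
      rintro _ ⟨T, hT, B, hB, hT1, hB1, rfl⟩
      have hJ := hCJ (2 * (q - j)) (by omega)
      refine (Complex.re_le_norm _).trans ((h.norm_complexExt_mul_le
        (mul_mem (mul_mem hT (hN _)) hB) hJ).trans ?_)
      refine mul_le_mul_of_nonneg_right ?_ (h.map_nonneg _ hJ)
      calc ‖T * C ^ (2 * j) * B‖ ≤ ‖T‖ * ‖C ^ (2 * j)‖ * ‖B‖ := norm_mul₃_le
        _ ≤ 1 * ‖C ^ (2 * j)‖ * 1 := by gcongr
        _ = _ := by ring
  have key : sSup (Φ m) ≤ M := by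
    refine le_of_midpoint_convex (s := fun j => sSup (Φ j)) (q := q) (csSup_le (hne 0) hstart)
      (csSup_le (hne q) hend) (fun j hj => ?_) (by omega)
    obtain ⟨u, hu⟩ : ∃ u, q = j + u + 2 := ⟨q - j - 2, by omega⟩
    rw [← le_div_iff₀' two_pos]
    refine csSup_le (hne _) ?_
    rintro _ ⟨T, hT, B, hB, hT1, hB1, rfl⟩
    rw [le_div_iff₀' two_pos, show q - (j + 1) = u + 1 by omega]
    refine (h.holder_midpoint hC hCs hCJ hT hB u j).trans ?_
    rw [add_comm]
    refine add_le_add (le_csSup (hbdd j (by omega)) ⟨star B, star_mem hB, B, hB, by rwa [norm_star],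
      hB1, ?_⟩) (le_csSup (hbdd (j + 2) (by omega)) ⟨T, hT, star T, star_mem hT, hT1,
        by rwa [norm_star], ?_⟩)
    · rw [show q - j = u + 2 by omega]
    · rw [show q - (j + 2) = u by omega]
  rcases eq_or_ne T 0 with rfl | hT0
  · simp [h.complexExt_zero]
  rcases eq_or_ne B 0 with rfl | hB0
  · simp [h.complexExt_zero]
  have hTp := norm_pos_iff.2 hT0
  have hBp := norm_pos_iff.2 hB0
  have hns : ∀ {S : H →L[ℂ] H}, 0 < ‖S‖ → ‖((‖S‖⁻¹ : ℝ) : ℂ) • S‖ ≤ 1 := by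
    intro S hS
    rw [norm_smul, Complex.norm_real, Real.norm_of_nonneg (inv_nonneg.2 hS.le),
      inv_mul_cancel₀ hS.ne']
  have h1 := le_csSup (hbdd m (by omega)) ⟨((‖T‖⁻¹ : ℝ) : ℂ) • T, smul_mem_vonNeumann _ hT,
    ((‖B‖⁻¹ : ℝ) : ℂ) • B, smul_mem_vonNeumann _ hB, hns hTp, hns hBp, rfl⟩
  rw [show q - m = n by omega] at h1
  simp only [smul_mul_assoc, mul_smul_comm] at h1
  rw [h.complexExt_smul _ (Submodule.smul_mem _ _ (m1 hT hB (by omega))),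
    h.complexExt_smul _ (m1 hT hB (by omega)), Complex.re_ofReal_mul, Complex.re_ofReal_mul] at h1
  have h2 := mul_le_mul_of_nonneg_left (h1.trans key) (mul_nonneg hTp.le hBp.le)
  refine le_trans (le_of_eq ?_) h2
  field_simp

end IsTraceCone

namespace IsFaithfulNormalSemifiniteTrace

variable {N : VonNeumannAlgebra H} {τ : (H →L[ℂ] H) → ℝ≥0∞}

/-- With zero scalar part, the K-functional of W = ℜ Y is controlled by the trace of its positive
part. Approximating that part by G W with a contraction G = g(W), the trace is Re τ(G Y), which
Hölder bounds independently of t. -/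
theorem kFun_realPart_le_of_pow_mem (h : IsFaithfulNormalSemifiniteTrace N τ) {C : H →L[ℂ] H}
    (hC : C ∈ N) (hCs : IsSelfAdjoint C)
    (hCJ : ∀ k, 1 ≤ k → C ^ k ∈ {T | T ∈ N ∧ 0 ≤ T ∧ τ T < ∞}) {T B : H →L[ℂ] H} (hT : T ∈ N)
    (hB : B ∈ N) {m n : ℕ} (hmn : 1 ≤ m + n) {t : ℝ} (ht : 0 ≤ t) :
    kFun N τ t (ℜ (T * C ^ (2 * m) * B * C ^ (2 * n)) : H →L[ℂ] H)
      ≤ ENNReal.ofReal (‖T‖ * ‖B‖ * (τ (C ^ (2 * (m + n)))).toReal) := by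
  have hJ := h.isTraceCone
  set Y := T * C ^ (2 * m) * B * C ^ (2 * n) with hY
  have hYs : Y ∈ Submodule.span ℂ {T | T ∈ N ∧ 0 ≤ T ∧ τ T < ∞} := by
    have := hJ.mul_pow_mul_pow_mem_span hC hCJ (one_mem N) hT hB
      (m := 2 * m) (n := 2 * n) (by omega)
    rwa [mul_one] at this
  have hYN := hJ.mem_of_mem_span hYs
  set W : H →L[ℂ] H := (ℜ Y : H →L[ℂ] H) with hW
  have hWe : W = ((1 / 2 : ℝ) : ℂ) • (Y + star Y) := by
    rw [hW, realPart_apply_coe, Complex.coe_smul]; norm_num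
  have hWs : W ∈ Submodule.span ℂ {T | T ∈ N ∧ 0 ≤ T ∧ τ T < ∞} := by
    rw [hWe]
    exact Submodule.smul_mem _ _ (add_mem hYs (hJ.star_mem_span hYs))
  have hWN := hJ.mem_of_mem_span hWs
  have hWsa : IsSelfAdjoint W := (ℜ Y).2
  refine kFun_le_of_forall_le_add ht fun e he => ?_
  let g : ℝ → ℝ := fun x => min 1 (e⁻¹ * max x 0)
  have hg : Continuous g := by fun_prop
  have hg0 : ∀ x, 0 ≤ g x := fun x => by positivity
  have hgx : ∀ x, 0 ≤ g x * x := by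
    intro x
    rcases le_total x 0 with hx | hx
    · simp only [g, max_eq_right hx, mul_zero, min_eq_right zero_le_one, zero_mul, le_refl]
    · exact mul_nonneg (hg0 x) hx
  have hgle : ∀ x, x ≤ g x * x + e := by
    intro x
    rcases le_total x e with hx | hx
    · linarith [hgx x]
    · have : g x = 1 := by
        refine min_eq_left ?_
        rw [max_eq_left (by linarith), inv_mul_eq_div, one_le_div he]
        exact hx
      rw [this]; linarith
  set G : H →L[ℂ] H := cfc g W with hG
  have hGN : G ∈ N := cfc_mem_vonNeumann hWN g
  have hGn : ‖G‖ ≤ 1 := by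
    refine norm_cfc_le zero_le_one fun x _ => ?_
    rw [Real.norm_of_nonneg (hg0 x)]
    exact min_le_left _ _
  have hGs : star G = G := (cfc_predicate g W : IsSelfAdjoint _).star_eq
  have hP : G * W = cfc (fun x => g x * x) W := by
    rw [cfc_mul g (fun x => x) W hg.continuousOn continuousOn_id, cfc_id' ℝ W]
  have hPJ : G * W ∈ {T | T ∈ N ∧ 0 ≤ T ∧ τ T < ∞} := by
    refine hJ.mem_of_mem_span_of_nonneg (hJ.mul_mem_span_left hGN hWs) ?_
    rw [hP]
    exact cfc_nonneg fun x _ => hgx x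
  refine ⟨G * W, ?_, ?_⟩
  · rw [hP, cfc_add_smul_one hWsa (by fun_prop)]
    nth_rewrite 1 [← cfc_id' ℝ W]
    exact cfc_mono (fun x _ => hgle x) (by fun_prop) (by fun_prop)
  · have h1 := kFun_le (N := N) (τ := τ) (t := t) (Y := G * W) hPJ.1 hPJ.2.1 le_rfl (by simp)
    rw [mul_zero, ENNReal.ofReal_zero, add_zero] at h1
    refine h1.trans ?_
    rw [← ENNReal.ofReal_toReal hPJ.2.2.ne]
    refine ENNReal.ofReal_le_ofReal ?_
    have h2 := congrArg Complex.re (hJ.complexExt_of_mem hPJ)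
    rw [Complex.ofReal_re] at h2
    rw [← h2, hWe, mul_smul_comm, mul_add,
      hJ.complexExt_smul _ (add_mem (hJ.mul_mem_span_left hGN hYs)
        (hJ.mul_mem_span_left hGN (hJ.star_mem_span hYs))),
      hJ.complexExt_add (hJ.mul_mem_span_left hGN hYs)
        (hJ.mul_mem_span_left hGN (hJ.star_mem_span hYs))]
    -- G is self-adjoint, so cyclicity gives τ(G Y*) = conj τ(G Y); hence τ(G W) = Re τ(G Y).
    have h3 : complexExt (fun T => (τ T).toReal) (G * star Y)
        = star (complexExt (fun T => (τ T).toReal) (G * Y)) := by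
      rw [hJ.complexExt_mul_comm hGN hYs, ← hJ.complexExt_star (hJ.mul_mem_span_right hGN hYs),
        star_mul Y G, hGs]
    rw [h3, Complex.re_ofReal_mul, Complex.add_re, Complex.star_def, Complex.conj_re]
    have h4 := hJ.re_complexExt_le hC hCs hCJ (mul_mem hGN hT) hB hmn
    have h5 : G * Y = G * T * C ^ (2 * m) * B * C ^ (2 * n) := by
      rw [hY]; simp only [mul_assoc]
    have h6 : ‖G * T‖ ≤ ‖T‖ :=
      (norm_mul_le _ _).trans (mul_le_of_le_one_left (norm_nonneg _) hGn)
    rw [← h5] at h4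
    have h7 : ‖G * T‖ * ‖B‖ * (τ (C ^ (2 * (m + n)))).toReal
        ≤ ‖T‖ * ‖B‖ * (τ (C ^ (2 * (m + n)))).toReal := by gcongr
    linarith

/-- Only R^(m+n) need have finite trace. Replace R by (R - ε)⁺ = C², which is close in norm; every
positive power of C has finite trace, and the norm error is absorbed by `kFun_le_of_forall_le_add`.
-/
theorem kFun_realPart_le (h : IsFaithfulNormalSemifiniteTrace N τ) {R : H →L[ℂ] H}
    (hR : R ∈ N) (hR0 : 0 ≤ R) {T B : H →L[ℂ] H} (hT : T ∈ N)
    (hB : B ∈ N) {m n : ℕ} (hmn : 1 ≤ m + n) (hfin : τ (R ^ (m + n)) < ∞) {t : ℝ} (ht : 0 ≤ t) :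
    kFun N τ t (ℜ (T * R ^ m * B * R ^ n) : H →L[ℂ] H)
      ≤ ENNReal.ofReal (‖T‖ * ‖B‖ * (τ (R ^ (m + n))).toReal) := by
  have hRs : IsSelfAdjoint R := .of_nonneg hR0
  refine kFun_le_of_forall_le_add ht fun e he => ?_
  have hcont : Continuous fun A : H →L[ℂ] H => T * A ^ m * B * A ^ n := by fun_prop
  obtain ⟨δ, hδ, hclose⟩ := Metric.continuous_iff.1 hcont R e he
  set ε := δ / 2 with hε
  have hε0 : 0 < ε := by positivity
  let c : ℝ → ℝ := fun x => √(max (x - ε) 0)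
  have hcc : Continuous c := by fun_prop
  have hc2 : ∀ x, c x ^ 2 = max (x - ε) 0 := fun x => Real.sq_sqrt (le_max_right _ _)
  set C : H →L[ℂ] H := cfc c R with hCdef
  have hC : C ∈ N := cfc_mem_vonNeumann hR c
  have hCs : IsSelfAdjoint C := cfc_predicate c R
  have hCk : ∀ k, C ^ k = cfc (fun x => c x ^ k) R := fun k =>
    (cfc_pow c k R hcc.continuousOn).symm
  have hC2k : ∀ k, C ^ (2 * k) = cfc (fun x => max (x - ε) 0 ^ k) R := fun k => by
    rw [hCk]
    simp only [pow_mul, hc2]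
  have hRk : ∀ k, R ^ k = cfc (fun x : ℝ => x ^ k) R := fun k => (cfc_pow_id (R := ℝ) R k).symm
  have hRk0 : ∀ k, 0 ≤ R ^ k := fun k => CStarAlgebra.pow_nonneg hR0 k
  have hCJ : ∀ k, 1 ≤ k → C ^ k ∈ {T | T ∈ N ∧ 0 ≤ T ∧ τ T < ∞} := by
    intro k hk
    have hCk0 : 0 ≤ C ^ k := by
      rw [hCk]; exact cfc_nonneg fun x _ => pow_nonneg (Real.sqrt_nonneg _) k
    -- C^k vanishes where x ≤ ε and is at most √‖R‖^k elsewhere, so C^k ≤ K R^(m+n).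
    set K : ℝ := √‖R‖ ^ k / ε ^ (m + n) with hK
    have hK0 : 0 ≤ K := by positivity
    refine ⟨pow_mem hC k, hCk0, lt_of_le_of_lt (h.mono (pow_mem hC k)
      (real_smul_mem_vonNeumann K (pow_mem hR (m + n))) hCk0 ?_) ?_⟩
    · rw [hCk, hRk, ← cfc_smul K (fun x : ℝ => x ^ (m + n)) R]
      refine cfc_mono (fun x hx => ?_) (by fun_prop) (by fun_prop)
      have hx0 : 0 ≤ x := spectrum_nonneg_of_nonneg hR0 hx
      have hxR := le_norm_of_mem_spectrum hRs hx
      rcases le_total x ε with hxe | hxe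
      · have : c x = 0 := by
          simp only [c, max_eq_right (sub_nonpos.2 hxe), Real.sqrt_zero]
        rw [this, zero_pow (by omega)]
        exact smul_nonneg hK0 (by positivity)
      · have h1 : c x ≤ √‖R‖ := Real.sqrt_le_sqrt (max_le (by linarith) (norm_nonneg _))
        calc c x ^ k ≤ √‖R‖ ^ k := pow_le_pow_left₀ (Real.sqrt_nonneg _) h1 k
          _ = K * ε ^ (m + n) := by rw [hK]; field_simp
          _ ≤ K * x ^ (m + n) := by gcongr
    · rw [h.real_smul hK0 (pow_mem hR _) (hRk0 _)]
      exact ENNReal.mul_lt_top ENNReal.ofReal_lt_top hfin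
  have hCR : ‖C ^ 2 - R‖ < δ := by
    have e1 : C ^ 2 - R = cfc (fun x => max (x - ε) 0 - x) R := by
      rw [cfc_sub (fun x => max (x - ε) 0) (fun x => x) R, cfc_id' ℝ R, hCk]
      simp only [hc2]
    rw [e1]
    refine lt_of_le_of_lt (norm_cfc_le hε0.le fun x hx => ?_) (by linarith : ε < δ)
    have hx0 : 0 ≤ x := spectrum_nonneg_of_nonneg hR0 hx
    rw [Real.norm_eq_abs, abs_le]
    constructor
    · linarith [le_max_left (x - ε) 0]
    · have : max (x - ε) 0 ≤ x := max_le (by linarith) hx0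
      linarith
  refine ⟨(ℜ (T * C ^ (2 * m) * B * C ^ (2 * n)) : H →L[ℂ] H), ?_, ?_⟩
  · have h1 := hclose (C ^ 2) (by rwa [dist_eq_norm])
    rw [dist_eq_norm, ← pow_mul, ← pow_mul] at h1
    set Y := T * R ^ m * B * R ^ n
    set Y' := T * C ^ (2 * m) * B * C ^ (2 * n)
    have h2 : (ℜ (Y - Y') : H →L[ℂ] H) ≤ e • (1 : H →L[ℂ] H) := by
      refine (le_norm_smul_one (ℜ (Y - Y')).2).trans ?_
      have h3 : ‖(ℜ (Y - Y') : H →L[ℂ] H)‖ ≤ e := by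
        refine (realPart.norm_le (Y - Y')).trans ?_
        rw [norm_sub_rev]
        exact h1.le
      gcongr
    rw [map_sub, AddSubgroup.coe_sub, sub_le_iff_le_add'] at h2
    exact h2
  · refine (h.kFun_realPart_le_of_pow_mem hC hCs hCJ hT hB hmn ht).trans ?_
    refine ENNReal.ofReal_le_ofReal ?_
    gcongr
    · exact hfin.ne
    · refine h.mono (pow_mem hC _) (pow_mem hR _) (hCJ _ (by omega)).2.1 ?_
      rw [hC2k, hRk]
      exact cfc_le_cfc_of_nonneg hR0 (by fun_prop) (by fun_prop) fun x hx =>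
        pow_le_pow_left₀ (le_max_right _ _) (max_le (by linarith) hx) _

/-- The Dixmier trace vanishes on products which contain the positive operator `R` in total order
`m + n`, if `R ^ (m + n)` is of trace class. -/
theorem mul_pow_mul_pow_dixmierTrace (h : IsFaithfulNormalSemifiniteTrace N τ)
    {ω : LInfty →ₗ[ℝ] ℝ} (hω : IsDixmierFunctional ω) {R : H →L[ℂ] H}
    (hR : R ∈ N) (hR0 : 0 ≤ R) {T B : H →L[ℂ] H} (hT : T ∈ N)
    (hB : B ∈ N) {m n : ℕ} (hmn : 1 ≤ m + n) (hfin : τ (R ^ (m + n)) < ∞) :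
    T * R ^ m * B * R ^ n ∈ Submodule.span ℂ (dixmierCone N τ) ∧
      dixmierTrace N τ ω (T * R ^ m * B * R ^ n) = 0 := by
  have key : ∀ T ∈ N, (ℜ (T * R ^ m * B * R ^ n) : H →L[ℂ] H)⁺ ∈ dixmierCone N τ ∧
      dixmierTracePos N τ ω ((ℜ (T * R ^ m * B * R ^ n) : H →L[ℂ] H)⁺) = 0 := by
    intro T hT
    have hYN : T * R ^ m * B * R ^ n ∈ N :=
      mul_mem (mul_mem (mul_mem hT (pow_mem hR _)) hB) (pow_mem hR _)
    have hW := realPart_mem_vonNeumann hYN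
    refine h.dixmierTracePos_eq_zero hω (posPart_mem_vonNeumann hW) (CFC.posPart_nonneg _)
      (C := ‖T‖ * ‖B‖ * (τ (R ^ (m + n))).toReal) fun t ht => ?_
    exact h.kyFan_le_of_kFun_le ht.le (by positivity) (posPart_mem_vonNeumann hW)
      (CFC.posPart_nonneg _) ((h.kFun_posPart_le ht.le hW (ℜ (T * R ^ m * B * R ^ n)).2).trans
        (h.kFun_realPart_le hR hR0 hT hB hmn hfin ht.le))
  set Y := T * R ^ m * B * R ^ n with hY
  -- Multiplying T by 1, -1, -i and i turns the positive part of the real part into (ℜ Y)⁺, (ℜ Y)⁻,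
  -- (ℑ Y)⁺ and (ℑ Y)⁻.
  have k1 := key T hT
  have k2 := key (-T) (neg_mem hT)
  have k3 := key ((-Complex.I) • T) (smul_mem_vonNeumann _ hT)
  have k4 := key (Complex.I • T) (smul_mem_vonNeumann _ hT)
  simp only [neg_mul, smul_mul_assoc, ← hY, neg_smul, map_neg, AddSubgroup.coe_neg,
    realPart_I_smul, neg_neg, CFC.posPart_neg] at k1 k2 k3 k4
  refine ⟨IsTraceCone.mem_span_of_parts ⟨_, k1.1, _, k2.1, (CFC.posPart_sub_negPart _ (ℜ Y).2).symm⟩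
    ⟨_, k3.1, _, k4.1, (CFC.posPart_sub_negPart _ (ℑ Y).2).symm⟩, ?_⟩
  unfold dixmierTrace
  rw [k1.2, k2.2, k3.2, k4.2]
  simp

end IsFaithfulNormalSemifiniteTrace

end Holder

/-! ### Algebra of the Hochschild coboundary and of commutators with powers -/

section Telescoping

theorem contractNth_zero {A : Type*} [Mul A] {n : ℕ} (a : Fin (n + 2) → A) :
    Fin.contractNth 0 (· * ·) a = Fin.cons (a 0 * a 1) (fun i => a i.succ.succ) := by
  funext k
  refine Fin.cases ?_ (fun k => ?_) k
  · simp [Fin.contractNth]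
  · simp [Fin.contractNth]

theorem contractNth_succ {A : Type*} [Mul A] {n : ℕ} (a : Fin (n + 2) → A) (i : Fin (n + 1)) :
    Fin.contractNth i.succ (· * ·) a
      = Fin.cons (a 0) (Fin.contractNth i (· * ·) fun j => a j.succ) := by
  funext k
  refine Fin.cases ?_ (fun k => ?_) k
  · simp [Fin.contractNth]
  · simp [Fin.contractNth]

variable {A B : Type*} [Ring B]

/-- The product `d b_0 ⋯ d b_{n-1}`. -/
def prodMap (d : A → B) {n : ℕ} (b : Fin n → A) : B := (List.ofFn fun i => d (b i)).prod

theorem prodMap_succ (d : A → B) {n : ℕ} (b : Fin (n + 1) → A) :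
    prodMap d b = d (b 0) * prodMap d fun i => b i.succ := by
  rw [prodMap, List.ofFn_succ, List.prod_cons, prodMap]

theorem prodMap_cons (d : A → B) {n : ℕ} (x : A) (b : Fin n → A) :
    prodMap d (Fin.cons x b : Fin (n + 1) → A) = d x * prodMap d b := by
  rw [prodMap_succ]; simp

variable [Mul A] {d : A → B} {ι : A → B}

/-- By Leibniz each contraction splits into two terms, and neighbouring ones cancel; only the factor
that escapes at the left end and the one that escapes at the right end survive. -/
theorem sum_prodMap_contractNth (hd : ∀ x y, d (x * y) = d x * ι y + ι x * d y) {n : ℕ}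
    (b : Fin (n + 1) → A) :
    ∑ i : Fin n, (-1 : B) ^ (i : ℕ) * prodMap d (Fin.contractNth i.castSucc (· * ·) b)
      = ι (b 0) * prodMap d (fun i : Fin n => b i.succ)
        + (-1) ^ (n + 1) * (prodMap d (fun i : Fin n => b i.castSucc) * ι (b (Fin.last n))) := by
  induction n with
  | zero => simp [prodMap]
  | succ n ih =>
    have ih' := ih fun i => b i.succ
    rw [Fin.sum_univ_succ, Fin.castSucc_zero, contractNth_zero, prodMap_cons, hd]
    have e : ∀ i : Fin n, (-1 : B) ^ (i.succ : ℕ) *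
        prodMap d (Fin.contractNth i.succ.castSucc (· * ·) b)
        = -(d (b 0) * ((-1 : B) ^ (i : ℕ) *
          prodMap d (Fin.contractNth i.castSucc (· * ·) fun j => b j.succ))) := by
      intro i
      rw [← Fin.succ_castSucc, contractNth_succ, prodMap_cons, Fin.val_succ, pow_succ]
      have hc := ((Commute.neg_one_left (d (b 0))).pow_left (i : ℕ)).eq
      rw [← mul_assoc (d (b 0)), ← hc]
      noncomm_ring
    rw [Finset.sum_congr rfl fun i _ => e i, Finset.sum_neg_distrib, ← Finset.mul_sum, ih',
      prodMap_succ d (fun i : Fin (n + 1) => b i.succ),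
      prodMap_succ d (fun i : Fin (n + 1) => b i.castSucc)]
    have hc := ((Commute.neg_one_left (d (b 0))).pow_left (n + 1)).eq
    simp only [Fin.castSucc_zero, Fin.val_zero, pow_zero, one_mul, Fin.succ_last,
      ← Fin.succ_castSucc, Fin.succ_zero_eq_one, mul_add]
    rw [← mul_assoc (d (b 0)) ((-1) ^ (n + 1)), ← hc, pow_succ _ (n + 1)]
    noncomm_ring

/-- The Hochschild coboundary of the universal form `a_0 d a_1 ⋯ d a_n`, up to its last term. -/
theorem sum_form_contractNth (hι : ∀ x y, ι (x * y) = ι x * ι y)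
    (hd : ∀ x y, d (x * y) = d x * ι y + ι x * d y) {n : ℕ} (a : Fin (n + 2) → A) :
    ∑ i : Fin (n + 1), (-1 : B) ^ (i : ℕ) *
        (ι (Fin.contractNth i.castSucc (· * ·) a 0) *
          prodMap d fun j : Fin n => Fin.contractNth i.castSucc (· * ·) a j.succ)
      = (-1) ^ n * (ι (a 0) * prodMap d (fun j : Fin n => a j.succ.castSucc) *
          ι (a (Fin.last (n + 1)))) := by
  have key := sum_prodMap_contractNth hd fun i => a i.succ
  rw [Fin.sum_univ_succ, Fin.castSucc_zero, contractNth_zero]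
  have e : ∀ i : Fin n, (-1 : B) ^ (i.succ : ℕ) *
        (ι (Fin.contractNth i.succ.castSucc (· * ·) a 0) *
          prodMap d fun j : Fin n => Fin.contractNth i.succ.castSucc (· * ·) a j.succ)
      = -(ι (a 0) * ((-1 : B) ^ (i : ℕ) *
          prodMap d (Fin.contractNth i.castSucc (· * ·) fun j => a j.succ))) := by
    intro i
    rw [← Fin.succ_castSucc, contractNth_succ, Fin.val_succ, pow_succ]
    simp only [Fin.cons_zero, Fin.cons_succ]
    have hc := ((Commute.neg_one_left (ι (a 0))).pow_left (i : ℕ)).eq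
    rw [← mul_assoc (ι (a 0)), ← hc]
    noncomm_ring
  rw [Finset.sum_congr rfl fun i _ => e i, Finset.sum_neg_distrib, ← Finset.mul_sum, key]
  have hc := ((Commute.neg_one_left (ι (a 0))).pow_left (n + 1)).eq
  simp only [Fin.cons_zero, Fin.cons_succ, Fin.val_zero, pow_zero, one_mul, Fin.succ_last,
    ← Fin.succ_castSucc, Fin.succ_zero_eq_one, mul_add, hι]
  rw [← mul_assoc (ι (a 0)) ((-1) ^ (n + 1)), ← hc, pow_succ _ n]
  noncomm_ring

/-- Leibniz for [a, R^p]. Substituting R b R for [a, R] raises the total order in R of each summand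
from p to p + 1. -/
theorem mul_pow_sub_pow_mul {a R b : B} (h : a * R - R * a = R * b * R) (p : ℕ) :
    a * R ^ p - R ^ p * a = ∑ k ∈ Finset.range p, R ^ (k + 1) * b * R ^ (p - k) := by
  induction p with
  | zero => simp
  | succ p ih =>
    have e : a * R ^ (p + 1) - R ^ (p + 1) * a
        = (a * R ^ p - R ^ p * a) * R + R ^ p * (a * R - R * a) := by
      rw [pow_succ]; noncomm_ring
    rw [e, ih, h, Finset.sum_range_succ, Finset.sum_mul]
    congr 1
    · refine Finset.sum_congr rfl fun k hk => ?_
      rw [Finset.mem_range] at hk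
      rw [mul_assoc, ← pow_succ, show p - k + 1 = p + 1 - k by omega]
    · rw [show p + 1 - p = 1 by omega, pow_one, pow_succ]
      noncomm_ring

end Telescoping

/-! ### The multilinear form of a spectral triple and the cocycle identity -/

namespace SpectralTriple

variable {H : Type*} [NormedAddCommGroup H] [InnerProductSpace ℂ H] [CompleteSpace H]
  (X : SpectralTriple H)

theorem Γ_mem : X.Γ ∈ X.N := by
  rcases X.grading with h | h
  · rw [h]; exact one_mem X.N
  · exact h.1

theorem Γ_commute {a : H →L[ℂ] H} (ha : a ∈ X.A) : X.Γ * a = a * X.Γ := by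
  rcases X.grading with h | h
  · rw [h, one_mul, mul_one]
  · exact h.2.2.2.1 a ha

variable {X}

theorem IsQC.commutator_mem (hQC : X.IsQC 1) {a : H →L[ℂ] H} (ha : a ∈ X.A) :
    commutator X.D a ∈ X.N := (hQC a ha).2.1

theorem IsQC.exists_commutator_eq (hQC : X.IsQC 1) {a : H →L[ℂ] H} (ha : a ∈ X.A) :
    ∃ B ∈ X.N, a * invSqrtOneAddSq X.D - invSqrtOneAddSq X.D * a
      = invSqrtOneAddSq X.D * B * invSqrtOneAddSq X.D := by
  obtain ⟨ha', B, hB, hBN⟩ := (hQC a ha).1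
  exact hB.exists_commutator_eq X.selfAdjoint X.affiliated ha' hBN

theorem IsQC.map_mem_domain (hQC : X.IsQC 1) {a : H →L[ℂ] H} (ha : a ∈ X.A) :
    ∀ x ∈ X.D.domain, a x ∈ X.D.domain := by
  obtain ⟨B, -, hB⟩ := hQC.exists_commutator_eq ha
  exact fun x hx => map_mem_domain_of_commutator_eq X.selfAdjoint hB hx

variable (X) in
theorem isBoundedCommutator {a : H →L[ℂ] H} (ha : a ∈ X.A) :
    IsBoundedCommutator X.D a (commutator X.D a) := by
  obtain ⟨B, -, hB⟩ := X.commutator_bounded a ha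
  rwa [hB.commutator_eq]

theorem IsQC.commutator_mul (hQC : X.IsQC 1) (a b : X.A) :
    commutator X.D ((a * b : X.A) : H →L[ℂ] H)
      = commutator X.D a * (b : H →L[ℂ] H) + (a : H →L[ℂ] H) * commutator X.D b :=
  (isBoundedCommutator_mul X.selfAdjoint (X.isBoundedCommutator a.2) (X.isBoundedCommutator b.2)
    (hQC.map_mem_domain a.2) (hQC.map_mem_domain b.2)).commutator_eq

/-- The derivation `a ↦ [D, a]`. -/
def IsQC.commutatorLinearMap (hQC : X.IsQC 1) : X.A →ₗ[ℂ] (H →L[ℂ] H) where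
  toFun a := commutator X.D a
  map_add' a b := (isBoundedCommutator_add X.selfAdjoint (X.isBoundedCommutator a.2)
    (X.isBoundedCommutator b.2) (hQC.map_mem_domain a.2)
    (hQC.map_mem_domain b.2)).commutator_eq
  map_smul' c a := (isBoundedCommutator_smul X.selfAdjoint c (X.isBoundedCommutator a.2)
    (hQC.map_mem_domain a.2)).commutator_eq

variable (X) in
theorem formOp_eq (p : ℕ) (a : Fin (p + 1) → X.A) :
    X.formOp p a = X.Γ * ((a 0 : H →L[ℂ] H) *
      prodMap (fun x : X.A => commutator X.D x) fun i : Fin p => a i.succ)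
        * invSqrtOneAddSq X.D ^ p := by
  rw [formOp, prodMap, mul_assoc X.Γ]

theorem IsQC.prodMap_mem (hQC : X.IsQC 1) {n : ℕ} (b : Fin n → X.A) :
    prodMap (fun x : X.A => commutator X.D x) b ∈ X.N := by
  induction n with
  | zero => simp [prodMap]
  | succ n ih =>
    rw [prodMap_succ]
    exact mul_mem (hQC.commutator_mem (b 0).2) (ih _)

theorem norm_prodMap_le {n : ℕ} (b : Fin n → X.A) :
    ‖prodMap (fun x : X.A => commutator X.D x) b‖
      ≤ ∏ i, (‖(b i : H →L[ℂ] H)‖ + ‖commutator X.D (b i)‖) := by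
  induction n with
  | zero => simpa [prodMap] using! ContinuousLinearMap.norm_id_le (𝕜 := ℂ) (E := H)
  | succ n ih =>
    rw [prodMap_succ, Fin.prod_univ_succ]
    refine (norm_mul_le _ _).trans (mul_le_mul ?_ (ih _) (norm_nonneg _) (by positivity))
    exact le_add_of_nonneg_left (norm_nonneg _)

variable (X) in
/-- The inclusion of the algebra, as a linear map. -/
def coeLinearMap : X.A →ₗ[ℂ] (H →L[ℂ] H) where
  toFun a := a
  map_add' _ _ := rfl
  map_smul' _ _ := rfl

/-- The multilinear map `(a_0, …, a_p) ↦ Γ a_0 [D, a_1] ⋯ [D, a_p] (1 + D²)^(-p/2)`. -/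
def IsQC.formMultilinear (hQC : X.IsQC 1) (p : ℕ) :
    MultilinearMap ℂ (fun _ : Fin (p + 1) => X.A) (H →L[ℂ] H) :=
  ((LinearMap.mulRight ℂ (invSqrtOneAddSq X.D ^ p)).comp
    (LinearMap.mulLeft ℂ X.Γ)).compMultilinearMap
    ((MultilinearMap.mkPiAlgebraFin ℂ (p + 1) (H →L[ℂ] H)).compLinearMap
      (Fin.cons X.coeLinearMap
        fun _ : Fin p => hQC.commutatorLinearMap))

theorem IsQC.formMultilinear_apply (hQC : X.IsQC 1) (p : ℕ) (a : Fin (p + 1) → X.A) :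
    hQC.formMultilinear p a = X.formOp p a := by
  rw [formOp_eq, prodMap]
  change X.Γ * _ * _ = _
  congr 2
  rw [MultilinearMap.compLinearMap_apply, MultilinearMap.mkPiAlgebraFin_apply, List.ofFn_succ,
    List.prod_cons]
  rfl

end SpectralTriple

/-- The linear extension of `f`, as a linear map. -/
def IsTraceCone.complexExtLinearMap {H : Type*} [NormedAddCommGroup H] [InnerProductSpace ℂ H]
    [CompleteSpace H] {N : VonNeumannAlgebra H} {J : Set (H →L[ℂ] H)} {f : (H →L[ℂ] H) → ℝ}
    (h : IsTraceCone N J f) : Submodule.span ℂ J →ₗ[ℂ] ℂ where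
  toFun T := complexExt f T
  map_add' S T := h.complexExt_add S.2 T.2
  map_smul' c T := h.complexExt_smul c T.2

/-- The Hochschild class of the character: `φ_ω` is a Hochschild cocycle. -/
theorem SpectralTriple.isHochschildCocycle_dixmierTrace {H : Type*} [NormedAddCommGroup H]
    [InnerProductSpace ℂ H] [CompleteSpace H] (X : SpectralTriple H) (p : ℕ) (hp : 1 ≤ p)
    (hQC : X.IsQC 1) (hsum : X.IsWeaklySummable p) (ω : LInfty →ₗ[ℝ] ℝ)
    (hω : IsDixmierFunctional ω) :
    (∀ a : Fin (p + 1) → X.A, X.formOp p a ∈ weakIdeal X.N X.τ 1) ∧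
    IsHochschildCocycle X p
      (fun a => lambdaConst p * dixmierTrace X.N X.τ ω (X.formOp p a)) := by
  have h := X.isTrace
  have hJ := h.isTraceCone_dixmier hω
  have hRN : invSqrtOneAddSq X.D ∈ X.N := hsum.1
  have hR0 := invSqrtOneAddSq_nonneg X.D
  have hRp := h.pow_mem_dixmierCone hR0 hp hsum
  have hfin := h.trace_pow_succ_lt_top hR0 hp hsum
  set R := invSqrtOneAddSq X.D with hR
  set d : X.A → (H →L[ℂ] H) := fun x => SemifiniteNCG.commutator X.D x with hd
  have hθ : ∀ a : Fin (p + 1) → X.A,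
      X.Γ * ((a 0 : H →L[ℂ] H) * prodMap d fun i : Fin p => a i.succ) ∈ X.N := fun a =>
    mul_mem X.Γ_mem (mul_mem (X.A_subset _ (a 0).2) (hQC.prodMap_mem _))
  have hspan : ∀ a : Fin (p + 1) → X.A,
      X.formOp p a ∈ Submodule.span ℂ (dixmierCone X.N X.τ) := by
    intro a
    rw [X.formOp_eq]
    exact hJ.mul_mem_span_left (hθ a) (Submodule.subset_span hRp)
  refine ⟨fun a => ?_, ⟨?_, ?_⟩, ?_, fun a => ?_⟩
  · rw [X.formOp_eq]
    obtain ⟨C, hC⟩ := hRp.2.2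
    refine ⟨mul_mem (hθ a) (pow_mem hRN p),
      ‖X.Γ * ((a 0 : H →L[ℂ] H) * prodMap d fun i : Fin p => a i.succ)‖ * C, fun t ht => ?_⟩
    rw [SemifiniteNCG.gauge, if_pos rfl, div_le_iff₀ (log_one_add_pos ht), mul_assoc _ C]
    exact (h.kyFan_mul_le _ _ ht.le).trans (mul_le_mul_of_nonneg_left (hC t ht) (norm_nonneg _))
  · exact lambdaConst p • hJ.complexExtLinearMap.compMultilinearMap
      ((hQC.formMultilinear p).codRestrict _ fun a => by
        rw [hQC.formMultilinear_apply]; exact hspan a)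
  · funext a
    change lambdaConst p * complexExt _ (hQC.formMultilinear p a) = _
    rw [hQC.formMultilinear_apply]
    rfl
  · refine ⟨‖lambdaConst p‖ * (‖X.Γ‖ * dixmierTracePos X.N X.τ ω (R ^ p)), fun a => ?_⟩
    have hf0 := hJ.map_nonneg _ hRp
    rw [norm_mul, mul_assoc, X.formOp_eq, Fin.prod_univ_succ]
    refine mul_le_mul_of_nonneg_left ?_ (norm_nonneg _)
    refine (hJ.norm_complexExt_mul_le (hθ a) hRp).trans ?_
    rw [mul_right_comm]
    refine mul_le_mul_of_nonneg_right ?_ hf0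
    refine (norm_mul_le _ _).trans (mul_le_mul_of_nonneg_left ?_ (norm_nonneg _))
    refine (norm_mul_le _ _).trans (mul_le_mul (le_add_of_nonneg_right (norm_nonneg _))
      (X.norm_prodMap_le _) (norm_nonneg _) (by positivity))
  -- The cocycle identity: with Z as below, everything reduces to the vanishing of τ_ω(Z [b, R^p]).
  · set b : X.A := a (Fin.last (p + 1)) with hb
    set Z : H →L[ℂ] H := X.Γ * ((a 0 : H →L[ℂ] H) *
      prodMap d fun i : Fin p => a i.succ.castSucc) with hZ
    have hZN : Z ∈ X.N := hθ fun i => a i.castSucc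
    have hbN : (b : H →L[ℂ] H) ∈ X.N := X.A_subset _ b.2
    have hRs : R ^ p ∈ Submodule.span ℂ (dixmierCone X.N X.τ) := Submodule.subset_span hRp
    have hsign : ∀ (k : ℕ) (T : H →L[ℂ] H), T ∈ Submodule.span ℂ (dixmierCone X.N X.τ) →
        (-1 : ℂ) ^ k * dixmierTrace X.N X.τ ω T
          = complexExt (dixmierTracePos X.N X.τ ω) ((-1 : ℂ) ^ k • T) :=
      fun k T hT => (hJ.complexExt_smul _ hT).symm
    have e1 : ∑ i : Fin (p + 1), (-1 : ℂ) ^ (i : ℕ) *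
        dixmierTrace X.N X.τ ω (X.formOp p (Fin.contractNth i.castSucc (· * ·) a))
        = complexExt (dixmierTracePos X.N X.τ ω) ((-1 : ℂ) ^ p • (Z * b * R ^ p)) := by
      refine (Finset.sum_congr rfl fun (i : Fin (p + 1)) _ =>
        hsign (i : ℕ) (X.formOp p (Fin.contractNth i.castSucc (· * ·) a)) (hspan _)).trans ?_
      rw [← hJ.complexExt_sum _ _ fun i _ => Submodule.smul_mem _ _ (hspan _)]
      congr 1
      have key := sum_form_contractNth (d := d) (ι := fun x : X.A => (x : H →L[ℂ] H))
        (fun x y => rfl) hQC.commutator_mul a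
      have key2 := congrArg (fun T => X.Γ * T * R ^ p) key
      simp only [Finset.mul_sum, Finset.sum_mul] at key2
      have es : ∀ (k : ℕ) (T : H →L[ℂ] H), X.Γ * ((-1) ^ k * T) * R ^ p
          = (-1 : ℂ) ^ k • (X.Γ * T * R ^ p) := by
        intro k T
        rcases neg_one_pow_eq_or ℂ k with hk | hk <;>
        rcases Nat.even_or_odd k with hk' | hk' <;>
        simp [hk'.neg_one_pow]
      rw [es] at key2
      rw [hZ, mul_assoc X.Γ _ (b : H →L[ℂ] H), ← key2]
      refine Finset.sum_congr rfl fun i _ => ?_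
      rw [es, X.formOp_eq]
    -- Cyclicity brings b to the front of Z R^p, and b passes Γ because the grading commutes with
    -- the algebra.
    have e2 : dixmierTrace X.N X.τ ω (X.formOp p (Fin.cons (b * a 0)
          fun i : Fin p => a i.succ.castSucc))
        = complexExt (dixmierTracePos X.N X.τ ω) (Z * R ^ p * b) := by
      rw [← hJ.complexExt_mul_comm hbN (hJ.mul_mem_span_left hZN hRs), X.formOp_eq]
      change complexExt _ _ = _
      congr 1
      simp only [Fin.cons_zero, Fin.cons_succ]
      change X.Γ * ((b : H →L[ℂ] H) * (a 0 : H →L[ℂ] H) * _) * _ = _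
      rw [hZ]
      simp only [mul_assoc]
      rw [← mul_assoc X.Γ, X.Γ_commute b.2]
      simp only [mul_assoc]
      rfl
    have hs1 : Z * b * R ^ p ∈ Submodule.span ℂ (dixmierCone X.N X.τ) :=
      hJ.mul_mem_span_left (mul_mem hZN hbN) hRs
    have hs2 : Z * R ^ p * b ∈ Submodule.span ℂ (dixmierCone X.N X.τ) :=
      hJ.mul_mem_span_right hbN (hJ.mul_mem_span_left hZN hRs)
    have e3 : complexExt (dixmierTracePos X.N X.τ ω) (Z * b * R ^ p)
        = complexExt (dixmierTracePos X.N X.τ ω) (Z * R ^ p * b) := by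
      rw [← sub_eq_zero, ← hJ.complexExt_sub hs1 hs2]
      obtain ⟨B, hB, hBe⟩ := hQC.exists_commutator_eq b.2
      have hvan : ∀ k ∈ Finset.range p,
          Z * R ^ (k + 1) * B * R ^ (p - k) ∈ Submodule.span ℂ (dixmierCone X.N X.τ) ∧
          dixmierTrace X.N X.τ ω (Z * R ^ (k + 1) * B * R ^ (p - k)) = 0 := by
        intro k hk
        rw [Finset.mem_range] at hk
        -- The exponents k + 1 and p - k add up to p + 1, exactly the power of R with finite trace.
        refine h.mul_pow_mul_pow_dixmierTrace hω hRN hR0 hZN hB (by omega) ?_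
        rwa [show k + 1 + (p - k) = p + 1 by omega]
      have e : Z * b * R ^ p - Z * R ^ p * b
          = ∑ k ∈ Finset.range p, Z * R ^ (k + 1) * B * R ^ (p - k) := by
        rw [mul_assoc Z, mul_assoc Z, ← mul_sub, mul_pow_sub_pow_mul hBe, Finset.mul_sum]
        simp only [mul_assoc, hR]
      rw [e, hJ.complexExt_sum _ _ fun k hk => (hvan k hk).1]
      exact Finset.sum_eq_zero fun k hk => (hvan k hk).2
    -- The telescoped sum carries (-1)^p and the last term (-1)^(p+1), so the two equal values
    -- cancel.
    rw [hochschildCoboundary]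
    simp only [mul_left_comm _ (lambdaConst p)]
    rw [← Finset.mul_sum, e1, e2, hJ.complexExt_smul _ hs1, e3, pow_succ]
    ring

end SemifiniteNCG

theorem mainTheorem8 {H : Type*} [NormedAddCommGroup H] [InnerProductSpace ℂ H] [CompleteSpace H]
    (X : SemifiniteNCG.SpectralTriple H) (p : ℕ) (hp : 1 ≤ p)
    (hQC : X.IsQC 1) (hsum : X.IsWeaklySummable p)
    (ω : SemifiniteNCG.LInfty →ₗ[ℝ] ℝ) (hω : SemifiniteNCG.IsDixmierFunctional ω) :
    (∀ a : Fin (p + 1) → X.A, X.formOp p a ∈ SemifiniteNCG.weakIdeal X.N X.τ 1) ∧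
    SemifiniteNCG.IsHochschildCocycle X p
      (fun a => SemifiniteNCG.lambdaConst p *
        SemifiniteNCG.dixmierTrace X.N X.τ ω (X.formOp p a)) :=
  X.isHochschildCocycle_dixmierTrace p hp hQC hsum ω hω

end
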